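/- **Setting.** A *PT-DFA* is a tuple $(Q,\Sigma,\delta,\hat q,F)$ with $Q,\Sigma$ finite, $\hat q\in Q$, $F\subseteq Q$ and $\delta\subseteq Q\times\Sigma\times Q$ such that $(q,a,q_1),(q,a,q_2)\in\delta$ implies $q_1=q_2$. A state is *relevant* if it is $\hat q$, or if it is reachable from $\hat q$ and some state of $F$ is reachable from it. *Refinable partition* of $\{1,\dots,\mathit{max}\}$: arrays $elems, loc, sidx, first, end, mid$ and a counter $sets$; set number $s$ consists of $elems[first[s]],\dots,elems[end[s]-1]$, of which those before position $mid[s]$ are *marked*; $elems[loc[e]]=e$; $sidx[e]$ is the number of the set of $e$. Initially all elements form set $1$, unmarked (if $\mathit{max}=0$ there is no set). Operations: - $Size(s)=end[s]-first[s]$, $Set(e)=sidx[e]$, $First(s)=elems[first[s]]$; $No\_marks(s)$ tests $mid[s]=first[s]$; $Next(e)$ is $0$ if $loc[e]+1\ge end[sidx[e]]$ and $elems[loc[e]+1]$ otherwise. - $Mark(e)$: $s:=sidx[e]$, $\ell:=loc[e]$, $m:=mid[s]$; if $\ell\ge m$, then $elems[\ell]:=elems[m]$, $loc[elems[\ell]]:=\ell$,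 $elems[m]:=e$, $loc[e]:=m$, $mid[s]:=m+1$. - $Split(s)$: if $mid[s]=end[s]$ then $mid[s]:=first[s]$. If now $mid[s]=first[s]$ return $0$; otherwise $sets:=sets+1$, $first[sets]:=mid[sets]:=first[s]$, $end[sets]:=mid[s]$, $first[s]:=mid[s]$, set $sidx[elems[\ell]]:=sets$ for $\ell=first[sets],\dots,end[sets]-1$, and return $sets$. A *simple set* is an array with a size counter and the operations $Empty$, $Add$ and $Remove$, where $Remove$ may remove and return any element. **Algorithm.** States are numbered $1,\dots,|Q|$ and transitions $1,\dots,|\delta|$; $tail[t]$, $label[t]$, $head[t]$ are the components of transition $t$, and $F$ is given as a list. First, initialize the refinable partitions $BRP$ of $\{1,\dots,|Q|\}$ and $TRP$ of $\{1,\dots,|\delta|\}$, the empty simple sets $Unready\_Spls$, $Touched\_Blocks$, $Touched\_Spls$, and, by counting sort, arrays listing for each state $q$ the set $In\_trs[q]$ of transitions with head $q$. Then run $Main\_part$. $Split\_block(b)$: $b':=BRP.Split(b)$. If $b'\neq 0$: - if $BRP.Size(b)<BRP.Size(b')$ then $b':=b$; - for each $q$ in the $BRP$-set $b'$ (scanned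 with $First$, $Next$) and each $t\in In\_trs[q]$: $p:=TRP.Set(t)$; if $TRP.No\_marks(p)$ then $Touched\_Spls.Add(p)$; $TRP.Mark(t)$; - while $Touched\_Spls$ is nonempty: $p:=Touched\_Spls.Remove$; $p':=TRP.Split(p)$; if $p'\ne0$ then $Unready\_Spls.Add(p')$. $Main\_part$: - for each label $a$ occurring in $\delta$: mark in $TRP$ all transitions with label $a$ and execute $TRP.Split(1)$; - for $p=1,\dots,TRP.sets$: $Unready\_Spls.Add(p)$; - for $q\in F$: $BRP.Mark(q)$; then $Split\_block(1)$; - while $Unready\_Spls$ is nonempty: $p:=Unready\_Spls.Remove$; for each $t$ in the $TRP$-set $p$ (scanned with $First$, $Next$): $q:=tail[t]$, $b':=BRP.Set(q)$, if $BRP.No\_marks(b')$ then $Touched\_Blocks.Add(b')$, $BRP.Mark(q)$; then, while $Touched\_Blocks$ is nonempty: $b:=Touched\_Blocks.Remove$, $Split\_block(b)$. Time and memory refer to a random access machine under the uniform cost criterion (each elementary operation takes unit time; memory is the number of scalar registers plus the lengths of the array areas used). **Theorem.** There is a constant $C$ such that the following holds for every PT-DFA all of whose states are relevant and that has at least one final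 state. If the transitions that have the same label are given successively in the input, then, for all numberings of the states and transitions subject to this, all initial contents of the memory outside the input, and all choices made by $Remove$, the above algorithm (including initialization) halts, and if $|Q|\ge 2$, it uses at most $C\,|\delta|\log_2|Q|$ time and at most $C\,|\delta|$ memory; that is, it runs in $O(|\delta|\lg|Q|)$ time and $O(|\delta|)$ memory. If $|Q|=1$, it uses at most $C\,(|\delta|+1)$ time and memory. -/

import Mathlib

/-! # Deterministic finite automata with a partial transition function -/

/-- A PT-DFA with state set `Q` and alphabet `S`: a set `δ ⊆ Q × S × Q` of transitions in which
`(q, a)` determines the end state, an initial state and a set of final states. -/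
structure PTDFA (Q : Type*) (S : Type*) where
  δ : Finset (Q × S × Q)
  det : ∀ q a q₁ q₂, (q, a, q₁) ∈ δ → (q, a, q₂) ∈ δ → q₁ = q₂
  init : Q
  F : Finset Q

namespace PTDFA

/-- `D.Path q w q'`: there is a path from `q` to `q'` whose labels spell the word `w`. -/
inductive Path {Q S : Type*} (D : PTDFA Q S) : Q → List S → Q → Prop
  | nil (q : Q) : Path D q [] q
  | snoc {q : Q} {w : List S} {r : Q} {a : S} {q' : Q} :
      Path D q w r → (r, a, q') ∈ D.δ → Path D q (w ++ [a]) q'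

/-- A state is relevant if it is the initial state, or if it is reachable from the initial state
and some final state is reachable from it. -/
def Relevant {Q S : Type*} (D : PTDFA Q S) (q : Q) : Prop :=
  q = D.init ∨ ∃ q' ∈ D.F, ∃ w v : List S, D.Path D.init w q ∧ D.Path q v q'

/-- The order in which a PT-DFA is presented to the algorithm: a numbering of the states, a
numbering of the transitions, an enumeration of the final states, and a coding of the letters by
pairwise distinct natural numbers. (`Fin k` counts from `0`; the algorithm counts from `1`.) -/
structure Presentation {Q S : Type*} (D : PTDFA Q S) where
  state : Q ≃ Fin (Nat.card Q)
  letter : S ↪ ℕ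
  trans : Fin D.δ.card ≃ D.δ
  final : Fin D.F.card ≃ D.F

namespace Presentation

variable {Q S : Type*} {D : PTDFA Q S} (P : Presentation D)

/-- The number, in `{1, …, |Q|}`, of a state. -/
def num (q : Q) : ℕ := (P.state q : ℕ) + 1

/-- The three components (start state, label, end state) of the `i`-th transition. -/
def src (i : Fin D.δ.card) : Q := (P.trans i).1.1
def lab (i : Fin D.δ.card) : S := (P.trans i).1.2.1
def dst (i : Fin D.δ.card) : Q := (P.trans i).1.2.2

/-- Transitions that have the same label are given successively. -/
def LabelsConsecutive : Prop :=
  ∀ i j k : Fin D.δ.card, i ≤ j → j ≤ k → P.lab i = P.lab k → P.lab j = P.lab i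

end Presentation
end PTDFA

/-! # A random access machine under the uniform cost criterion

Programs over finitely many scalar registers and finitely many arrays that hold natural numbers.
Every node of an expression and every elementary command costs one unit of time. -/

namespace Ram

/-- The two instances of the refinable partition structure: of the states (blocks) and of the
transitions (splitters). -/
inductive RPart
  | brp
  | trp
  deriving DecidableEq

instance : Fintype RPart :=
  ⟨{.brp, .trp}, fun x => by cases x <;> decide⟩

/-- The six arrays of a refinable partition. (`lim` is the array `end` of first positions after
the sets.) -/
inductive RField
  | elems
  | loc
  | sidx
  | first
  | lim
  | mid
  deriving DecidableEq

instance : Fintype RField :=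
  ⟨{.elems, .loc, .sidx, .first, .lim, .mid}, fun x => by cases x <;> decide⟩

/-- The three simple sets. -/
inductive Bag
  | unreadySpls
  | touchedBlocks
  | touchedSpls
  deriving DecidableEq

instance : Fintype Bag :=
  ⟨{.unreadySpls, .touchedBlocks, .touchedSpls}, fun x => by cases x <;> decide⟩

/-- Arrays: the input (`tail`, `label`, `head` of the transitions, and the list of final states),
the input transitions of the states, the two partitions, and the three simple sets. -/
inductive Arr
  | tail
  | label
  | head
  | finals
  | inElems
  | inFirst
  | inLim
  | part (P : RPart) (f : RField)
  | bag (B : Bag)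
  deriving DecidableEq, Fintype

/-- Scalar registers: the input sizes `|Q|`, `|δ|`, `|F|`, the numbers of sets of the partitions,
the cardinalities of the simple sets, the variables of the algorithm (`b2`, `p2` stand for
`b'`, `p'`), and the local variables of the operations. -/
inductive Reg
  | nQ
  | nT
  | nF
  | sets (P : RPart)
  | size (B : Bag)
  | a
  | b
  | b2
  | i
  | k
  | p
  | p2
  | q
  | t
  | markS
  | markL
  | markM
  | splitL
  | pick
  deriving DecidableEq, Fintype

/-- Contents of the machine: registers, arrays, the sequence `oracle` that settles the free
choices still to come, the time used so far, and for every array `A` the least `ext A` such that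
only cells with index below `ext A` have been read or written so far. -/
structure State where
  reg : Reg → ℕ
  arr : Arr → ℕ → ℕ
  oracle : ℕ → ℕ
  time : ℕ
  ext : Arr → ℕ

namespace State

/-- Memory used so far: all registers, and for each array a contiguous area that contains all
cells accessed so far. -/
def space (s : State) : ℕ := Fintype.card Reg + ∑ A : Arr, s.ext A

/-- Charge `c` units of time and record the accesses described by `w`. -/
def charge (s : State) (c : ℕ) (w : Arr → ℕ) : State :=
  { s with time := s.time + c, ext := s.ext ⊔ w }

def setReg (s : State) (r : Reg) (v : ℕ) : State :=
  { s with reg := Function.update s.reg r v }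

def setArr (s : State) (A : Arr) (i v : ℕ) : State :=
  { s with arr := Function.update s.arr A (Function.update (s.arr A) i v) }

/-- Put a number below `k` that is dictated by the oracle into register `r`. -/
def pickReg (s : State) (r : Reg) (k : ℕ) : State :=
  { s with
    reg := Function.update s.reg r (s.oracle 0 % k)
    oracle := fun j => s.oracle (j + 1) }

end State

/-- Arithmetic expressions. -/
inductive Expr
  | lit (n : ℕ)
  | reg (r : Reg)
  | get (A : Arr) (i : Expr)
  | add (e f : Expr)
  | sub (e f : Expr)

instance : Coe Reg Expr := ⟨Expr.reg⟩
instance (n : ℕ) : OfNat Expr n := ⟨Expr.lit n⟩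
instance : Add Expr := ⟨Expr.add⟩
instance : Sub Expr := ⟨Expr.sub⟩

namespace Expr

def eval (s : State) : Expr → ℕ
  | lit n => n
  | reg r => s.reg r
  | get A i => s.arr A (i.eval s)
  | add e f => e.eval s + f.eval s
  | sub e f => e.eval s - f.eval s

/-- The time of an evaluation. -/
def cost : Expr → ℕ
  | lit _ => 1
  | reg _ => 1
  | get _ i => i.cost + 1
  | add e f => e.cost + f.cost + 1
  | sub e f => e.cost + f.cost + 1

/-- The array cells that an evaluation reads: those of `A` have indices below `touch s e A`. -/
def touch (s : State) : Expr → Arr → ℕ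
  | lit _ => 0
  | reg _ => 0
  | get A i => i.touch s ⊔ Pi.single A (i.eval s + 1)
  | add e f => e.touch s ⊔ f.touch s
  | sub e f => e.touch s ⊔ f.touch s

end Expr

/-- Tests; the conjunction evaluates its second argument only if the first one holds. -/
inductive Test
  | eq (e f : Expr)
  | lt (e f : Expr)
  | not (x : Test)
  | and (x y : Test)

namespace Test

def eval (s : State) : Test → Bool
  | eq e f => decide (e.eval s = f.eval s)
  | lt e f => decide (e.eval s < f.eval s)
  | not x => !x.eval s
  | and x y => x.eval s && y.eval s

def cost (s : State) : Test → ℕ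
  | eq e f => e.cost + f.cost + 1
  | lt e f => e.cost + f.cost + 1
  | not x => x.cost s + 1
  | and x y => x.cost s + (if x.eval s then y.cost s else 0) + 1

def touch (s : State) : Test → Arr → ℕ
  | eq e f => e.touch s ⊔ f.touch s
  | lt e f => e.touch s ⊔ f.touch s
  | not x => x.touch s
  | and x y => x.touch s ⊔ (if x.eval s then y.touch s else 0)

end Test

/-- Programs: `assign r e` is `r := e`, `store A i e` is `A[i] := e`, and `choose r e` lets `r` be
an arbitrary number below `e`. -/
inductive Cmd
  | skip
  | assign (r : Reg) (e : Expr)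
  | store (A : Arr) (i e : Expr)
  | choose (r : Reg) (e : Expr)
  | seq (c d : Cmd)
  | cond (x : Test) (c d : Cmd)
  | while (x : Test) (c : Cmd)

/-- `Exec c s s'`: the program `c`, started in `s`, halts in `s'`. -/
inductive Exec : Cmd → State → State → Prop
  | skip (s : State) : Exec .skip s (s.charge 1 0)
  | assign (r : Reg) (e : Expr) (s : State) :
      Exec (.assign r e) s ((s.charge (e.cost + 1) (e.touch s)).setReg r (e.eval s))
  | store (A : Arr) (i e : Expr) (s : State) :
      Exec (.store A i e) s
        ((s.charge (i.cost + e.cost + 1)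
          (i.touch s ⊔ e.touch s ⊔ Pi.single A (i.eval s + 1))).setArr A (i.eval s) (e.eval s))
  | choose (r : Reg) (e : Expr) (s : State) :
      Exec (.choose r e) s ((s.charge (e.cost + 1) (e.touch s)).pickReg r (e.eval s))
  | seq {c d : Cmd} {s s' s'' : State} :
      Exec c s s' → Exec d s' s'' → Exec (.seq c d) s s''
  | condTrue {x : Test} {c d : Cmd} {s s' : State} : x.eval s = true →
      Exec c (s.charge (x.cost s + 1) (x.touch s)) s' → Exec (.cond x c d) s s'
  | condFalse {x : Test} {c d : Cmd} {s s' : State} : x.eval s = false →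
      Exec d (s.charge (x.cost s + 1) (x.touch s)) s' → Exec (.cond x c d) s s'
  | whileTrue {x : Test} {c : Cmd} {s s' s'' : State} : x.eval s = true →
      Exec c (s.charge (x.cost s + 1) (x.touch s)) s' → Exec (.while x c) s' s'' →
      Exec (.while x c) s s''
  | whileFalse {x : Test} {c : Cmd} {s : State} : x.eval s = false →
      Exec (.while x c) s (s.charge (x.cost s + 1) (x.touch s))

/-- Once the oracle is fixed, there is at most one halting run. -/
theorem Exec.unique {c : Cmd} {s s₁ s₂ : State} (h₁ : Exec c s s₁) (h₂ : Exec c s s₂) :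
    s₁ = s₂ := by
  induction h₁ generalizing s₂ with
  | skip s => cases h₂; rfl
  | assign r e s => cases h₂; rfl
  | store A i e s => cases h₂; rfl
  | choose r e s => cases h₂; rfl
  | seq _ _ ih₁ ih₂ =>
    cases h₂ with
    | seq g₁ g₂ => obtain rfl := ih₁ g₁; exact ih₂ g₂
  | condTrue hx _ ih =>
    cases h₂ with
    | condTrue _ g => exact ih g
    | condFalse hy _ => rw [hx] at hy; cases hy
  | condFalse hx _ ih =>
    cases h₂ with
    | condFalse _ g => exact ih g
    | condTrue hy _ => rw [hx] at hy; cases hy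
  | whileTrue hx _ _ ih₁ ih₂ =>
    cases h₂ with
    | whileTrue _ g₁ g₂ => obtain rfl := ih₁ g₁; exact ih₂ g₂
    | whileFalse hy => rw [hx] at hy; cases hy
  | whileFalse hx =>
    cases h₂ with
    | whileFalse _ => rfl
    | whileTrue hy _ _ => rw [hx] at hy; cases hy

scoped infixr:30 ";;" => Cmd.seq
scoped infix:35 "::=" => Cmd.assign

/-- `for r := lo, …, hi - 1 do c`. -/
def Cmd.forUp (r : Reg) (lo hi : Expr) (c : Cmd) : Cmd :=
  r ::= lo ;;
  .while (.lt r hi) (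
    c ;;
    r ::= r + 1)

/-! ## Simple sets, kept in an array in any order -/

namespace Bag

def clear (B : Bag) : Cmd := .size B ::= 0

def isEmpty (B : Bag) : Test := .eq (Reg.size B) 0

def add (B : Bag) (e : Expr) : Cmd :=
  .store (.bag B) (Reg.size B) e ;;
  .size B ::= Reg.size B + 1

/-- `r := Remove`: any element may be removed. -/
def remove (B : Bag) (r : Reg) : Cmd :=
  .choose .pick (Reg.size B) ;;
  r ::= .get (.bag B) Reg.pick ;;
  .size B ::= Reg.size B - 1 ;;
  .store (.bag B) Reg.pick (.get (.bag B) (Reg.size B))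

end Bag

/-! ## Refinable partitions -/

namespace RPart

def elems (P : RPart) (e : Expr) : Expr := .get (.part P .elems) e
def loc (P : RPart) (e : Expr) : Expr := .get (.part P .loc) e
def sidx (P : RPart) (e : Expr) : Expr := .get (.part P .sidx) e
def first (P : RPart) (e : Expr) : Expr := .get (.part P .first) e
def lim (P : RPart) (e : Expr) : Expr := .get (.part P .lim) e
def mid (P : RPart) (e : Expr) : Expr := .get (.part P .mid) e

def setElems (P : RPart) (i e : Expr) : Cmd := .store (.part P .elems) i e
def setLoc (P : RPart) (i e : Expr) : Cmd := .store (.part P .loc) i e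
def setSidx (P : RPart) (i e : Expr) : Cmd := .store (.part P .sidx) i e
def setFirst (P : RPart) (i e : Expr) : Cmd := .store (.part P .first) i e
def setLim (P : RPart) (i e : Expr) : Cmd := .store (.part P .lim) i e
def setMid (P : RPart) (i e : Expr) : Cmd := .store (.part P .mid) i e

/-- Initialization as the partition of `{1, …, max}` with one set (with no set if `max = 0`). -/
def setup (P : RPart) (max : Reg) : Cmd :=
  .cond (.eq max 0) (.sets P ::= 0) (
    .sets P ::= 1 ;;
    P.setFirst 1 1 ;;
    P.setMid 1 1 ;;
    P.setLim 1 (max + 1) ;;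
    .forUp .i 1 (max + 1) (
      P.setElems Reg.i Reg.i ;;
      P.setLoc Reg.i Reg.i ;;
      P.setSidx Reg.i 1))

def size (P : RPart) (s : Expr) : Expr := P.lim s - P.first s

def noMarks (P : RPart) (s : Expr) : Test := .eq (P.mid s) (P.first s)

/-- `r := Next(e)`. -/
def next (P : RPart) (r : Reg) (e : Expr) : Cmd :=
  .cond (.not (.lt (P.loc e + 1) (P.lim (P.sidx e)))) (r ::= 0)
    (r ::= P.elems (P.loc e + 1))

def mark (P : RPart) (e : Expr) : Cmd :=
  .markS ::= P.sidx e ;;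
  .markL ::= P.loc e ;;
  .markM ::= P.mid Reg.markS ;;
  .cond (.not (.lt Reg.markL Reg.markM)) (
    P.setElems Reg.markL (P.elems Reg.markM) ;;
    P.setLoc (P.elems Reg.markL) Reg.markL ;;
    P.setElems Reg.markM e ;;
    P.setLoc e Reg.markM ;;
    P.setMid Reg.markS (Reg.markM + 1)) .skip

/-- `r := Split(s)`. -/
def split (P : RPart) (r : Reg) (s : Expr) : Cmd :=
  .cond (.eq (P.mid s) (P.lim s)) (P.setMid s (P.first s)) .skip ;;
  .cond (.eq (P.mid s) (P.first s)) (r ::= 0) (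
    .sets P ::= Reg.sets P + 1 ;;
    P.setFirst (Reg.sets P) (P.first s) ;;
    P.setMid (Reg.sets P) (P.first s) ;;
    P.setLim (Reg.sets P) (P.mid s) ;;
    P.setFirst s (P.mid s) ;;
    .forUp .splitL (P.first (Reg.sets P)) (P.lim (Reg.sets P)) (
      P.setSidx (P.elems Reg.splitL) (Reg.sets P)) ;;
    r ::= Reg.sets P)

end RPart

/-! ## The block-splitting stage -/

open RPart Bag

/-- Initialization of `In_trs` by counting sort, using `head` as the key: the input transitions of
`q` become `inElems[inFirst[q]], …, inElems[inLim[q] - 1]`. -/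
def initInTrs : Cmd :=
  .forUp .q 1 (Reg.nQ + 1) (.store .inLim Reg.q 0) ;;
  .forUp .t 1 (Reg.nT + 1) (
    .store .inLim (.get .head Reg.t) (.get .inLim (.get .head Reg.t) + 1)) ;;
  .k ::= 1 ;;
  .forUp .q 1 (Reg.nQ + 1) (
    .store .inFirst Reg.q Reg.k ;;
    .k ::= Reg.k + .get .inLim Reg.q ;;
    .store .inLim Reg.q (.get .inFirst Reg.q)) ;;
  .forUp .t 1 (Reg.nT + 1) (
    .store .inElems (.get .inLim (.get .head Reg.t)) Reg.t ;;
    .store .inLim (.get .head Reg.t) (.get .inLim (.get .head Reg.t) + 1))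

/-- Initialization of the data structures. -/
def initData : Cmd :=
  unreadySpls.clear ;;
  touchedBlocks.clear ;;
  touchedSpls.clear ;;
  initInTrs ;;
  brp.setup .nQ ;;
  trp.setup .nT

/-- Refine `TRP` from one set into the sets of transitions with the same label: for each label,
mark its transitions, which occupy a contiguous range of indices, and split. -/
def initSplitters : Cmd :=
  .t ::= 1 ;;
  .while (.lt Reg.t (Reg.nT + 1)) (
    .a ::= .get .label Reg.t ;;
    .while (.and (.lt Reg.t (Reg.nT + 1)) (.eq (.get .label Reg.t) Reg.a)) (
      trp.mark Reg.t ;;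
      .t ::= Reg.t + 1) ;;
    trp.split .p2 1)

/-- `Split_block(b)`, where the argument is in register `b`. -/
def splitBlock : Cmd :=
  brp.split .b2 Reg.b ;;
  .cond (.not (.eq Reg.b2 0)) (
    .cond (.lt (brp.size Reg.b) (brp.size Reg.b2)) (.b2 ::= Reg.b) .skip ;;
    .q ::= brp.elems (brp.first Reg.b2) ;;
    .while (.not (.eq Reg.q 0)) (
      .forUp .k (.get .inFirst Reg.q) (.get .inLim Reg.q) (
        .t ::= .get .inElems Reg.k ;;
        .p ::= trp.sidx Reg.t ;;
        .cond (trp.noMarks Reg.p) (touchedSpls.add Reg.p) .skip ;;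
        trp.mark Reg.t) ;;
      brp.next .q Reg.q) ;;
    .while (.not touchedSpls.isEmpty) (
      touchedSpls.remove .p ;;
      trp.split .p2 Reg.p ;;
      .cond (.not (.eq Reg.p2 0)) (unreadySpls.add Reg.p2) .skip)) .skip

/-- `Main_part`. -/
def mainPart : Cmd :=
  initSplitters ;;
  .forUp .p 1 (Reg.sets trp + 1) (unreadySpls.add Reg.p) ;;
  .forUp .i 1 (Reg.nF + 1) (brp.mark (.get .finals Reg.i)) ;;
  .b ::= 1 ;;
  splitBlock ;;
  .while (.not unreadySpls.isEmpty) (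
    unreadySpls.remove .p ;;
    .t ::= trp.elems (trp.first Reg.p) ;;
    .while (.not (.eq Reg.t 0)) (
      .q ::= .get .tail Reg.t ;;
      .b2 ::= brp.sidx Reg.q ;;
      .cond (brp.noMarks Reg.b2) (touchedBlocks.add Reg.b2) .skip ;;
      brp.mark Reg.q ;;
      trp.next .t Reg.t) ;;
    .while (.not touchedBlocks.isEmpty) (
      touchedBlocks.remove .b ;;
      splitBlock))

/-- The whole block-splitting stage, including the initialization of its data structures. -/
def blockSplitting : Cmd := initData ;; mainPart

/-- `s` is a state in which the machine is started on the presentation `P` of `D`: the sizes of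
the input, the transitions with numbers `1, …, |δ|`, and the final states are stored in the input
registers and arrays. All other registers and cells have arbitrary contents, and the oracle is
arbitrary. -/
structure Start {Q S : Type*} {D : PTDFA Q S} (P : D.Presentation) (s : State) : Prop where
  nQ : s.reg .nQ = Nat.card Q
  nT : s.reg .nT = D.δ.card
  nF : s.reg .nF = D.F.card
  tail : ∀ i : Fin D.δ.card, s.arr .tail ((i : ℕ) + 1) = P.num (P.src i)
  label : ∀ i : Fin D.δ.card, s.arr .label ((i : ℕ) + 1) = P.letter (P.lab i)
  head : ∀ i : Fin D.δ.card, s.arr .head ((i : ℕ) + 1) = P.num (P.dst i)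
  finals : ∀ i : Fin D.F.card, s.arr .finals ((i : ℕ) + 1) = P.num (P.final i).1
  time : s.time = 0
  ext : s.ext = 0

end Ram

/-!
# The running time of partition refinement for partial automata

The bounds come from an amortized analysis in the manner of Hopcroft. Each state of the machine is
assigned a *cost* (`blockCost`): the elapsed time plus a potential. The potential is a fixed
multiple of

* the number of marked transitions, and the number of entries of `Touched_Spls`,
* the total size of the splitters in `Unready_Spls`,
* the number of marked states,
* `∑ q, |In_trs[q]| * ⌊log₂ |block of q|⌋`.

Every operation raises the cost by at most a constant that its caller can pay. Splitting a set with
`m` marked elements takes time proportional to `m`, which the marks pay (`RP.marks_cut`); a marked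
transition, moreover, pays for its place in a new unready splitter (`wp_splitTouched`). Scanning
an unready splitter is paid by its size, which leaves `Unready_Spls` when the scan starts, and
covers the marks and the touched blocks that the scan creates (`wp_markTails`, `wp_mainLoop`). The
crucial step is the scan of the input transitions of a block that was split. It is paid by the
logarithmic sum: only the smaller half is scanned, and for each state in it the size of the block
has at least halved (`RP.Valid.logSum_cut`, `wp_splitBlock`). Therefore the cost increases by at
most a constant in the loop of the main part altogether, so the final time is at most the cost at
the beginning of the loop, which is `O(|Q| + |δ| + |δ| log₂ |Q|)` (`wp_blockSplitting`).

Every command takes time, so an invariant that bounds the time also makes a loop halt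
(`wp_while`); one invariant thus yields both termination and the bound, and it does so for every
oracle. Concerning the data, it suffices that the two partitions remain well-formed (`RP.Valid`),
that the simple sets contain only set numbers, and that the lists `In_trs` contain only transition
numbers and have total length at most `|δ|` (`Core`, `Ctx`). This also bounds all array indices
in use by `2 |δ| + |Q| + 3`, whence the memory bound.

Finally, if all states are relevant, each state but the initial one is the end state of a
transition (`PTDFA.card_le_of_relevant`), so `|Q| ≤ |δ| + 1`: the terms `|Q|` are absorbed, and
`|δ| ≥ 1` if `|Q| ≥ 2`.
-/

namespace Ram

/-! ### Execution states, expressions and tests -/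

/-- `w A ≤ N` for every array `A`: cells with index below `w A` lie in an area of length `N`. -/
def Within (N : ℕ) (w : Arr → ℕ) : Prop := ∀ A, w A ≤ N

@[simp] theorem within_sup {N : ℕ} {w w' : Arr → ℕ} :
    Within N (w ⊔ w') ↔ Within N w ∧ Within N w' := by
  simp [Within, forall_and]

@[simp] theorem within_zero {N : ℕ} : Within N 0 := fun _ => Nat.zero_le _

@[simp] theorem within_single {N i : ℕ} {A : Arr} : Within N (Pi.single A (i + 1)) ↔ i < N := by
  constructor
  · intro h
    simpa using h A
  · intro h B
    by_cases hB : B = A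
    · subst hB; simpa using h
    · simp [Pi.single_eq_of_ne hB]

namespace State

variable (s : State) (c : ℕ) (w : Arr → ℕ) (r : Reg) (v i k : ℕ) (A : Arr)

@[simp] theorem charge_reg : (s.charge c w).reg = s.reg := rfl
@[simp] theorem charge_arr : (s.charge c w).arr = s.arr := rfl
@[simp] theorem charge_oracle : (s.charge c w).oracle = s.oracle := rfl
@[simp] theorem charge_time : (s.charge c w).time = s.time + c := rfl
@[simp] theorem charge_ext : (s.charge c w).ext = s.ext ⊔ w := rfl
@[simp] theorem setReg_reg : (s.setReg r v).reg = Function.update s.reg r v := rfl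
@[simp] theorem setReg_arr : (s.setReg r v).arr = s.arr := rfl
@[simp] theorem setReg_time : (s.setReg r v).time = s.time := rfl
@[simp] theorem setReg_ext : (s.setReg r v).ext = s.ext := rfl
@[simp] theorem setArr_reg : (s.setArr A i v).reg = s.reg := rfl
@[simp] theorem setArr_arr : (s.setArr A i v).arr =
    Function.update s.arr A (Function.update (s.arr A) i v) := rfl
@[simp] theorem setArr_time : (s.setArr A i v).time = s.time := rfl
@[simp] theorem setArr_ext : (s.setArr A i v).ext = s.ext := rfl
@[simp] theorem pickReg_reg :
    (s.pickReg r k).reg = Function.update s.reg r (s.oracle 0 % k) := rfl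
@[simp] theorem pickReg_arr : (s.pickReg r k).arr = s.arr := rfl
@[simp] theorem pickReg_time : (s.pickReg r k).time = s.time := rfl
@[simp] theorem pickReg_ext : (s.pickReg r k).ext = s.ext := rfl

end State

namespace Expr

variable (s : State) (r : Reg) (A : Arr) (e f : Expr)

@[simp] theorem eval_zero : (0 : Expr).eval s = 0 := rfl
@[simp] theorem eval_one : (1 : Expr).eval s = 1 := rfl
@[simp] theorem eval_reg : (Expr.reg r).eval s = s.reg r := rfl
@[simp] theorem eval_get : (Expr.get A e).eval s = s.arr A (e.eval s) := rfl
@[simp] theorem eval_add : (e + f).eval s = e.eval s + f.eval s := rfl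
@[simp] theorem eval_sub : (e - f).eval s = e.eval s - f.eval s := rfl
@[simp] theorem cost_zero : (0 : Expr).cost = 1 := rfl
@[simp] theorem cost_one : (1 : Expr).cost = 1 := rfl
@[simp] theorem cost_reg : (Expr.reg r).cost = 1 := rfl
@[simp] theorem cost_get : (Expr.get A e).cost = e.cost + 1 := rfl
@[simp] theorem cost_add : (e + f).cost = e.cost + f.cost + 1 := rfl
@[simp] theorem cost_sub : (e - f).cost = e.cost + f.cost + 1 := rfl
@[simp] theorem touch_zero : (0 : Expr).touch s = 0 := rfl
@[simp] theorem touch_one : (1 : Expr).touch s = 0 := rfl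
@[simp] theorem touch_reg : (Expr.reg r).touch s = 0 := rfl
@[simp] theorem touch_get :
    (Expr.get A e).touch s = e.touch s ⊔ Pi.single A (e.eval s + 1) := rfl
@[simp] theorem touch_add : (e + f).touch s = e.touch s ⊔ f.touch s := rfl
@[simp] theorem touch_sub : (e - f).touch s = e.touch s ⊔ f.touch s := rfl

end Expr

namespace Test

variable (s : State) (e f : Expr) (x y : Test)

@[simp] theorem eval_eq_true : (Test.eq e f).eval s = true ↔ e.eval s = f.eval s :=
  decide_eq_true_iff
@[simp] theorem eval_eq_false : (Test.eq e f).eval s = false ↔ e.eval s ≠ f.eval s :=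
  decide_eq_false_iff_not
@[simp] theorem eval_lt_true : (Test.lt e f).eval s = true ↔ e.eval s < f.eval s :=
  decide_eq_true_iff
@[simp] theorem eval_lt_false : (Test.lt e f).eval s = false ↔ f.eval s ≤ e.eval s :=
  decide_eq_false_iff_not.trans not_lt
@[simp] theorem eval_not : (Test.not x).eval s = !x.eval s := rfl
@[simp] theorem eval_and : (Test.and x y).eval s = (x.eval s && y.eval s) := rfl
@[simp] theorem cost_eq : (Test.eq e f).cost s = e.cost + f.cost + 1 := rfl
@[simp] theorem cost_lt : (Test.lt e f).cost s = e.cost + f.cost + 1 := rfl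
@[simp] theorem cost_not : (Test.not x).cost s = x.cost s + 1 := rfl
@[simp] theorem touch_eq : (Test.eq e f).touch s = e.touch s ⊔ f.touch s := rfl
@[simp] theorem touch_lt : (Test.lt e f).touch s = e.touch s ⊔ f.touch s := rfl
@[simp] theorem touch_not : (Test.not x).touch s = x.touch s := rfl

end Test

/-! ### Weakest preconditions -/

/-- The program `c`, started in `s`, halts in a state that satisfies `Q`. -/
def wp (c : Cmd) (s : State) (Q : State → Prop) : Prop := ∃ s', Exec c s s' ∧ Q s'

/-- The rule of consequence. -/
theorem wp.mono {c : Cmd} {s : State} {Q R : State → Prop} (h : wp c s Q)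
    (hQR : ∀ s', Q s' → R s') : wp c s R :=
  let ⟨s', hs, hQ⟩ := h
  ⟨s', hs, hQR s' hQ⟩

@[simp] theorem wp_skip {s : State} {Q : State → Prop} : wp .skip s Q ↔ Q (s.charge 1 0) :=
  ⟨fun ⟨_, h, hQ⟩ => by cases h; exact hQ, fun h => ⟨_, .skip s, h⟩⟩

@[simp] theorem wp_assign {s : State} {Q : State → Prop} {r : Reg} {e : Expr} :
    wp (.assign r e) s Q ↔ Q ((s.charge (e.cost + 1) (e.touch s)).setReg r (e.eval s)) :=
  ⟨fun ⟨_, h, hQ⟩ => by cases h; exact hQ, fun h => ⟨_, .assign r e s, h⟩⟩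

@[simp] theorem wp_store {s : State} {Q : State → Prop} {A : Arr} {i e : Expr} :
    wp (.store A i e) s Q ↔ Q ((s.charge (i.cost + e.cost + 1)
      (i.touch s ⊔ e.touch s ⊔ Pi.single A (i.eval s + 1))).setArr A (i.eval s) (e.eval s)) :=
  ⟨fun ⟨_, h, hQ⟩ => by cases h; exact hQ, fun h => ⟨_, .store A i e s, h⟩⟩

@[simp] theorem wp_choose {s : State} {Q : State → Prop} {r : Reg} {e : Expr} :
    wp (.choose r e) s Q ↔ Q ((s.charge (e.cost + 1) (e.touch s)).pickReg r (e.eval s)) :=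
  ⟨fun ⟨_, h, hQ⟩ => by cases h; exact hQ, fun h => ⟨_, .choose r e s, h⟩⟩

@[simp] theorem wp_seq {s : State} {Q : State → Prop} {c d : Cmd} :
    wp (.seq c d) s Q ↔ wp c s fun s' => wp d s' Q :=
  ⟨fun ⟨_, h, hQ⟩ => by cases h with | seq h₁ h₂ => exact ⟨_, h₁, _, h₂, hQ⟩,
    fun ⟨_, h₁, _, h₂, hQ⟩ => ⟨_, .seq h₁ h₂, hQ⟩⟩

theorem wp_cond {s : State} {Q : State → Prop} {x : Test} {c d : Cmd}
    (ht : x.eval s = true → wp c (s.charge (x.cost s + 1) (x.touch s)) Q)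
    (hf : x.eval s = false → wp d (s.charge (x.cost s + 1) (x.touch s)) Q) :
    wp (.cond x c d) s Q := by
  cases hx : x.eval s with
  | true => obtain ⟨s', h, hQ⟩ := ht hx; exact ⟨s', .condTrue hx h, hQ⟩
  | false => obtain ⟨s', h, hQ⟩ := hf hx; exact ⟨s', .condFalse hx h, hQ⟩

/-- Every execution takes at least one unit of time. -/
theorem Exec.time_lt {c : Cmd} {s s' : State} (h : Exec c s s') : s.time < s'.time := by
  induction h with
  | skip | assign | store | choose => simp
  | seq _ _ h₁ h₂ => exact h₁.trans h₂
  | condTrue _ _ h | condFalse _ _ h => simp only [State.charge_time] at h; omega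
  | whileTrue _ _ _ h₁ h₂ => simp only [State.charge_time] at h₁; omega
  | whileFalse => simp

/-- An invariant that bounds the elapsed time makes a loop halt: every round takes time, so no
separate termination measure is needed. -/
theorem wp_while {x : Test} {c : Cmd} {Q : State → Prop} (I : State → Prop) (K : ℕ) {s : State}
    (hs : I s) (hK : ∀ s, I s → s.time ≤ K)
    (hbody : ∀ s, I s → x.eval s = true → wp c (s.charge (x.cost s + 1) (x.touch s)) I)
    (hexit : ∀ s, I s → x.eval s = false → Q (s.charge (x.cost s + 1) (x.touch s))) :
    wp (.while x c) s Q := by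
  induction hn : K - s.time using Nat.strong_induction_on generalizing s with
  | _ n ih =>
    cases hx : x.eval s with
    | false => exact ⟨_, .whileFalse hx, hexit s hs hx⟩
    | true =>
      obtain ⟨s₁, h₁, hI₁⟩ := hbody s hs hx
      have hlt := h₁.time_lt
      have hle := hK s₁ hI₁
      simp only [State.charge_time] at hlt
      obtain ⟨s₂, h₂, hQ⟩ := ih (K - s₁.time) (by omega) hI₁ rfl
      exact ⟨s₂, .whileTrue hx h₁ h₂, hQ⟩

/-- Forget everything about the current state but `A`: this keeps the states that arise from
executing a sequence of elementary commands from growing. -/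
theorem wp_weaken {c : Cmd} {t : State} {Q : State → Prop} (A : State → Prop) (ht : A t)
    (h : ∀ t, A t → wp c t Q) : wp c t Q :=
  h t ht

/-- `s'` differs from `s` at most in the registers `L`, in the arrays `M`, and in the oracle, the
time and the extents. -/
structure Frame (L : List Reg) (M : List Arr) (s s' : State) : Prop where
  reg : ∀ r, r ∉ L → s'.reg r = s.reg r
  arr : ∀ A, A ∉ M → s'.arr A = s.arr A

/-! ### Refinable partitions as mathematical objects -/

theorem sum_add_eq_of_eq_off {α : Type*} [DecidableEq α] {S : Finset α} {f g : α → ℕ} {v : α}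
    (hv : v ∈ S) (h : ∀ x ∈ S, x ≠ v → g x = f x) : ∑ x ∈ S, g x + f v = ∑ x ∈ S, f x + g v := by
  rw [← Finset.add_sum_erase S f hv, ← Finset.add_sum_erase S g hv,
    Finset.sum_congr rfl fun x hx => h x (Finset.mem_of_mem_erase hx) (Finset.ne_of_mem_erase hx)]
  ring

/-- The contents of a refinable partition structure. -/
@[ext] structure RP where
  elems : ℕ → ℕ
  loc : ℕ → ℕ
  sidx : ℕ → ℕ
  first : ℕ → ℕ
  lim : ℕ → ℕ
  mid : ℕ → ℕ
  sets : ℕ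

/-- The refinable partition stored in the arrays and the counter that belong to `P`. -/
def State.rp (s : State) (P : RPart) : RP where
  elems := s.arr (.part P .elems)
  loc := s.arr (.part P .loc)
  sidx := s.arr (.part P .sidx)
  first := s.arr (.part P .first)
  lim := s.arr (.part P .lim)
  mid := s.arr (.part P .mid)
  sets := s.reg (.sets P)

namespace RP

/-- `R` represents a partition of `{1, …, n}` into nonempty sets: the sets with numbers
`1, …, R.sets` occupy ranges of positions, their first parts are marked, and `loc` and `sidx` tell
the position and the set of each element. -/
structure Valid (n : ℕ) (R : RP) : Prop where
  le_loc : ∀ e, 1 ≤ e → e ≤ n → R.first (R.sidx e) ≤ R.loc e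
  loc_lt : ∀ e, 1 ≤ e → e ≤ n → R.loc e < R.lim (R.sidx e)
  elems_loc : ∀ e, 1 ≤ e → e ≤ n → R.elems (R.loc e) = e
  one_le_sidx : ∀ e, 1 ≤ e → e ≤ n → 1 ≤ R.sidx e
  sidx_le : ∀ e, 1 ≤ e → e ≤ n → R.sidx e ≤ R.sets
  one_le_first : ∀ v, 1 ≤ v → v ≤ R.sets → 1 ≤ R.first v
  first_lt : ∀ v, 1 ≤ v → v ≤ R.sets → R.first v < R.lim v
  lim_le : ∀ v, 1 ≤ v → v ≤ R.sets → R.lim v ≤ n + 1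
  le_mid : ∀ v, 1 ≤ v → v ≤ R.sets → R.first v ≤ R.mid v
  mid_le : ∀ v, 1 ≤ v → v ≤ R.sets → R.mid v ≤ R.lim v
  one_le_elems : ∀ v i, 1 ≤ v → v ≤ R.sets → R.first v ≤ i → i < R.lim v → 1 ≤ R.elems i
  elems_le : ∀ v i, 1 ≤ v → v ≤ R.sets → R.first v ≤ i → i < R.lim v → R.elems i ≤ n
  loc_elems : ∀ v i, 1 ≤ v → v ≤ R.sets → R.first v ≤ i → i < R.lim v → R.loc (R.elems i) = i
  sidx_elems : ∀ v i, 1 ≤ v → v ≤ R.sets → R.first v ≤ i → i < R.lim v →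
    R.sidx (R.elems i) = v
  sum_size_le : ∑ v ∈ Finset.Icc 1 R.sets, (R.lim v - R.first v) ≤ n

/-- The size of a set. -/
def size (R : RP) (v : ℕ) : ℕ := R.lim v - R.first v

/-- The number of marked elements. -/
def marks (R : RP) : ℕ := ∑ v ∈ Finset.Icc 1 R.sets, (R.mid v - R.first v)

/-- Every element counts with its weight times the binary logarithm of the size of its set: an
upper bound for the number of times that elements can still end up in the smaller half. -/
def logSum (n : ℕ) (w : ℕ → ℕ) (R : RP) : ℕ :=
  ∑ q ∈ Finset.Icc 1 n, w q * Nat.log 2 (R.size (R.sidx q))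

/-- The effect of moving the unmarked element `e` to the marked part of its set. -/
def mark (R : RP) (e : ℕ) : RP :=
  let v := R.sidx e
  let l := R.loc e
  let m := R.mid v
  { R with
    elems := Function.update (Function.update R.elems l (R.elems m)) m e
    loc := Function.update (Function.update R.loc (R.elems m) l) e m
    mid := Function.update R.mid v (m + 1) }

/-- The effect of removing the marks from set `v`. -/
def unmark (R : RP) (v : ℕ) : RP := { R with mid := Function.update R.mid v (R.first v) }

open Classical in
/-- The set numbers after the elements in positions `first, …, l - 1` got set number `x`. -/
noncomputable def relabel (R : RP) (first l x e : ℕ) : ℕ :=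
  if ∃ i, first ≤ i ∧ i < l ∧ R.elems i = e then x else R.sidx e

/-- The effect of making the marked elements of set `v` a set of their own. -/
noncomputable def cut (R : RP) (v : ℕ) : RP where
  elems := R.elems
  loc := R.loc
  sidx := R.relabel (R.first v) (R.mid v) (R.sets + 1)
  first := Function.update (Function.update R.first (R.sets + 1) (R.first v)) v (R.mid v)
  lim := Function.update R.lim (R.sets + 1) (R.mid v)
  mid := Function.update R.mid (R.sets + 1) (R.first v)
  sets := R.sets + 1

variable {n : ℕ} {R : RP}

/-- The sets are nonempty, so there are at most `n` of them. -/
theorem Valid.sets_le (h : R.Valid n) : R.sets ≤ n := by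
  calc R.sets = ∑ v ∈ Finset.Icc 1 R.sets, 1 := by simp
    _ ≤ ∑ v ∈ Finset.Icc 1 R.sets, (R.lim v - R.first v) := by
        refine Finset.sum_le_sum fun v hv => ?_
        rw [Finset.mem_Icc] at hv
        have := h.first_lt v hv.1 hv.2
        omega
    _ ≤ n := h.sum_size_le

/-- Summing weights over the positions of a set does not count any element twice. -/
theorem Valid.sum_elems_le (h : R.Valid n) (w : ℕ → ℕ) {x : ℕ} (h1 : 1 ≤ x) (h2 : x ≤ R.sets) :
    ∑ i ∈ Finset.Ico (R.first x) (R.lim x), w (R.elems i) ≤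
      ∑ q ∈ Finset.Icc 1 n, if R.sidx q = x then w q else 0 := by
  rw [← Finset.sum_filter, ← Finset.sum_image (f := w) (g := R.elems)]
  · refine Finset.sum_le_sum_of_subset fun q hq => ?_
    simp only [Finset.mem_image, Finset.mem_Ico] at hq
    obtain ⟨i, ⟨hi1, hi2⟩, rfl⟩ := hq
    simp only [Finset.mem_filter, Finset.mem_Icc]
    exact ⟨⟨h.one_le_elems x i h1 h2 hi1 hi2, h.elems_le x i h1 h2 hi1 hi2⟩,
      h.sidx_elems x i h1 h2 hi1 hi2⟩
  · intro i hi j hj hij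
    simp only [Finset.coe_Ico, Set.mem_Ico] at hi hj
    rw [← h.loc_elems x i h1 h2 hi.1 hi.2, ← h.loc_elems x j h1 h2 hj.1 hj.2, hij]

/-- Marking an element that is not marked yet. -/
theorem Valid.mark (h : R.Valid n) {e : ℕ} (h1 : 1 ≤ e) (hn : e ≤ n)
    (hm : R.mid (R.sidx e) ≤ R.loc e) : (R.mark e).Valid n := by
  have hv1 := h.one_le_sidx e h1 hn
  have hv2 := h.sidx_le e h1 hn
  have hl2 := h.loc_lt e h1 hn
  have hm1 := h.le_mid _ hv1 hv2
  have hx := h.sidx_elems _ _ hv1 hv2 hm1 (hm.trans_lt hl2)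
  have hx1 := h.one_le_elems _ _ hv1 hv2 hm1 (hm.trans_lt hl2)
  have hx2 := h.elems_le _ _ hv1 hv2 hm1 (hm.trans_lt hl2)
  have hx3 := h.loc_elems _ _ hv1 hv2 hm1 (hm.trans_lt hl2)
  have he := h.elems_loc e h1 hn
  constructor <;> simp only [RP.mark, Function.update_apply]
  case sum_size_le => exact h.sum_size_le
  case le_loc => intro y hy1 hy2; have := h.le_loc y hy1 hy2; grind
  case loc_lt => intro y hy1 hy2; have := h.loc_lt y hy1 hy2; grind
  case elems_loc => intro y hy1 hy2; have := h.elems_loc y hy1 hy2; grind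
  case one_le_sidx => exact h.one_le_sidx
  case sidx_le => exact h.sidx_le
  case one_le_first => exact h.one_le_first
  case first_lt => exact h.first_lt
  case lim_le => exact h.lim_le
  case le_mid => intro y hy1 hy2; have := h.le_mid y hy1 hy2; grind
  case mid_le => intro y hy1 hy2; have := h.mid_le y hy1 hy2; grind
  case one_le_elems =>
    intro y i hy1 hy2 hi1 hi2; have := h.one_le_elems y i hy1 hy2 hi1 hi2; grind
  case elems_le => intro y i hy1 hy2 hi1 hi2; have := h.elems_le y i hy1 hy2 hi1 hi2; grind
  case loc_elems => intro y i hy1 hy2 hi1 hi2; have := h.loc_elems y i hy1 hy2 hi1 hi2; grind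
  case sidx_elems =>
    intro y i hy1 hy2 hi1 hi2; have := h.sidx_elems y i hy1 hy2 hi1 hi2; grind

theorem Valid.marks_mark (h : R.Valid n) {e : ℕ} (h1 : 1 ≤ e) (hn : e ≤ n) :
    (R.mark e).marks ≤ R.marks + 1 := by
  have hv : R.sidx e ∈ Finset.Icc 1 R.sets :=
    Finset.mem_Icc.2 ⟨h.one_le_sidx e h1 hn, h.sidx_le e h1 hn⟩
  have := sum_add_eq_of_eq_off (f := fun v => R.mid v - R.first v)
    (g := fun v => (R.mark e).mid v - (R.mark e).first v) hv
    (fun x _ hx => by simp [RP.mark, hx])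
  simp only [marks]
  simp only [RP.mark, Function.update_self] at this ⊢
  omega

theorem Valid.unmark (h : R.Valid n) (v : ℕ) : (R.unmark v).Valid n where
  le_loc := h.le_loc
  loc_lt := h.loc_lt
  elems_loc := h.elems_loc
  one_le_sidx := h.one_le_sidx
  sidx_le := h.sidx_le
  one_le_first := h.one_le_first
  first_lt := h.first_lt
  lim_le := h.lim_le
  le_mid x := by
    have := h.le_mid x
    simp only [RP.unmark, Function.update_apply]
    grind
  mid_le x := by
    have := h.mid_le x
    have := h.first_lt x
    simp only [RP.unmark, Function.update_apply]
    grind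
  one_le_elems := h.one_le_elems
  elems_le := h.elems_le
  loc_elems := h.loc_elems
  sidx_elems := h.sidx_elems
  sum_size_le := h.sum_size_le

theorem marks_unmark_le (v : ℕ) : (R.unmark v).marks ≤ R.marks := by
  refine Finset.sum_le_sum fun x _ => ?_
  by_cases hx : x = v
  · subst hx; simp [RP.unmark]
  · simp [RP.unmark, hx]

/-- A sum over sets when the term of set `v` is distributed to `v` and to a new last set, possibly
with a loss. -/
theorem sum_cut {f g : ℕ → ℕ} {k v : ℕ} (h1 : 1 ≤ v) (hk : v ≤ k)
    (h : ∀ x, x ≠ v → x ≤ k → g x = f x) (hv : g v + g (k + 1) ≤ f v) :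
    ∑ x ∈ Finset.Icc 1 (k + 1), g x + (f v - (g v + g (k + 1))) = ∑ x ∈ Finset.Icc 1 k, f x := by
  rw [Finset.sum_Icc_succ_top (by omega)]
  have := sum_add_eq_of_eq_off (f := f) (g := g) (Finset.mem_Icc.2 ⟨h1, hk⟩)
    (fun x hx hxv => h x hxv (Finset.mem_Icc.1 hx).2)
  omega

section Cut

variable (h : R.Valid n) {v : ℕ} (h1 : 1 ≤ v) (h2 : v ≤ R.sets) (hf : R.first v < R.mid v)
  (hl : R.mid v < R.lim v)

include h h1 h2 hl in
/-- The set numbers after a cut, in terms of positions instead of the relabelled range. -/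
theorem Valid.cut_sidx {e : ℕ} (he1 : 1 ≤ e) (hen : e ≤ n) :
    (R.cut v).sidx e =
      if R.sidx e = v ∧ R.loc e < R.mid v then R.sets + 1 else R.sidx e := by
  simp only [cut, relabel]
  congr 1
  apply propext
  constructor
  · rintro ⟨i, hi1, hi2, rfl⟩
    exact ⟨h.sidx_elems v i h1 h2 hi1 (hi2.trans hl),
      by rw [h.loc_elems v i h1 h2 hi1 (hi2.trans hl)]; exact hi2⟩
  · rintro ⟨rfl, he⟩
    exact ⟨R.loc e, h.le_loc e he1 hen, he, h.elems_loc e he1 hen⟩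

include h h1 h2 hf hl in
theorem Valid.cut : (R.cut v).Valid n := by
  have hs := fun e he1 hen => h.cut_sidx (e := e) h1 h2 hl he1 hen
  have hvn : v ≠ R.sets + 1 := by omega
  have hfi : (R.cut v).first =
    Function.update (Function.update R.first (R.sets + 1) (R.first v)) v (R.mid v) := rfl
  have hli : (R.cut v).lim = Function.update R.lim (R.sets + 1) (R.mid v) := rfl
  have hmi : (R.cut v).mid = Function.update R.mid (R.sets + 1) (R.first v) := rfl
  have hlo : (R.cut v).loc = R.loc := rfl
  have hel : (R.cut v).elems = R.elems := rfl
  have hse : (R.cut v).sets = R.sets + 1 := rfl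
  have hm' := h.mid_le
  have hfm := h.le_mid
  have hlim := h.lim_le v h1 h2
  have hfirst := h.one_le_first v h1 h2
  -- where the elements of a set of the cut partition come from
  have key : ∀ x i, 1 ≤ x → x ≤ R.sets + 1 → (R.cut v).first x ≤ i → i < (R.cut v).lim x →
      ∃ y, 1 ≤ y ∧ y ≤ R.sets ∧ R.first y ≤ i ∧ i < R.lim y ∧
        (if y = v ∧ i < R.mid v then R.sets + 1 else y) = x := by
    intro x i hx1 hx2 hi1 hi2
    rw [hfi] at hi1
    rw [hli] at hi2
    by_cases hx : x = R.sets + 1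
    · exact ⟨v, h1, h2, by grind⟩
    · exact ⟨x, hx1, by omega, by grind⟩
  constructor
  case sum_size_le =>
    refine le_trans (le_of_eq_of_le ?_ (Nat.le_refl _)) h.sum_size_le
    rw [hse, ← sum_cut (g := fun x => (R.cut v).lim x - (R.cut v).first x) h1 h2, hfi, hli]
    · simp [hvn, hvn.symm]; omega
    · intro x hxv hx
      have : x ≠ R.sets + 1 := by omega
      simp [hfi, hli, hxv, this]
    · simp [hfi, hli, hvn, hvn.symm]; omega
  case elems_loc => exact h.elems_loc
  case le_loc =>
    intro y hy1 hy2
    have := h.le_loc y hy1 hy2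
    have := h.sidx_le y hy1 hy2
    rw [hs y hy1 hy2, hfi, hlo]
    simp only [Function.update_apply]
    grind
  case loc_lt =>
    intro y hy1 hy2
    have := h.loc_lt y hy1 hy2
    have := h.sidx_le y hy1 hy2
    rw [hs y hy1 hy2, hli, hlo]
    simp only [Function.update_apply]
    grind
  case one_le_sidx =>
    intro y hy1 hy2
    have := h.one_le_sidx y hy1 hy2
    rw [hs y hy1 hy2]
    grind
  case sidx_le =>
    intro y hy1 hy2
    have := h.sidx_le y hy1 hy2
    rw [hs y hy1 hy2]
    grind
  case one_le_first =>
    intro y hy1 hy2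
    have := h.one_le_first y hy1
    rw [hse] at hy2
    simp only [hfi, Function.update_apply]
    grind
  case first_lt =>
    intro y hy1 hy2
    have := h.first_lt y hy1
    rw [hse] at hy2
    simp only [hfi, hli, Function.update_apply]
    grind
  case lim_le =>
    intro y hy1 hy2
    have := h.lim_le y hy1
    rw [hse] at hy2
    simp only [hli, Function.update_apply]
    grind
  case le_mid =>
    intro y hy1 hy2
    have := h.le_mid y hy1
    rw [hse] at hy2
    simp only [hfi, hmi, Function.update_apply]
    grind
  case mid_le =>
    intro y hy1 hy2
    have := h.mid_le y hy1
    rw [hse] at hy2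
    simp only [hli, hmi, Function.update_apply]
    grind
  case one_le_elems =>
    intro x i hx1 hx2 hi1 hi2
    obtain ⟨y, hy1, hy2, hy3, hy4, -⟩ := key x i hx1 hx2 hi1 hi2
    exact h.one_le_elems y i hy1 hy2 hy3 hy4
  case elems_le =>
    intro x i hx1 hx2 hi1 hi2
    obtain ⟨y, hy1, hy2, hy3, hy4, -⟩ := key x i hx1 hx2 hi1 hi2
    exact h.elems_le y i hy1 hy2 hy3 hy4
  case loc_elems =>
    intro x i hx1 hx2 hi1 hi2
    obtain ⟨y, hy1, hy2, hy3, hy4, -⟩ := key x i hx1 hx2 hi1 hi2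
    exact h.loc_elems y i hy1 hy2 hy3 hy4
  case sidx_elems =>
    intro x i hx1 hx2 hi1 hi2
    obtain ⟨y, hy1, hy2, hy3, hy4, hy5⟩ := key x i hx1 hx2 hi1 hi2
    rw [hel, hs _ (h.one_le_elems y i hy1 hy2 hy3 hy4) (h.elems_le y i hy1 hy2 hy3 hy4),
      h.sidx_elems y i hy1 hy2 hy3 hy4, h.loc_elems y i hy1 hy2 hy3 hy4, hy5]

include h1 h2 in
/-- A cut uses up the marks of the set; they pay for the relabelling. -/
theorem marks_cut : (R.cut v).marks + (R.mid v - R.first v) = R.marks := by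
  have hvn : v ≠ R.sets + 1 := by omega
  have := sum_cut (f := fun x => R.mid x - R.first x)
    (g := fun x => (R.cut v).mid x - (R.cut v).first x) h1 h2
    (fun x hxv hx => by
      have : x ≠ R.sets + 1 := by omega
      simp [cut, hxv, this])
    (by simp [cut, hvn, hvn.symm])
  rw [marks, marks, ← this]
  simp [cut, hvn, hvn.symm]

include h2 in
theorem size_cut_new : (R.cut v).size (R.sets + 1) = R.mid v - R.first v := by
  have hvn : v ≠ R.sets + 1 := by omega
  simp [size, cut, hvn.symm]

include h2 in
theorem size_cut_self : (R.cut v).size v = R.lim v - R.mid v := by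
  have hvn : v ≠ R.sets + 1 := by omega
  simp [size, cut, hvn]

theorem size_cut_of_ne {x : ℕ} (hx : x ≠ v) (hx2 : x ≤ R.sets) : (R.cut v).size x = R.size x := by
  have hvn : x ≠ R.sets + 1 := by omega
  simp [size, cut, hvn, hx]

include h h1 h2 in
theorem Valid.size_cut_le {x : ℕ} (hx2 : x ≤ R.sets) : (R.cut v).size x ≤ R.size x := by
  by_cases hx : x = v
  · subst hx
    have := h.le_mid x h1 h2
    rw [size_cut_self h2, size]
    omega
  · exact (size_cut_of_ne hx hx2).le

include h h1 h2 hf hl in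
/-- The elements of the smaller half of a set that is cut pay for a scan of that half: the
logarithm of the size of their set decreases by at least `1`. -/
theorem Valid.logSum_cut (w : ℕ → ℕ) {x : ℕ} (hx : x = v ∨ x = R.sets + 1)
    (hv : (R.cut v).size x ≤ (R.cut v).size v)
    (hn : (R.cut v).size x ≤ (R.cut v).size (R.sets + 1)) :
    logSum n w (R.cut v) + ∑ i ∈ Finset.Ico ((R.cut v).first x) ((R.cut v).lim x), w (R.elems i) ≤
      logSum n w R := by
  have hc := h.cut h1 h2 hf hl
  have hx1 : 1 ≤ x := by omega
  have hx2 : x ≤ (R.cut v).sets := by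
    have : (R.cut v).sets = R.sets + 1 := rfl
    omega
  have hsum := hc.sum_elems_le w hx1 hx2
  refine le_trans (Nat.add_le_add_left hsum _) ?_
  rw [logSum, logSum, ← Finset.sum_add_distrib]
  refine Finset.sum_le_sum fun q hq => ?_
  rw [Finset.mem_Icc] at hq
  have hself := size_cut_self h2
  have hnew := size_cut_new h2
  have hsz : R.size v = R.lim v - R.first v := rfl
  have hcs := h.cut_sidx h1 h2 hl hq.1 hq.2
  have hle : (R.cut v).size ((R.cut v).sidx q) ≤ R.size (R.sidx q) := by
    rw [hcs]
    split_ifs with hc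
    · rw [hc.1]; omega
    · exact h.size_cut_le h1 h2 (h.sidx_le q hq.1 hq.2)
  by_cases hqx : (R.cut v).sidx q = x
  · have hqv : R.sidx q = v := by
      have := h.sidx_le q hq.1 hq.2
      rw [hcs] at hqx
      split_ifs at hqx with hc
      · exact hc.1
      · omega
    rw [if_pos hqx, hqx, hqv]
    have hpos : (R.cut v).size x ≠ 0 := by
      rcases hx with rfl | rfl <;> omega
    -- the set `v` is at least twice as large as its smaller half `x`
    have hlog : Nat.log 2 ((R.cut v).size x) + 1 ≤ Nat.log 2 (R.size v) := by
      rw [← Nat.log_mul_base (by omega) hpos]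
      exact Nat.log_mono_right (by omega)
    calc _ = w q * (Nat.log 2 ((R.cut v).size x) + 1) := by ring
      _ ≤ _ := Nat.mul_le_mul_left _ hlog
  · rw [if_neg hqx, add_zero]
    exact Nat.mul_le_mul_left _ (Nat.log_mono_right hle)

end Cut

end RP
/-! ### Marking -/

namespace Frame

variable {L : List Reg} {M : List Arr} {s s' s'' : State}

@[simp] theorem refl : Frame L M s s := ⟨fun _ _ => rfl, fun _ _ => rfl⟩

theorem trans (h : Frame L M s s') (h' : Frame L M s' s'') : Frame L M s s'' :=
  ⟨fun r hr => (h'.reg r hr).trans (h.reg r hr), fun A hA => (h'.arr A hA).trans (h.arr A hA)⟩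

theorem mono {L' : List Reg} {M' : List Arr} (h : Frame L M s s') (hL : L ⊆ L') (hM : M ⊆ M') :
    Frame L' M' s s' :=
  ⟨fun r hr => h.reg r fun hr' => hr (hL hr'), fun A hA => h.arr A fun hA' => hA (hM hA')⟩

@[simp] theorem charge {c : ℕ} {w : Arr → ℕ} : Frame L M s (s'.charge c w) ↔ Frame L M s s' :=
  ⟨fun h => ⟨h.reg, h.arr⟩, fun h => ⟨h.reg, h.arr⟩⟩

@[simp] theorem charge_left {c : ℕ} {w : Arr → ℕ} :
    Frame L M (s.charge c w) s' ↔ Frame L M s s' :=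
  ⟨fun h => ⟨h.reg, h.arr⟩, fun h => ⟨h.reg, h.arr⟩⟩

@[simp] theorem setReg {r : Reg} {v : ℕ} (hr : r ∈ L) :
    Frame L M s (s'.setReg r v) ↔ Frame L M s s' := by
  constructor
  · refine fun h => ⟨fun x hx => ?_, h.arr⟩
    rw [← h.reg x hx, State.setReg_reg, Function.update_of_ne (by rintro rfl; exact hx hr)]
  · refine fun h => ⟨fun x hx => ?_, h.arr⟩
    rw [← h.reg x hx, State.setReg_reg, Function.update_of_ne (by rintro rfl; exact hx hr)]

@[simp] theorem setReg_left {r : Reg} {v : ℕ} (hr : r ∈ L) :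
    Frame L M (s.setReg r v) s' ↔ Frame L M s s' := by
  constructor
  · refine fun h => ⟨fun x hx => ?_, h.arr⟩
    rw [h.reg x hx, State.setReg_reg, Function.update_of_ne (by rintro rfl; exact hx hr)]
  · refine fun h => ⟨fun x hx => ?_, h.arr⟩
    rw [h.reg x hx, State.setReg_reg, Function.update_of_ne (by rintro rfl; exact hx hr)]

@[simp] theorem pickReg {r : Reg} {v : ℕ} (hr : r ∈ L) :
    Frame L M s (s'.pickReg r v) ↔ Frame L M s s' := by
  constructor
  · refine fun h => ⟨fun x hx => ?_, h.arr⟩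
    rw [← h.reg x hx, State.pickReg_reg, Function.update_of_ne (by rintro rfl; exact hx hr)]
  · refine fun h => ⟨fun x hx => ?_, h.arr⟩
    rw [← h.reg x hx, State.pickReg_reg, Function.update_of_ne (by rintro rfl; exact hx hr)]

@[simp] theorem setArr {A : Arr} {i v : ℕ} (hA : A ∈ M) :
    Frame L M s (s'.setArr A i v) ↔ Frame L M s s' := by
  constructor
  · refine fun h => ⟨h.reg, fun x hx => ?_⟩
    rw [← h.arr x hx, State.setArr_arr, Function.update_of_ne (by rintro rfl; exact hx hA)]
  · refine fun h => ⟨h.reg, fun x hx => ?_⟩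
    rw [← h.arr x hx, State.setArr_arr, Function.update_of_ne (by rintro rfl; exact hx hA)]

end Frame

attribute [simp] RPart.elems RPart.loc RPart.sidx RPart.first RPart.lim RPart.mid

/-- The registers that `Mark` may change. -/
def markRegs : List Reg := [.markS, .markL, .markM]

/-- The arrays that `Mark` may change. -/
def markArrs (P : RPart) : List Arr := [.part P .elems, .part P .loc, .part P .mid]

@[simp] theorem mem_markRegs {r : Reg} :
    r ∈ markRegs ↔ r = .markS ∨ r = .markL ∨ r = .markM := by
  simp [markRegs]

@[simp] theorem mem_markArrs {P : RPart} {A : Arr} :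
    A ∈ markArrs P ↔ A = .part P .elems ∨ A = .part P .loc ∨ A = .part P .mid := by
  simp [markArrs]

/-- The effect of `Mark`: at most one more element is marked, in time `c`. All indices used are
below `N`. -/
structure MarkPost (P : RPart) (n N c : ℕ) (s s' : State) : Prop where
  frame : Frame markRegs (markArrs P) s s'
  valid : (s'.rp P).Valid n
  marks : (s'.rp P).marks ≤ (s.rp P).marks + 1
  ext : Within N s'.ext
  time : s'.time ≤ s.time + c

/-- `Mark(e)`. The expression `e` is evaluated several times, also between the assignments, so its
value may not depend on what `Mark` changes. -/
theorem wp_mark {P : RPart} {n N v : ℕ} {e : Expr} {s : State} (hR : (s.rp P).Valid n)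
    (h1 : 1 ≤ v) (hn : v ≤ n) (hN : n + 1 < N) (hext : Within N s.ext)
    (he : ∀ s', Frame markRegs (markArrs P) s s' → e.eval s' = v ∧ Within N (e.touch s')) :
    wp (P.mark e) s (MarkPost P n N (40 + 4 * e.cost) s) := by
  have he1 := fun s' h => (he s' h).1
  have he2 := fun s' h => (he s' h).2
  have hv1 := hR.one_le_sidx v h1 hn
  have hv2 := hR.sidx_le v h1 hn
  have hl1 := hR.le_loc v h1 hn
  have hl2 := hR.loc_lt v h1 hn
  have hl3 := hR.lim_le _ hv1 hv2
  have hs := hR.sets_le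
  have hm := hR.mid_le _ hv1 hv2
  have hx := hR.elems_le _ _ hv1 hv2 (hR.le_mid _ hv1 hv2)
  simp only [State.rp] at hv1 hv2 hl1 hl2 hl3 hs hm hx
  simp only [RPart.mark, wp_seq, wp_assign]
  refine wp_cond (fun ht => ?_) (fun ht => ?_)
  · simp (maxDischargeDepth := 5) [he1] at ht
    have hmark : (s.rp P).mid ((s.rp P).sidx v) ≤ (s.rp P).loc v := ht
    have hx' := hx (by omega)
    simp only [RPart.setElems, RPart.setLoc, RPart.setMid, wp_seq, wp_store]
    have key : ∀ s' : State, s'.rp P = (s.rp P).mark v → (s'.rp P).Valid n ∧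
        (s'.rp P).marks ≤ (s.rp P).marks + 1 := by
      intro s' hs'
      rw [hs']
      exact ⟨hR.mark h1 hn hmark, hR.marks_mark h1 hn⟩
    refine (fun {s'} hf hk ht hx => ⟨hf, (key s' hk).1, (key s' hk).2, hx, ht⟩ :
      ∀ {s' : State}, Frame markRegs (markArrs P) s s' → s'.rp P = (s.rp P).mark v →
        s'.time ≤ s.time + (40 + 4 * e.cost) → Within N s'.ext → MarkPost P n N _ s s') ?_ ?_ ?_ ?_
    · simp
    · simp (maxDischargeDepth := 5) [State.rp, RP.mark, he1]
    · simp
      omega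
    · simp (maxDischargeDepth := 5) [he1, he2, hext]
      omega
  · simp only [wp_skip]
    constructor
    · simp
    · simpa [State.rp] using hR
    · simp [State.rp]
    · simp (maxDischargeDepth := 5) [he1, he2, hext]
      omega
    · simp
      omega

/-! ### Splitting a set -/

attribute [simp] RPart.setElems RPart.setLoc RPart.setSidx RPart.setFirst RPart.setLim RPart.setMid

namespace RP

theorem relabel_self {R : RP} {f x : ℕ} : R.relabel f f x = R.sidx := by
  funext e
  rw [relabel, if_neg]
  rintro ⟨i, hi1, hi2, -⟩
  omega

theorem relabel_congr {R R' : RP} (he : R.elems = R'.elems) (hs : R.sidx = R'.sidx)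
    {f l x : ℕ} : R.relabel f l x = R'.relabel f l x := by
  funext e
  rw [relabel, relabel, he, hs]

/-- One round of the loop of `Split` extends the relabelled range by one position. -/
theorem relabel_succ {R : RP} {f l x : ℕ} (h : f ≤ l) :
    R.relabel f (l + 1) x = Function.update (R.relabel f l x) (R.elems l) x := by
  funext e
  rw [Function.update_apply]
  unfold relabel
  by_cases he : e = R.elems l
  · rw [if_pos he, if_pos ⟨l, h, Nat.lt_succ_self l, he.symm⟩]
  · rw [if_neg he]
    congr 1
    apply propext
    constructor
    · rintro ⟨i, hi1, hi2, hi3⟩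
      refine ⟨i, hi1, lt_of_le_of_ne (Nat.lt_succ_iff.1 hi2) ?_, hi3⟩
      rintro rfl
      exact he hi3.symm
    · rintro ⟨i, hi1, hi2, hi3⟩
      exact ⟨i, hi1, Nat.lt_succ_of_lt hi2, hi3⟩

end RP

/-- The loop of `Split`, which gives the elements in positions `f, …, m - 1` the set number `x`. -/
theorem wp_relabel {P : RPart} {N x f m : ℕ} {s : State} (hx : s.reg (.sets P) = x)
    (hf : s.arr (.part P .first) x = f) (hm : s.arr (.part P .lim) x = m) (hfm : f ≤ m)
    (hmN : m ≤ N) (hxN : x < N) (hel : ∀ i, f ≤ i → i < m → s.arr (.part P .elems) i < N)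
    (hext : Within N s.ext) :
    wp (.forUp .splitL (P.first (Reg.sets P)) (P.lim (Reg.sets P))
      (P.setSidx (P.elems Reg.splitL) (Reg.sets P))) s fun s' =>
      Frame [.splitL] [.part P .sidx] s s' ∧
      s'.arr (.part P .sidx) = (s.rp P).relabel f m x ∧ Within N s'.ext ∧
      s'.time ≤ s.time + 20 + 20 * (m - f) := by
  simp only [Cmd.forUp, wp_seq, wp_assign]
  refine wp_while (fun s' => Frame [.splitL] [.part P .sidx] s s' ∧
      s'.arr (.part P .sidx) = (s.rp P).relabel f (s'.reg .splitL) x ∧ Within N s'.ext ∧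
      f ≤ s'.reg .splitL ∧ s'.reg .splitL ≤ m ∧
      s'.time + 20 * (m - s'.reg .splitL) ≤ s.time + 10 + 20 * (m - f))
    (s.time + 10 + 20 * (m - f)) ?_ ?_ ?_ ?_
  · simp [hx, hf, hfm, hext, hxN, RP.relabel_self]
    rfl
  · rintro s' ⟨-, -, -, -, -, h⟩
    omega
  · rintro s' ⟨hfr, hsi, hex, h1, h2, ht⟩ hc
    have e1 := hfr.reg (.sets P) (by simp)
    have e2 := hfr.arr (.part P .lim) (by simp)
    have e3 := hfr.arr (.part P .elems) (by simp)
    simp [e1, e2, hx, hm] at hc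
    have := hel _ h1 hc
    simp [hfr, hex, e1, e3, hx, hsi, RP.relabel_succ h1, hxN]
    refine ⟨rfl, ?_⟩
    omega
  · rintro s' ⟨hfr, hsi, hex, h1, h2, ht⟩ hc
    have e1 := hfr.reg (.sets P) (by simp)
    have e2 := hfr.arr (.part P .lim) (by simp)
    simp [e1, e2, hx, hm] at hc
    have : s'.reg .splitL = m := by omega
    rw [this] at ht
    simp [hfr, hex, e1, hx, hsi, this, hxN]
    omega

/-- The registers that `Split` may change besides the one that holds its result. -/
def splitRegs (P : RPart) : List Reg := [.sets P, .splitL]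

/-- The arrays that `Split` may change. -/
def splitArrs (P : RPart) : List Arr :=
  [.part P .sidx, .part P .first, .part P .lim, .part P .mid]

@[simp] theorem mem_splitRegs {P : RPart} {r : Reg} :
    r ∈ splitRegs P ↔ r = .sets P ∨ r = .splitL := by
  simp [splitRegs]

@[simp] theorem mem_splitArrs {P : RPart} {A : Arr} :
    A ∈ splitArrs P ↔
      A = .part P .sidx ∨ A = .part P .first ∨ A = .part P .lim ∨ A = .part P .mid := by
  simp [splitArrs]

/-- The set `v` was not split: at most, its marks were removed. -/
structure SplitNone (P : RPart) (r : Reg) (s s' : State) : Prop where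
  result : s'.reg r = 0
  sidx : (s'.rp P).sidx = (s.rp P).sidx
  first : (s'.rp P).first = (s.rp P).first
  lim : (s'.rp P).lim = (s.rp P).lim
  sets : (s'.rp P).sets = (s.rp P).sets
  marks : (s'.rp P).marks ≤ (s.rp P).marks
  time : s'.time ≤ s.time + 100

/-- The marked elements of the set `v` became a set of their own. -/
structure SplitCut (P : RPart) (r : Reg) (v : ℕ) (s s' : State) : Prop where
  first_lt : (s.rp P).first v < (s.rp P).mid v
  lt_lim : (s.rp P).mid v < (s.rp P).lim v
  result : s'.reg r = (s.rp P).sets + 1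
  rp : s'.rp P = (s.rp P).cut v
  time : s'.time ≤ s.time + 100 + 20 * ((s.rp P).mid v - (s.rp P).first v)

/-- The effect of `Split(v)` with its result in register `r`. -/
structure SplitPost (P : RPart) (r : Reg) (n N v : ℕ) (s s' : State) : Prop where
  frame : Frame (r :: splitRegs P) (splitArrs P) s s'
  valid : (s'.rp P).Valid n
  ext : Within N s'.ext
  cases : SplitNone P r s s' ∨ SplitCut P r v s s'

/-- `Split(e)`. A set of which all elements are marked just loses its marks; otherwise the time is
proportional to the number of marks. -/
theorem wp_split {P : RPart} {r : Reg} {n N v : ℕ} {e : Expr} {s : State}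
    (hR : (s.rp P).Valid n) (h1 : 1 ≤ v) (hv : v ≤ s.reg (.sets P)) (hN : n + 1 < N)
    (hext : Within N s.ext) (hr : r ≠ .sets P)
    (he1 : ∀ s', Frame (splitRegs P) (splitArrs P) s s' → e.eval s' = v)
    (he2 : ∀ s', e.touch s' = 0) (hec : e.cost = 1) :
    wp (P.split r e) s (SplitPost P r n N v s) := by
  have hs := hR.sets_le
  have hfl := hR.first_lt v h1 hv
  have hfm := hR.le_mid v h1 hv
  have hml := hR.mid_le v h1 hv
  have hln := hR.lim_le v h1 hv
  simp only [State.rp] at hs hfl hfm hml hln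
  have hvN : v < N := by omega
  simp only [RPart.split, wp_seq]
  refine wp_cond (fun ht => ?_) (fun ht => ?_)
  · simp [he1] at ht
    simp only [RPart.setMid, wp_store]
    refine wp_cond (fun ht2 => ?_) (fun ht2 => ?_)
    · simp only [wp_assign]
      refine ⟨by simp [splitRegs], ?_, ?_, .inl ⟨?_, ?_, ?_, ?_, ?_, ?_, ?_⟩⟩
      · have := hR.unmark v
        rw [RP.unmark] at this
        simpa (maxDischargeDepth := 5) [State.rp, he1, hr.symm] using this
      · simp (maxDischargeDepth := 5) [he1, he2, hext, hvN]
      · simp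
      · simp [State.rp]
      · simp [State.rp]
      · simp [State.rp]
      · simp [State.rp, hr.symm]
      · have := RP.marks_unmark_le (R := s.rp P) v
        rw [RP.unmark] at this
        simpa (maxDischargeDepth := 5) [State.rp, he1, hr.symm] using this
      · simp [hec]
    · -- after the removal of the marks, `mid` equals `first`
      simp (maxDischargeDepth := 5) [he1] at ht2
  · simp [he1] at ht
    simp only [wp_skip]
    refine wp_cond (fun ht2 => ?_) (fun ht2 => ?_)
    · simp only [wp_assign]
      refine ⟨by simp [splitRegs], ?_, ?_, .inl ⟨?_, ?_, ?_, ?_, ?_, ?_, ?_⟩⟩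
      · simpa [State.rp, hr.symm] using hR
      · simp (maxDischargeDepth := 5) [he1, he2, hext, hvN]
      · simp
      · simp [State.rp]
      · simp [State.rp]
      · simp [State.rp]
      · simp [State.rp, hr.symm]
      · simp [State.rp, RP.marks, hr.symm]
      · simp [hec]
    · simp (maxDischargeDepth := 5) [he1] at ht2
      have hlt1 : (s.rp P).first v < (s.rp P).mid v := lt_of_le_of_ne hfm (Ne.symm ht2)
      have hlt2 : (s.rp P).mid v < (s.rp P).lim v := lt_of_le_of_ne hml ht
      have hvx : v ≠ s.reg (.sets P) + 1 := by omega
      simp only [wp_seq, wp_assign, wp_store, RPart.setFirst, RPart.setMid, RPart.setLim]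
      refine wp_weaken (fun t => Frame (splitRegs P) (splitArrs P) s t ∧ Within N t.ext ∧
          t.time ≤ s.time + 75 ∧ t.reg (.sets P) = (s.rp P).sets + 1 ∧
          t.arr (.part P .sidx) = (s.rp P).sidx ∧ t.arr (.part P .first) = ((s.rp P).cut v).first ∧
          t.arr (.part P .lim) = ((s.rp P).cut v).lim ∧
          t.arr (.part P .mid) = ((s.rp P).cut v).mid) ?_ ?_
      · refine ⟨by simp, ?_, ?_, ?_, ?_, ?_, ?_, ?_⟩
        · simp (maxDischargeDepth := 5) [he1, he2, hext, hvN, hvx]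
          omega
        · simp [hec]
        · simp [State.rp]
        · simp [State.rp]
        · simp (maxDischargeDepth := 5) [State.rp, RP.cut, he1, hvx]
        · simp (maxDischargeDepth := 5) [State.rp, RP.cut, he1, hvx]
        · simp (maxDischargeDepth := 5) [State.rp, RP.cut, he1, hvx]
      rintro t ⟨hft, hext, htime, b1, b2, b3, b4, b5⟩
      have b6 := hft.arr (.part P .elems) (by simp)
      have b7 := hft.arr (.part P .loc) (by simp)
      refine (wp_relabel (N := N) b1 (f := (s.rp P).first v) (m := (s.rp P).mid v) ?_ ?_ hlt1.le
        ?_ ?_ ?_ hext).mono ?_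
      · simp [b3, RP.cut, State.rp, hvx.symm]
      · simp [b4, RP.cut]
      · simp only [State.rp]; omega
      · simp only [State.rp]; omega
      · intro i hi1 hi2
        have := hR.elems_le v i h1 hv hi1 (hi2.trans hlt2)
        rw [b6]
        simp only [State.rp] at this
        omega
      · rintro s' ⟨hfr, hsi, hex, htime'⟩
        have e1 := hfr.reg (.sets P) (by simp)
        have hrp : s'.rp P = (s.rp P).cut v := by
          have a1 := hfr.arr (.part P .elems) (by simp)
          have a2 := hfr.arr (.part P .loc) (by simp)
          have a3 := hfr.arr (.part P .first) (by simp)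
          have a4 := hfr.arr (.part P .lim) (by simp)
          have a5 := hfr.arr (.part P .mid) (by simp)
          ext1
          · exact a1.trans b6
          · exact a2.trans b7
          · rw [RP.cut, ← RP.relabel_congr (R := t.rp P) (R' := s.rp P) b6 b2]
            exact hsi
          · exact a3.trans b3
          · exact a4.trans b4
          · exact a5.trans b5
          · exact e1.trans b1
        have hrp' : ((s'.charge ((Expr.reg (.sets P)).cost + 1)
            ((Expr.reg (.sets P)).touch s')).setReg r ((Expr.reg (.sets P)).eval s')).rp P =
            (s.rp P).cut v := by
          rw [← hrp]
          simp [State.rp, hr.symm]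
        refine ⟨?_, ?_, ?_, .inr ⟨hlt1, hlt2, ?_, hrp', ?_⟩⟩
        · rw [Frame.setReg (by simp), Frame.charge]
          exact (hft.mono (by simp) (by simp)).trans (hfr.mono (by simp) (by simp))
        · rw [hrp']
          exact hR.cut h1 hv hlt1 hlt2
        · simp [hex]
        · simp [e1, b1]
        · simp
          omega

/-! ### Simple sets -/

/-- The sum of `f` over the entries of a simple set. -/
def State.bagSum (s : State) (B : Bag) (f : ℕ → ℕ) : ℕ :=
  ∑ j ∈ Finset.range (s.reg (.size B)), f (s.arr (.bag B) j)

/-- All entries of a simple set satisfy `p`. -/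
def State.BagAll (s : State) (B : Bag) (p : ℕ → Prop) : Prop :=
  ∀ j < s.reg (.size B), p (s.arr (.bag B) j)

theorem Frame.bagSum {L : List Reg} {M : List Arr} {s s' : State} (h : Frame L M s s') {B : Bag}
    (hL : Reg.size B ∉ L) (hM : Arr.bag B ∉ M) (f : ℕ → ℕ) : s'.bagSum B f = s.bagSum B f := by
  rw [State.bagSum, State.bagSum, h.reg _ hL, h.arr _ hM]

theorem Frame.bagAll {L : List Reg} {M : List Arr} {s s' : State} (h : Frame L M s s') {B : Bag}
    (hL : Reg.size B ∉ L) (hM : Arr.bag B ∉ M) {p : ℕ → Prop} (hp : s.BagAll B p) :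
    s'.BagAll B p := by
  rw [State.BagAll, h.reg _ hL, h.arr _ hM]
  exact hp

/-- The effect of `Add` with argument `v`, where `c` is the time to evaluate the argument. -/
structure AddPost (B : Bag) (N c v : ℕ) (s s' : State) : Prop where
  frame : Frame [.size B] [.bag B] s s'
  size : s'.reg (.size B) = s.reg (.size B) + 1
  sum : ∀ f, s'.bagSum B f = s.bagSum B f + f v
  all : ∀ p, p v → s.BagAll B p → s'.BagAll B p
  ext : Within N s'.ext
  time : s'.time ≤ s.time + (10 + c)

theorem wp_add {B : Bag} {N : ℕ} {e : Expr} {s : State} (hs : s.reg (.size B) < N)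
    (he : Within N (e.touch s)) (hext : Within N s.ext) :
    wp (B.add e) s (AddPost B N e.cost (e.eval s) s) := by
  simp only [Bag.add, wp_seq, wp_store, wp_assign]
  refine ⟨by simp, by simp, fun f => ?_, fun p hp ha => ?_, by simp [hext, he, hs],
    by simp; omega⟩
  · simp only [State.bagSum]
    simp only [State.setReg_reg, State.setReg_arr, State.charge_reg, State.charge_arr,
      State.setArr_reg, State.setArr_arr, Expr.eval_add, Expr.eval_reg, Expr.eval_one,
      Function.update_self, Finset.sum_range_succ]
    congr 1
    refine Finset.sum_congr rfl fun j hj => ?_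
    rw [Function.update_of_ne (Finset.mem_range.1 hj).ne]
  · intro j hj
    simp only [State.setReg_reg, State.setReg_arr, State.charge_reg, State.charge_arr,
      State.setArr_reg, State.setArr_arr, Expr.eval_add, Expr.eval_reg, Expr.eval_one,
      Function.update_self] at hj ⊢
    by_cases hjs : j = s.reg (.size B)
    · subst hjs
      rwa [Function.update_self]
    · rw [Function.update_of_ne hjs]
      exact ha j (by omega)

/-- The effect of `r := Remove`. Which entry was removed is not specified: it is some value whose
removal accounts for the change of all sums over the simple set. -/
structure RemovePost (B : Bag) (r : Reg) (N : ℕ) (s s' : State) : Prop where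
  frame : Frame [.size B, .pick, r] [.bag B] s s'
  size : s'.reg (.size B) + 1 = s.reg (.size B)
  sum : ∀ f, s'.bagSum B f + f (s'.reg r) = s.bagSum B f
  all : ∀ p, s.BagAll B p → p (s'.reg r) ∧ s'.BagAll B p
  ext : Within N s'.ext
  time : s'.time ≤ s.time + 20

/-- Overwriting entry `i` by the last entry removes entry `i` from the sum. -/
theorem sum_range_update_last (g f : ℕ → ℕ) {m i : ℕ} (hi : i ≤ m) :
    ∑ j ∈ Finset.range m, f (Function.update g i (g m) j) + f (g i) =
      ∑ j ∈ Finset.range (m + 1), f (g j) := by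
  rw [Finset.sum_range_succ]
  rcases hi.eq_or_lt with rfl | hi
  · congr 1
    refine Finset.sum_congr rfl fun j hj => ?_
    rw [Function.update_of_ne (Finset.mem_range.1 hj).ne]
  · have := sum_add_eq_of_eq_off (f := fun j => f (g j))
      (g := fun j => f (Function.update g i (g m) j)) (Finset.mem_range.2 hi)
      (fun x _ hx => by simp [hx])
    simpa using this

/-- `r := Remove` for any choice of the oracle, which picks the position of the entry that is
removed. -/
theorem wp_remove {B : Bag} {r : Reg} {N : ℕ} {s : State} (hs : 0 < s.reg (.size B))
    (hN : s.reg (.size B) ≤ N) (hr : r ≠ .size B) (hrp : r ≠ .pick) (hext : Within N s.ext) :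
    wp (B.remove r) s (RemovePost B r N s) := by
  simp only [Bag.remove, wp_seq, wp_store, wp_assign, wp_choose]
  have hi := Nat.mod_lt (s.oracle 0) hs
  have hi2 : s.oracle 0 % s.reg (.size B) ≤ s.reg (.size B) - 1 := by omega
  have hm : s.reg (.size B) - 1 + 1 = s.reg (.size B) := by omega
  refine ⟨by simp, by simp [hr.symm]; omega, fun f => ?_, fun p hp => ⟨?_, fun j hj => ?_⟩, ?_, ?_⟩
  · have := sum_range_update_last (s.arr (.bag B)) f hi2
    rw [hm] at this
    simp only [State.bagSum]
    rw [← this]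
    simp [hr.symm, hrp.symm, hr]
  · simpa [hr, hrp] using hp _ hi
  · simp [hr.symm, hrp.symm] at hj ⊢
    rw [Function.update_apply]
    split_ifs
    · exact hp _ (by omega)
    · exact hp _ (by omega)
  · simp [hr.symm, hrp.symm, hext]
    omega
  · simp

/-! ### Touching the set of an element -/

/-- The effect of recording the set of element `v` in `B`, with register `y` as intermediate
storage, and marking `v`. -/
structure TouchPost (P : RPart) (B : Bag) (y : Reg) (n N v : ℕ) (s s' : State) : Prop where
  frame : Frame (y :: .size B :: markRegs) (.bag B :: markArrs P) s s'
  valid : (s'.rp P).Valid n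
  marks : (s'.rp P).marks ≤ (s.rp P).marks + 1
  size : s'.reg (.size B) ≤ s.reg (.size B) + 1
  all : ∀ p, p ((s.rp P).sidx v) → s.BagAll B p → s'.BagAll B p
  ext : Within N s'.ext
  time : s'.time ≤ s.time + 80

theorem Frame.rp {L : List Reg} {M : List Arr} {s s' : State} (h : Frame L M s s') {P : RPart}
    (hL : Reg.sets P ∉ L) (hM : ∀ f, Arr.part P f ∉ M) : s'.rp P = s.rp P := by
  simp only [State.rp, h.reg _ hL, h.arr _ (hM _)]

theorem State.rp_charge {s : State} {P : RPart} {c : ℕ} {w : Arr → ℕ} :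
    (s.charge c w).rp P = s.rp P := rfl

theorem State.rp_setReg {s : State} {P : RPart} {r : Reg} {v : ℕ} (h : r ≠ .sets P) :
    (s.setReg r v).rp P = s.rp P := by
  simp [State.rp, h.symm]

theorem State.bagAll_charge {s : State} {B : Bag} {c : ℕ} {w : Arr → ℕ} {p : ℕ → Prop} :
    (s.charge c w).BagAll B p ↔ s.BagAll B p := Iff.rfl

/-- Record the set of element `x` in `B` unless it was recorded before, and mark `x`. -/
theorem wp_touch {P : RPart} {B : Bag} {x y : Reg} {n N v : ℕ} {s : State}
    (hx : s.reg x = v) (hxy : x ≠ y) (hxB : x ≠ .size B) (hxm : x ∉ markRegs)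
    (hyB : y ≠ .size B) (hyP : y ≠ .sets P) (hR : (s.rp P).Valid n) (h1 : 1 ≤ v) (hn : v ≤ n)
    (hN : n + 1 < N) (hB : s.reg (.size B) < N) (hext : Within N s.ext) :
    wp (y ::= P.sidx x ;; .cond (P.noMarks y) (B.add y) .skip ;; P.mark x) s
      (TouchPost P B y n N v s) := by
  simp only [wp_seq, wp_assign]
  have hv1 := hR.sidx_le v h1 hn
  have hv2 := hR.sets_le
  simp only [State.rp] at hv1 hv2
  refine wp_weaken (fun t => Frame [y] [] s t ∧ t.reg y = (s.rp P).sidx v ∧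
    Within N t.ext ∧ t.time ≤ s.time + 3) ?_ ?_
  · simp [hx, hext, State.rp]
    omega
  rintro t ⟨hf, hy, hext, ht⟩
  have hrp : t.rp P = s.rp P := hf.rp (by simp [hyP.symm]) (by simp)
  have hmid := hf.arr (.part P .mid) (by simp)
  have hfir := hf.arr (.part P .first) (by simp)
  -- the state between the insertion into `B` and the marking
  have key : wp (.cond (P.noMarks y) (B.add y) .skip) t fun t' =>
      Frame (y :: [.size B]) [.bag B] s t' ∧ t'.reg (.size B) ≤ s.reg (.size B) + 1 ∧
      (∀ p, p ((s.rp P).sidx v) → s.BagAll B p → t'.BagAll B p) ∧ Within N t'.ext ∧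
      t'.time ≤ s.time + 30 := by
    have hsz := hf.reg (.size B) (by simp [hyB.symm])
    have hy' : t.reg y < N := by
      rw [hy]
      simp only [State.rp]
      omega
    have hall : ∀ p, s.BagAll B p → t.BagAll B p := fun p hp =>
      hf.bagAll (by simp [hyB.symm]) (by simp) hp
    refine wp_cond (fun _ => ?_) (fun _ => ?_)
    · refine (wp_add (N := N) ?_ ?_ ?_).mono ?_
      · simpa [hsz] using hB
      · simp
      · simp [RPart.noMarks, hext, hy']
      · rintro t' ⟨hf', hsize, -, hall', hext', htime'⟩
        refine ⟨?_, ?_, ?_, hext', ?_⟩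
        · exact (hf.mono (by simp) (by simp)).trans
            ((Frame.charge_left.1 hf').mono (by simp) (by simp))
        · rw [hsize, State.charge_reg, hsz]
        · intro p hp hp'
          refine hall' p ?_ (State.bagAll_charge.2 (hall p hp'))
          rwa [Expr.eval_reg, State.charge_reg, hy]
        · simp [RPart.noMarks] at htime'
          omega
    · rw [wp_skip]
      refine ⟨?_, ?_, ?_, ?_, ?_⟩
      · rw [Frame.charge, Frame.charge]
        exact hf.mono (by simp) (by simp)
      · simp [hsz]
      · intro p _ hp'
        exact State.bagAll_charge.2 (State.bagAll_charge.2 (hall p hp'))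
      · simp [RPart.noMarks, hext, hy']
      · simp [RPart.noMarks]
        omega
  refine key.mono ?_
  rintro t' ⟨hf', hsize, hall, hext', ht'⟩
  have hrp' : t'.rp P = s.rp P := hf'.rp (by simp [hyP.symm]) (by simp)
  refine (wp_mark (n := n) (v := v) ?_ h1 hn hN hext' ?_).mono ?_
  · rwa [hrp']
  · intro t'' hf''
    simp [hf''.reg x hxm, hf'.reg x (by simp [hxy, hxB]), hx]
  · rintro s' ⟨hf'', hval, hmarks, hext'', htime⟩
    refine ⟨?_, hval, ?_, ?_, ?_, hext'', ?_⟩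
    · exact (hf'.mono (by simp) (by simp)).trans (hf''.mono (by simp) (by simp))
    · rwa [hrp'] at hmarks
    · rwa [hf''.reg _ (by simp)]
    · intro p hp hp'
      exact hf''.bagAll (by simp) (by simp) (hall p hp hp')
    · simp at htime
      omega

/-! ### Scanning a set -/

/-- The scan of set `x` by `First` and `Next` has reached position `i`, and `v` is the element
there, or `0` after the last element. -/
def RP.Cursor (R : RP) (x i v : ℕ) : Prop :=
  R.first x ≤ i ∧ i ≤ R.lim x ∧ v = if i < R.lim x then R.elems i else 0

/-- The step from one element to the next takes constant time. -/
theorem wp_next {P : RPart} {r : Reg} {n N x i : ℕ} {s : State} (hR : (s.rp P).Valid n)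
    (h1 : 1 ≤ x) (h2 : x ≤ (s.rp P).sets) (hc : (s.rp P).Cursor x i (s.reg r))
    (hr : s.reg r ≠ 0) (hN : n + 1 < N) (hext : Within N s.ext) :
    wp (P.next r r) s fun s' => Frame [r] [] s s' ∧ (s.rp P).Cursor x (i + 1) (s'.reg r) ∧
      Within N s'.ext ∧ s'.time ≤ s.time + 20 := by
  obtain ⟨hi1, hi2, hv⟩ := hc
  have hi : i < (s.rp P).lim x := by
    by_contra h
    rw [if_neg h] at hv
    exact hr hv
  rw [if_pos hi] at hv
  have e1 := hR.loc_elems x i h1 h2 hi1 hi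
  have e2 := hR.sidx_elems x i h1 h2 hi1 hi
  have e3 := hR.elems_le x i h1 h2 hi1 hi
  have e4 := hR.lim_le x h1 h2
  have e5 := hR.sets_le
  rw [← hv] at e1 e2 e3
  simp only [State.rp] at hi e1 e2 e3 e4 e5 h2
  refine wp_cond (fun ht => ?_) (fun ht => ?_)
  · simp [e1, e2] at ht
    simp [RP.Cursor, State.rp, e2, hext]
    refine ⟨⟨?_, ?_, ?_⟩, ?_, ?_⟩
    · simp only [State.rp] at hi1; omega
    · omega
    · exact (if_neg (by omega)).symm
    · omega
    · omega
  · simp [e1, e2] at ht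
    simp [RP.Cursor, State.rp, e1, e2, hext, ht]
    refine ⟨⟨?_, ?_⟩, ?_⟩
    · simp only [State.rp] at hi1; omega
    · omega
    · omega

/-- The data on which the main part works, apart from the partitions and the simple sets: the
input and the lists `In_trs`. `N` bounds the indices of the cells that are used. It does not
matter for the running time that these lists contain the right transitions, only that their total
length is at most `nT`. -/
structure Ctx where
  nQ : ℕ
  nT : ℕ
  N : ℕ
  tl : ℕ → ℕ
  inF : ℕ → ℕ
  inL : ℕ → ℕ
  inE : ℕ → ℕ
  nQ_lt : nQ + 1 < N
  nT_lt : nT + 1 < N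
  one_le_tl : ∀ t, 1 ≤ t → t ≤ nT → 1 ≤ tl t
  tl_le : ∀ t, 1 ≤ t → t ≤ nT → tl t ≤ nQ
  index_lt : ∀ q k, 1 ≤ q → q ≤ nQ → inF q ≤ k → k < inL q → k < N
  one_le_inE : ∀ q k, 1 ≤ q → q ≤ nQ → inF q ≤ k → k < inL q → 1 ≤ inE k
  inE_le : ∀ q k, 1 ≤ q → q ≤ nQ → inF q ≤ k → k < inL q → inE k ≤ nT
  sum_le : ∑ q ∈ Finset.Icc 1 nQ, (inL q - inF q) ≤ nT

/-- The number of transitions listed in `In_trs[q]`. -/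
def Ctx.deg (c : Ctx) (q : ℕ) : ℕ := c.inL q - c.inF q

/-- The invariant of the main part. -/
structure Core (c : Ctx) (s : State) : Prop where
  tail : s.arr .tail = c.tl
  inFirst : s.arr .inFirst = c.inF
  inLim : s.arr .inLim = c.inL
  inElems : s.arr .inElems = c.inE
  brp : (s.rp .brp).Valid c.nQ
  trp : (s.rp .trp).Valid c.nT
  unready : s.BagAll .unreadySpls fun p => 1 ≤ p ∧ p ≤ s.reg (.sets .trp)
  unready_le : s.reg (.size .unreadySpls) ≤ s.reg (.sets .trp)
  ext : Within c.N s.ext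

theorem Core.charge {c : Ctx} {s : State} {k : ℕ} {w : Arr → ℕ} (h : Core c s)
    (hw : Within c.N w) : Core c (s.charge k w) :=
  ⟨h.tail, h.inFirst, h.inLim, h.inElems, h.brp, h.trp, h.unready, h.unready_le,
    within_sup.2 ⟨h.ext, hw⟩⟩

/-! ### Marking the input transitions of a block -/

/-- The registers that a scan of the input transitions of a block may change. -/
def scanRegs : List Reg :=
  [.q, .k, .t, .p, .size .touchedSpls, .markS, .markL, .markM]

/-- The arrays that a scan of the input transitions of a block may change. -/
def scanArrs : List Arr :=
  [.bag .touchedSpls, .part .trp .elems, .part .trp .loc, .part .trp .mid]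

/-- The invariant of the scan of the input transitions of a block that starts in `s`. The numbers of
the splitters and their sizes do not change during the scan. -/
structure Scan (c : Ctx) (s s' : State) : Prop where
  frame : Frame scanRegs scanArrs s s'
  trp : (s'.rp .trp).Valid c.nT
  touched : s'.BagAll .touchedSpls fun p => 1 ≤ p ∧ p ≤ s.reg (.sets .trp)
  ext : Within c.N s'.ext

/-- The elapsed time and the potential of the splitters that are being marked: a marked transition
keeps `720` units ready, namely `20` for its new set number and `700` for its place in an unready
splitter, and an entry of `Touched_Spls` keeps `200` units ready for an execution of `Split`. -/
def scanCost (s : State) : ℕ :=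
  s.time + 720 * (s.rp .trp).marks + 200 * s.reg (.size .touchedSpls)

/-- Marking the input transitions of the state `v` costs `1100` units for each of them, including
the `720 + 200` units that are set aside for its mark and for the entry of its splitter in
`Touched_Spls`. -/
theorem wp_scan_state {c : Ctx} {s t : State} {v : ℕ} (hs : Core c s) (ht : Scan c s t)
    (hq : t.reg .q = v) (h1 : 1 ≤ v) (hv : v ≤ c.nQ)
    (hsz : t.reg (.size .touchedSpls) + c.deg v ≤ c.nT) :
    wp (.forUp .k (.get .inFirst Reg.q) (.get .inLim Reg.q) (
        .t ::= .get .inElems Reg.k ;;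
        .p ::= RPart.trp.sidx Reg.t ;;
        .cond (RPart.trp.noMarks Reg.p) (Bag.touchedSpls.add Reg.p) .skip ;;
        RPart.trp.mark Reg.t)) t fun t' =>
      Scan c s t' ∧ t'.reg .q = v ∧
      t'.reg (.size .touchedSpls) ≤ t.reg (.size .touchedSpls) + c.deg v ∧
      scanCost t' ≤ scanCost t + 1100 * c.deg v + 20 := by
  have f1 := (ht.frame.arr .inFirst (by decide)).trans hs.inFirst
  have f2 := (ht.frame.arr .inLim (by decide)).trans hs.inLim
  have hvN : v < c.N := by have := c.nQ_lt; omega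
  have hdeg : c.deg v = c.inL v - c.inF v := rfl
  rw [Cmd.forUp, wp_seq, wp_assign]
  refine wp_while (fun t' => Scan c s t' ∧ t'.reg .q = v ∧ c.inF v ≤ t'.reg .k ∧
      t'.reg (.size .touchedSpls) + (c.inL v - t'.reg .k) ≤
        t.reg (.size .touchedSpls) + c.deg v ∧
      scanCost t' + 1100 * (c.inL v - t'.reg .k) ≤ scanCost t + 1100 * c.deg v + 10)
    (scanCost t + 1100 * c.deg v + 10) ?_ ?_ ?_ ?_
  · refine ⟨⟨?_, ht.trp, ht.touched, ?_⟩, ?_, ?_, ?_, ?_⟩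
    · rw [Frame.setReg (by decide), Frame.charge]
      exact ht.frame
    · simp [ht.ext, hq, hvN]
    · simp [hq]
    · simp [f1, hq]
    · simp [f1, hq, hdeg]
    · simp [f1, hq, hdeg, scanCost, State.rp_setReg, State.rp_charge]
      omega
  · rintro t' ⟨-, -, -, -, h⟩
    simp only [scanCost] at h ⊢
    omega
  · rintro t' ⟨ht', hq', hk, hsz', hcost⟩ hx
    have f1 := (ht'.frame.arr .inLim (by decide)).trans hs.inLim
    have f2 := (ht'.frame.arr .inElems (by decide)).trans hs.inElems
    simp [f1, hq'] at hx
    have hkN := c.index_lt v _ h1 hv hk hx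
    have ht1 := c.one_le_inE v _ h1 hv hk hx
    have ht2 := c.inE_le v _ h1 hv hk hx
    rw [wp_seq, wp_seq, wp_assign]
    refine (wp_touch (B := .touchedSpls) (x := .t) (y := .p) (n := c.nT) (N := c.N)
      (v := c.inE (t'.reg .k)) ?_ (by decide) (by decide) (by decide) (by decide) (by decide) ?_
      ht1 ht2 c.nT_lt ?_ ?_).mono ?_
    · simp [f2]
    · exact ht'.trp
    · have := c.nT_lt
      simp
      omega
    · simp [ht'.ext, hq', hkN, hvN]
    · rintro t'' ⟨hf, hval, hmarks, hsize, hall, hext, htime⟩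
      have hsets := ht'.frame.reg (.sets .trp) (by decide)
      have hq'' := hf.reg .q (by decide)
      have hk'' := hf.reg .k (by decide)
      have hm1 := ht'.trp.one_le_sidx _ ht1 ht2
      have hm2 := ht'.trp.sidx_le _ ht1 ht2
      rw [wp_assign]
      refine ⟨⟨?_, hval, ?_, by simp [hext]⟩, ?_, ?_, ?_, ?_⟩
      · rw [Frame.setReg (by decide), Frame.charge]
        have := hf.mono (L' := scanRegs) (M' := scanArrs) (by decide) (by decide)
        rw [Frame.setReg_left (by decide), Frame.charge_left, Frame.charge_left] at this
        exact ht'.frame.trans this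
      · exact hall (fun p => 1 ≤ p ∧ p ≤ s.reg (.sets .trp)) ⟨hm1, hm2.trans hsets.le⟩
          (Frame.bagAll (L := [.t]) (M := []) (s := t') (by simp) (by decide) (by decide)
            ht'.touched)
      · simpa [hq''] using hq'
      · simp [hk'']
        omega
      · simp [hk''] at hsize ⊢
        omega
      · simp [hk'', scanCost, State.rp_setReg, State.rp_charge] at hmarks hsize htime hcost ⊢
        omega
  · rintro t' ⟨ht', hq', hk, hsz', hcost⟩ hx
    have f1 := (ht'.frame.arr .inLim (by decide)).trans hs.inLim
    simp [f1, hq'] at hx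
    refine ⟨⟨?_, ht'.trp, ht'.touched, ?_⟩, hq', ?_, ?_⟩
    · rw [Frame.charge]
      exact ht'.frame
    · simp [ht'.ext, hq', hvN]
    · simp
      omega
    · simp [scanCost, State.rp_charge] at hcost ⊢
      omega

theorem wp_seq_assoc {c d e : Cmd} {s : State} {Q : State → Prop} :
    wp ((c ;; d) ;; e) s Q ↔ wp (c ;; d ;; e) s Q := by
  simp only [wp_seq]

/-- The part of `splitBlock` that marks the input transitions of block `b2`. -/
def scanBlock : Cmd :=
  .q ::= RPart.brp.elems (RPart.brp.first Reg.b2) ;;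
  .while (.not (.eq Reg.q 0)) (
    .forUp .k (.get .inFirst Reg.q) (.get .inLim Reg.q) (
      .t ::= .get .inElems Reg.k ;;
      .p ::= RPart.trp.sidx Reg.t ;;
      .cond (RPart.trp.noMarks Reg.p) (Bag.touchedSpls.add Reg.p) .skip ;;
      RPart.trp.mark Reg.t) ;;
    RPart.brp.next .q Reg.q)

/-- Marking the input transitions of a block costs `60` units for each of its states and `1100`
units for each of the transitions. -/
theorem wp_scanBlock {c : Ctx} {s : State} {x : ℕ} (hs : Core c s) (hx : s.reg .b2 = x)
    (h1 : 1 ≤ x) (h2 : x ≤ (s.rp .brp).sets) (hT : s.reg (.size .touchedSpls) = 0) :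
    wp scanBlock s fun t => Scan c s t ∧ t.reg (.size .touchedSpls) ≤ c.nT ∧
      scanCost t ≤ scanCost s + 60 * (s.rp .brp).size x + 30 + 1100 *
        ∑ i ∈ Finset.Ico ((s.rp .brp).first x) ((s.rp .brp).lim x),
          c.deg ((s.rp .brp).elems i) := by
  have hxQ := hs.brp.sets_le
  have hNQ := c.nQ_lt
  have hfl := hs.brp.first_lt x h1 h2
  have hln := hs.brp.lim_le x h1 h2
  have htot : ∑ i ∈ Finset.Ico ((s.rp .brp).first x) ((s.rp .brp).lim x),
      c.deg ((s.rp .brp).elems i) ≤ c.nT :=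
    (hs.brp.sum_elems_le c.deg h1 h2).trans
      ((Finset.sum_le_sum fun q _ => by
        split_ifs
        exacts [le_rfl, Nat.zero_le _]).trans c.sum_le)
  rw [scanBlock, wp_seq, wp_assign]
  refine wp_while (fun t => Scan c s t ∧ ∃ i, (s.rp .brp).Cursor x i (t.reg .q) ∧
      t.reg (.size .touchedSpls) +
        ∑ j ∈ Finset.Ico i ((s.rp .brp).lim x), c.deg ((s.rp .brp).elems j) ≤ c.nT ∧
      scanCost t + 60 * ((s.rp .brp).lim x - i) + 1100 *
          ∑ j ∈ Finset.Ico i ((s.rp .brp).lim x), c.deg ((s.rp .brp).elems j) ≤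
        scanCost s + 60 * (s.rp .brp).size x + 20 + 1100 *
          ∑ j ∈ Finset.Ico ((s.rp .brp).first x) ((s.rp .brp).lim x), c.deg ((s.rp .brp).elems j))
    (scanCost s + 60 * (s.rp .brp).size x + 20 + 1100 *
      ∑ j ∈ Finset.Ico ((s.rp .brp).first x) ((s.rp .brp).lim x), c.deg ((s.rp .brp).elems j))
    ?_ ?_ ?_ ?_
  · refine ⟨⟨?_, hs.trp, ?_, ?_⟩, (s.rp .brp).first x, ⟨le_rfl, hfl.le, ?_⟩, ?_, ?_⟩
    · rw [Frame.setReg (by decide), Frame.charge]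
      exact Frame.refl
    · intro j hj
      simp [hT] at hj
    · simp only [State.rp] at h2 hxQ hfl hln
      simp [hs.ext, hx]
      omega
    · rw [if_pos hfl]
      simp [hx, State.rp]
    · simp [hT, htot]
    · simp [scanCost, State.rp_setReg, State.rp_charge, RP.size]
      omega
  · rintro t ⟨-, i, -, -, h⟩
    simp only [scanCost] at h ⊢
    omega
  · rintro t ⟨ht, i, hc, hsz, hcost⟩ hq
    obtain ⟨hi1, hi2, hqi⟩ := id hc
    have hq0 : t.reg .q ≠ 0 := by simpa using hq
    have hi : i < (s.rp .brp).lim x := by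
      by_contra h
      rw [if_neg h] at hqi
      exact hq0 hqi
    rw [if_pos hi] at hqi
    have hv1 := hs.brp.one_le_elems x i h1 h2 hi1 hi
    have hv2 := hs.brp.elems_le x i h1 h2 hi1 hi
    rw [Finset.sum_eq_sum_Ico_succ_bot hi] at hsz hcost
    rw [wp_seq]
    refine (wp_scan_state (c := c) (s := s) (v := (s.rp .brp).elems i) hs ?_ ?_ hv1 hv2 ?_).mono ?_
    · exact ⟨by rw [Frame.charge]; exact ht.frame, ht.trp, ht.touched, by simp [ht.ext]⟩
    · simpa using hqi
    · simp
      omega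
    · rintro t' ⟨ht', hq', hsz', hcost'⟩
      have hrp : t'.rp .brp = s.rp .brp := ht'.frame.rp (by decide) (by decide)
      refine (wp_next (n := c.nQ) (N := c.N) (x := x) (i := i) ?_ h1 ?_ ?_ ?_ c.nQ_lt ht'.ext).mono
        ?_
      · rw [hrp]; exact hs.brp
      · rw [hrp]; exact h2
      · rw [hrp, hq', ← hqi]; exact hc
      · rw [hq']; omega
      · rintro t'' ⟨hf, hc', hext, htime⟩
        rw [hrp] at hc'
        have e1 := hf.reg (.size .touchedSpls) (by decide)
        have e2 : t''.rp .trp = t'.rp .trp := hf.rp (by decide) (by decide)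
        refine ⟨⟨ht'.frame.trans (hf.mono (by decide) (by decide)), ?_, ?_, hext⟩,
          i + 1, hc', ?_, ?_⟩
        · rw [e2]; exact ht'.trp
        · exact hf.bagAll (by decide) (by decide) ht'.touched
        · simp at hsz'
          omega
        · simp [scanCost, State.rp_charge, e1, e2] at hcost hcost' ⊢
          omega
  · rintro t ⟨ht, i, hc, hsz, hcost⟩ hq
    refine ⟨⟨by rw [Frame.charge]; exact ht.frame, ht.trp, ht.touched, by simp [ht.ext]⟩, ?_, ?_⟩
    · simp
      omega
    · simp [scanCost, State.rp_charge] at hcost ⊢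
      omega

/-! ### Splitting the touched splitters -/

/-- The part of `splitBlock` that splits the touched splitters. -/
def splitTouched : Cmd :=
  .while (.not Bag.touchedSpls.isEmpty) (
    Bag.touchedSpls.remove .p ;;
    RPart.trp.split .p2 Reg.p ;;
    .cond (.not (.eq Reg.p2 0)) (Bag.unreadySpls.add Reg.p2) .skip)

/-- The registers that splitting the touched splitters may change. -/
def splitTouchedRegs : List Reg :=
  [.size .touchedSpls, .size .unreadySpls, .pick, .p, .p2, .sets .trp, .splitL]

/-- The arrays that splitting the touched splitters may change. -/
def splitTouchedArrs : List Arr :=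
  [.bag .touchedSpls, .bag .unreadySpls, .part .trp .sidx, .part .trp .first, .part .trp .lim,
    .part .trp .mid]

/-- The total size of the sets in `Unready_Spls`. -/
def unreadySize (s : State) : ℕ := s.bagSum .unreadySpls (s.rp .trp).size

/-- The elapsed time, and the time that is needed to split the touched splitters and to treat the
splitters in `Unready_Spls`. A transition in an unready splitter keeps `700` units ready. -/
def splCost (s : State) : ℕ := scanCost s + 700 * unreadySize s

theorem State.BagAll.sum_le {s : State} {B : Bag} {p : ℕ → Prop} {f g : ℕ → ℕ}
    (h : s.BagAll B p) (hfg : ∀ x, p x → f x ≤ g x) : s.bagSum B f ≤ s.bagSum B g :=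
  Finset.sum_le_sum fun j hj => hfg _ (h j (Finset.mem_range.1 hj))

theorem State.BagAll.imp {s : State} {B : Bag} {p q : ℕ → Prop} (h : s.BagAll B p)
    (hpq : ∀ x, p x → q x) : s.BagAll B q :=
  fun j hj => hpq _ (h j hj)

/-- Splitting the touched splitters is paid for by the marks and the entries of `Touched_Spls`. The
splitter that is split may be in `Unready_Spls` or not: in either case the total size of the
unready splitters increases at most by the size of the new splitter, which is the number of its
marks. -/
theorem wp_splitTouched {c : Ctx} {s : State} (hs : Core c s)
    (hT : s.BagAll .touchedSpls fun p => 1 ≤ p ∧ p ≤ s.reg (.sets .trp))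
    (hsz : s.reg (.size .touchedSpls) ≤ c.nT) :
    wp splitTouched s fun t => Core c t ∧ Frame splitTouchedRegs splitTouchedArrs s t ∧
      t.reg (.size .touchedSpls) = 0 ∧ splCost t ≤ splCost s + 10 := by
  have hN := c.nT_lt
  refine wp_while (fun t => Core c t ∧ Frame splitTouchedRegs splitTouchedArrs s t ∧
      (t.BagAll .touchedSpls fun p => 1 ≤ p ∧ p ≤ t.reg (.sets .trp)) ∧
      t.reg (.size .touchedSpls) ≤ c.nT ∧ splCost t ≤ splCost s)
    (splCost s) ⟨hs, Frame.refl, hT, hsz, le_rfl⟩ ?_ ?_ ?_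
  · rintro t ⟨-, -, -, -, h⟩
    simp only [splCost, scanCost] at h ⊢
    omega
  · rintro t ⟨ht, hf, hT, hsz, hcost⟩ hq
    have hpos : 0 < t.reg (.size .touchedSpls) := by
      simp [Bag.isEmpty] at hq
      omega
    rw [wp_seq]
    refine (wp_remove (N := c.N) ?_ ?_ (by decide) (by decide) ?_).mono ?_
    · simpa using hpos
    · rw [State.charge_reg]
      omega
    · simp [Bag.isEmpty, ht.ext]
    rintro t₁ ⟨hf₁, hsz₁, -, hall₁, hext₁, htime₁⟩
    rw [Frame.charge_left] at hf₁
    obtain ⟨⟨hp1, hp2⟩, hT₁⟩ := hall₁ _ (State.bagAll_charge.2 hT)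
    have hsets₁ := hf₁.reg (.sets .trp) (by decide)
    have hrp₁ : t₁.rp .trp = t.rp .trp := hf₁.rp (by decide) (by decide)
    rw [wp_seq]
    refine (wp_split (n := c.nT) (N := c.N) (v := t₁.reg .p) (by rw [hrp₁]; exact ht.trp) hp1
      (by omega) c.nT_lt hext₁ (by decide) ?_ (by simp) (by simp)).mono ?_
    · intro s' hs'
      exact hs'.reg _ (by decide)
    rintro t₂ ⟨hf₂, hval₂, hext₂, hcases⟩
    have hrpb : t₂.rp .brp = t.rp .brp :=
      (hf₂.rp (by decide) (by decide)).trans (hf₁.rp (by decide) (by decide))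
    have hf₂' : Frame splitTouchedRegs splitTouchedArrs t t₂ :=
      (hf₁.mono (by decide) (by decide)).trans (hf₂.mono (by decide) (by decide))
    have hunr₂ := hf₂.bagAll (by decide) (by decide)
      (hf₁.bagAll (by decide) (by decide) ht.unready)
    have hunsz : t₂.reg (.size .unreadySpls) = t.reg (.size .unreadySpls) :=
      (hf₂.reg _ (by decide)).trans (hf₁.reg _ (by decide))
    have hsz₂ := hf₂.reg (.size .touchedSpls) (by decide)
    have hT₂ := hf₂.bagAll (by decide) (by decide) hT₁
    have hsum : ∀ f, t₂.bagSum .unreadySpls f = t.bagSum .unreadySpls f := fun f =>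
      (hf₂.bagSum (by decide) (by decide) f).trans (hf₁.bagSum (by decide) (by decide) f)
    have hunle := ht.unready_le
    have hsetsle := ht.trp.sets_le
    simp only [State.charge_reg, State.charge_time] at hp2 hsz₁ htime₁ hT₂
    simp [Bag.isEmpty] at htime₁
    rcases hcases with h | h
    · have hsets₂ : t₂.reg (.sets .trp) = t.reg (.sets .trp) := h.sets.trans hsets₁
      have hsize : (t₂.rp .trp).size = (t.rp .trp).size := by
        funext x
        rw [RP.size, RP.size, h.lim, h.first, hrp₁]
      refine wp_cond (fun hc => ?_) (fun hc => ?_)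
      · simp [h.result] at hc
      · rw [wp_skip]
        refine ⟨(Core.charge ⟨?_, ?_, ?_, ?_, ?_, hval₂, ?_, ?_, hext₂⟩ (by simp)).charge (by simp),
          ?_, ?_, ?_, ?_⟩
        · exact (hf₂'.arr _ (by decide)).trans ht.tail
        · exact (hf₂'.arr _ (by decide)).trans ht.inFirst
        · exact (hf₂'.arr _ (by decide)).trans ht.inLim
        · exact (hf₂'.arr _ (by decide)).trans ht.inElems
        · rw [hrpb]; exact ht.brp
        · rw [hsets₂]; exact hunr₂
        · omega
        · rw [Frame.charge, Frame.charge]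
          exact hf.trans hf₂'
        · simp only [State.bagAll_charge, State.charge_reg, hsets₂]
          exact hT₂
        · simp
          omega
        · have h1 := h.time
          have h2 := h.marks
          rw [hrp₁] at h2
          have h3 : unreadySize ((t₂.charge ((Test.not (.eq Reg.p2 0)).cost t₂ + 1)
              ((Test.not (.eq Reg.p2 0)).touch t₂)).charge 1 0) = unreadySize t := by
            simp only [unreadySize, State.rp_charge, hsize]
            exact hsum _
          simp only [splCost, h3]
          simp [splCost, scanCost, State.rp_charge] at hcost ⊢
          omega
    · have hcut := h.rp
      rw [hrp₁] at hcut
      have h1 := h.first_lt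
      have h2 := h.lt_lim
      have h3 := h.time
      rw [hrp₁] at h1 h2 h3
      have hres := h.result
      rw [hrp₁] at hres
      have hp3 : t₁.reg .p ≤ (t.rp .trp).sets := hp2
      have hsets₂ : t₂.reg (.sets .trp) = t.reg (.sets .trp) + 1 := by
        change (t₂.rp .trp).sets = _
        rw [hcut]; rfl
      have hres' : t₂.reg .p2 = t.reg (.sets .trp) + 1 := hres
      have hnew := RP.size_cut_new (R := t.rp .trp) hp3
      have hle : t₂.bagSum .unreadySpls (t₂.rp .trp).size ≤ unreadySize t := by
        rw [hsum, hcut]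
        exact ht.unready.sum_le fun x hx => ht.trp.size_cut_le hp1 hp3 hx.2
      have hmarks := RP.marks_cut (R := t.rp .trp) hp1 hp3
      rw [← hcut] at hmarks
      have hsets₂' := hval₂.sets_le
      have hsets₂'' : (t₂.rp .trp).sets = t₂.reg (.sets .trp) := rfl
      refine wp_cond (fun hc => ?_) (fun hc => ?_)
      · refine (wp_add (N := c.N) (by simp; omega) (by simp) (by simp [hext₂])).mono ?_
        rintro t₃ ⟨hf₃, hsz₃, hsum₃, hall₃, hext₃, htime₃⟩
        rw [Frame.charge_left] at hf₃
        have hf₃' : Frame splitTouchedRegs splitTouchedArrs t t₃ :=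
          hf₂'.trans (hf₃.mono (by decide) (by decide))
        have hrp₃ : t₃.rp .trp = t₂.rp .trp := hf₃.rp (by decide) (by decide)
        have hsets₃ := hf₃.reg (.sets .trp) (by decide)
        have hszT := hf₃.reg (.size .touchedSpls) (by decide)
        simp at hsz₃ htime₃
        refine ⟨⟨?_, ?_, ?_, ?_, ?_, ?_, ?_, ?_, hext₃⟩, hf.trans hf₃', ?_, ?_, ?_⟩
        · exact (hf₃'.arr _ (by decide)).trans ht.tail
        · exact (hf₃'.arr _ (by decide)).trans ht.inFirst
        · exact (hf₃'.arr _ (by decide)).trans ht.inLim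
        · exact (hf₃'.arr _ (by decide)).trans ht.inElems
        · rw [hf₃.rp (by decide) (by decide), hrpb]; exact ht.brp
        · rw [hrp₃]; exact hval₂
        · refine hall₃ _ ?_ (State.bagAll_charge.2 (hunr₂.imp fun x hx => ⟨hx.1, ?_⟩))
          · rw [Expr.eval_reg, State.charge_reg, hres', hsets₃, hsets₂]
            omega
          · have := hx.2
            omega
        · omega
        · exact hf₃.bagAll (by decide) (by decide) (hT₂.imp fun x hx => ⟨hx.1, by omega⟩)
        · omega
        · have h4 : unreadySize t₃ ≤ unreadySize t +
              ((t.rp .trp).mid (t₁.reg .p) - (t.rp .trp).first (t₁.reg .p)) := by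
            rw [unreadySize, hrp₃, hsum₃, Expr.eval_reg, State.charge_reg, hres, hcut, hnew]
            refine Nat.add_le_add_right ?_ _
            rw [← hcut]
            exact hle
          simp only [splCost, scanCost, hrp₃] at hcost ⊢
          omega
      · simp [hres'] at hc
  · rintro t ⟨ht, hf, hT, hsz, hcost⟩ hq
    refine ⟨ht.charge (by simp [Bag.isEmpty]), by rwa [Frame.charge], ?_, ?_⟩
    · simpa [Bag.isEmpty] using hq
    · have h3 : unreadySize (t.charge ((Test.not Bag.touchedSpls.isEmpty).cost t + 1)
          ((Test.not Bag.touchedSpls.isEmpty).touch t)) = unreadySize t := rfl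
      simp only [splCost, h3]
      simp [splCost, scanCost, State.rp_charge, Bag.isEmpty] at hcost ⊢
      omega

/-! ### Splitting a block -/

/-- The registers that `Split_block` may change. -/
def splitBlockRegs : List Reg :=
  [.sets .brp, .sets .trp, .size .unreadySpls, .size .touchedSpls, .b2, .k, .p, .p2, .q, .t,
    .markS, .markL, .markM, .splitL, .pick]

/-- The arrays that `Split_block` may change. -/
def splitBlockArrs : List Arr :=
  [.part .brp .sidx, .part .brp .first, .part .brp .lim, .part .brp .mid, .part .trp .elems,
    .part .trp .loc, .part .trp .sidx, .part .trp .first, .part .trp .lim, .part .trp .mid,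
    .bag .unreadySpls, .bag .touchedSpls]

/-- The elapsed time and the potential. Besides what `splCost` accounts for, a marked state keeps
`100` units ready for its new block number and the scan of its block, and each transition keeps
`1100` units for every time that its head can still end up in the smaller half of a block. -/
def blockCost (c : Ctx) (s : State) : ℕ :=
  splCost s + 100 * (s.rp .brp).marks + 1100 * (s.rp .brp).logSum c.nQ c.deg

theorem splCost_charge {s : State} {k : ℕ} {w : Arr → ℕ} :
    splCost (s.charge k w) = splCost s + k := by
  have : unreadySize (s.charge k w) = unreadySize s := rfl
  simp [splCost, scanCost, this, State.rp_charge]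
  omega

theorem blockCost_charge {c : Ctx} {s : State} {k : ℕ} {w : Arr → ℕ} :
    blockCost c (s.charge k w) = blockCost c s + k := by
  simp only [blockCost, splCost_charge, State.rp_charge]
  omega

/-- The accounts of the splitters depend only on data that `Frame` can protect. -/
theorem Frame.splCost {L : List Reg} {M : List Arr} {s s' : State} (h : Frame L M s s')
    (h1 : Reg.sets .trp ∉ L) (h2 : ∀ f, Arr.part .trp f ∉ M) (h3 : Reg.size .touchedSpls ∉ L)
    (h4 : Reg.size .unreadySpls ∉ L) (h5 : Arr.bag .unreadySpls ∉ M) :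
    Ram.splCost s' + s.time = Ram.splCost s + s'.time := by
  have e1 : unreadySize s' = unreadySize s := by
    rw [unreadySize, unreadySize, h.bagSum h4 h5, h.rp h1 h2]
  simp only [Ram.splCost, scanCost, e1, h.rp h1 h2, h.reg _ h3]
  omega

/-- `Core` is kept if the splitters, `Unready_Spls` and the input stay the same. -/
theorem Core.of_frame {c : Ctx} {L : List Reg} {M : List Arr} {s s' : State} (hs : Core c s)
    (h : Frame L M s s') (hb : (s'.rp .brp).Valid c.nQ) (hx : Within c.N s'.ext)
    (h1 : Reg.sets .trp ∉ L) (h2 : ∀ f, Arr.part .trp f ∉ M) (h3 : Reg.size .unreadySpls ∉ L)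
    (h4 : ∀ A ∈ [Arr.bag .unreadySpls, .tail, .inFirst, .inLim, .inElems], A ∉ M) :
    Core c s' where
  tail := (h.arr _ (h4 _ (by decide))).trans hs.tail
  inFirst := (h.arr _ (h4 _ (by decide))).trans hs.inFirst
  inLim := (h.arr _ (h4 _ (by decide))).trans hs.inLim
  inElems := (h.arr _ (h4 _ (by decide))).trans hs.inElems
  brp := hb
  trp := by rw [h.rp h1 h2]; exact hs.trp
  unready := by
    rw [h.reg _ h1]
    exact h.bagAll h3 (h4 _ (by decide)) hs.unready
  unready_le := by rw [h.reg _ h1, h.reg _ h3]; exact hs.unready_le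
  ext := hx

/-- The work of `Split_block` that follows the split of the block into two. -/
theorem wp_scanBlock_splitTouched {c : Ctx} {s : State} {x : ℕ} (hs : Core c s)
    (hx : s.reg .b2 = x) (h1 : 1 ≤ x) (h2 : x ≤ (s.rp .brp).sets)
    (hT : s.reg (.size .touchedSpls) = 0) :
    wp (scanBlock ;; splitTouched) s fun t => Core c t ∧
      Frame (scanRegs ++ splitTouchedRegs) (scanArrs ++ splitTouchedArrs) s t ∧
      t.reg (.size .touchedSpls) = 0 ∧
      splCost t ≤ splCost s + 60 * (s.rp .brp).size x + 40 + 1100 *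
        ∑ i ∈ Finset.Ico ((s.rp .brp).first x) ((s.rp .brp).lim x),
          c.deg ((s.rp .brp).elems i) := by
  rw [wp_seq]
  refine (wp_scanBlock hs hx h1 h2 hT).mono ?_
  rintro t ⟨ht, hsz, hcost⟩
  have hsets := ht.frame.reg (.sets .trp) (by decide)
  have hun := ht.frame.reg (.size .unreadySpls) (by decide)
  have hcore : Core c t := by
    refine ⟨?_, ?_, ?_, ?_, ?_, ht.trp, ?_, ?_, ht.ext⟩
    · exact (ht.frame.arr _ (by decide)).trans hs.tail
    · exact (ht.frame.arr _ (by decide)).trans hs.inFirst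
    · exact (ht.frame.arr _ (by decide)).trans hs.inLim
    · exact (ht.frame.arr _ (by decide)).trans hs.inElems
    · rw [ht.frame.rp (by decide) (by decide)]; exact hs.brp
    · rw [hsets]
      exact ht.frame.bagAll (by decide) (by decide) hs.unready
    · rw [hsets, hun]; exact hs.unready_le
  refine (wp_splitTouched hcore ?_ hsz).mono ?_
  · rw [hsets]; exact ht.touched
  rintro t' ⟨hcore', hf', hT', hcost'⟩
  refine ⟨hcore', (ht.frame.mono (by simp) (by simp)).trans (hf'.mono (by simp) (by simp)), hT', ?_⟩
  have e1 : unreadySize t = unreadySize s := by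
    have a1 := ht.frame.arr (.part .trp .lim) (by decide)
    have a2 := ht.frame.arr (.part .trp .first) (by decide)
    have a3 : (t.rp .trp).size = (s.rp .trp).size := by
      funext y
      simp only [RP.size, State.rp, a1, a2]
    rw [unreadySize, unreadySize, a3, ht.frame.bagSum (by decide) (by decide)]
  simp only [splCost, e1] at hcost' ⊢
  omega

/-- `Split_block` is paid for by the potential up to a constant: the marks pay for the split and for
stepping through the smaller half, and the logarithmic sum pays for the input transitions. -/
theorem wp_splitBlock {c : Ctx} {s : State} {v : ℕ} (hs : Core c s) (hb : s.reg .b = v)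
    (h1 : 1 ≤ v) (h2 : v ≤ (s.rp .brp).sets) (hT : s.reg (.size .touchedSpls) = 0) :
    wp splitBlock s fun t => Core c t ∧ Frame splitBlockRegs splitBlockArrs s t ∧
      t.reg (.size .touchedSpls) = 0 ∧ (s.rp .brp).sets ≤ (t.rp .brp).sets ∧
      blockCost c t ≤ blockCost c s + 300 := by
  have hNQ := c.nQ_lt
  rw [splitBlock, wp_seq]
  refine (wp_split (n := c.nQ) (N := c.N) (v := v) hs.brp h1 h2 c.nQ_lt hs.ext (by decide) ?_
    (by simp) (by simp)).mono ?_
  · intro s' hs'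
    rw [Expr.eval_reg, hs'.reg _ (by decide), hb]
  rintro t ⟨hf, hval, hext, hcases⟩
  have ht : Core c t := hs.of_frame hf hval hext (by decide) (by decide) (by decide) (by decide)
  have hTt : t.reg (.size .touchedSpls) = 0 := (hf.reg _ (by decide)).trans hT
  have hbt : t.reg .b = v := (hf.reg _ (by decide)).trans hb
  have hspl := hf.splCost (by decide) (by decide) (by decide) (by decide) (by decide)
  rcases hcases with h | h
  · refine wp_cond (fun hc => ?_) (fun hc => ?_)
    · simp [h.result] at hc
    · rw [wp_skip]
      refine ⟨(ht.charge (by simp)).charge (by simp), ?_, hTt, ?_, ?_⟩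
      · rw [Frame.charge, Frame.charge]
        exact hf.mono (by decide) (by decide)
      · rw [State.rp_charge, State.rp_charge, h.sets]
      · have e1 := h.time
        have e2 := h.marks
        have e3 : (t.rp .brp).logSum c.nQ c.deg = (s.rp .brp).logSum c.nQ c.deg := by
          unfold RP.logSum RP.size
          rw [h.sidx, h.first, h.lim]
        simp only [blockCost_charge]
        simp [blockCost, e3]
        omega
  · have hcut := h.rp
    have e1 := h.first_lt
    have e2 := h.lt_lim
    have hres := h.result
    have htime := h.time
    have hmarks := RP.marks_cut (R := s.rp .brp) h1 h2
    have hsn := RP.size_cut_new (R := s.rp .brp) h2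
    have hsv := RP.size_cut_self (R := s.rp .brp) h2
    have hlog := fun x => hs.brp.logSum_cut h1 h2 e1 e2 c.deg (x := x)
    rw [← hcut] at hmarks hsn hsv hlog
    have hsets : (t.rp .brp).sets = (s.rp .brp).sets + 1 := by rw [hcut]; rfl
    have hsetsle := hval.sets_le
    have helems : (t.rp .brp).elems = (s.rp .brp).elems := by rw [hcut]; rfl
    refine wp_cond (fun hc => ?_) (fun hc => ?_)
    swap
    · simp [hres] at hc
    rw [wp_seq]
    -- register `b2` now gets the number of the smaller half
    have key : wp (.cond (.lt (RPart.brp.size Reg.b) (RPart.brp.size Reg.b2)) (.b2 ::= Reg.b) .skip)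
        (t.charge ((Test.not (.eq Reg.b2 0)).cost t + 1) ((Test.not (.eq Reg.b2 0)).touch t))
        fun t' => ∃ x, (x = v ∨ x = (s.rp .brp).sets + 1) ∧
          (t.rp .brp).size x ≤ (t.rp .brp).size v ∧
          (t.rp .brp).size x ≤ (t.rp .brp).size ((s.rp .brp).sets + 1) ∧
          t'.reg .b2 = x ∧ Frame [.b2] [] t t' ∧ Within c.N t'.ext ∧ t'.time ≤ t.time + 40 := by
      have hsz : ∀ y, (t.rp .brp).size y =
          t.arr (.part .brp .lim) y - t.arr (.part .brp .first) y := fun _ => rfl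
      have hsets' : (s.rp .brp).sets + 1 ≤ c.nQ := by omega
      refine wp_cond (fun hlt => ?_) (fun hge => ?_)
      · simp [RPart.size, hbt, hres] at hlt
        rw [wp_assign]
        refine ⟨v, .inl rfl, le_rfl, ?_, by simp [hbt], by simp, ?_, ?_⟩
        · rw [hsz, hsz]; exact hlt.le
        · simp [RPart.size, hbt, hres, hext]
          omega
        · simp [RPart.size]
      · simp [RPart.size, hbt, hres] at hge
        rw [wp_skip]
        refine ⟨_, .inr rfl, ?_, le_rfl, by simp [hres], by simp, ?_, ?_⟩
        · rw [hsz, hsz]; simpa using hge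
        · simp [RPart.size, hbt, hres, hext]
          omega
        · simp [RPart.size]
    refine key.mono ?_
    rintro t' ⟨x, hx, hx1, hx2, hb2, hf', hext', htime'⟩
    have hrp : t'.rp .brp = t.rp .brp := hf'.rp (by decide) (by decide)
    have ht' : Core c t' :=
      ht.of_frame hf' (by rw [hrp]; exact hval) hext' (by decide) (by decide) (by decide)
        (by decide)
    have hspl' := hf'.splCost (by decide) (by decide) (by decide) (by decide) (by decide)
    rw [← wp_seq_assoc]
    refine (wp_scanBlock_splitTouched ht' hb2 (by omega) (by rw [hrp]; omega)
      ((hf'.reg _ (by decide)).trans hTt)).mono ?_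
    rintro t'' ⟨ht'', hf'', hT'', hcost⟩
    have hrp'' : t''.rp .brp = t'.rp .brp := hf''.rp (by decide) (by decide)
    have hlog' := hlog x hx hx1 hx2
    refine ⟨ht'', ?_, hT'', ?_, ?_⟩
    · exact ((hf.mono (by decide) (by decide)).trans (hf'.mono (by decide) (by decide))).trans
        (hf''.mono (by decide) (by decide))
    · rw [hrp'', hrp]; omega
    · rw [hrp, helems] at hcost
      simp only [blockCost, hrp'', hrp]
      omega

/-! ### Initialization -/

theorem State.setReg_self {s : State} {r : Reg} : s.setReg r (s.reg r) = s := by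
  simp [State.setReg]

/-- A `for` loop whose body takes at most `k` units of time in each round. -/
theorem wp_forUp {r : Reg} {lo hi : Expr} {body : Cmd} {s : State} {Q : State → Prop} {a b k : ℕ}
    (I : ℕ → State → Prop) (hlo : lo.eval s = a) (hab : a ≤ b) (hlo0 : lo.touch s = 0)
    (hi0 : ∀ t, hi.touch t = 0) (hhi : ∀ i t, I i t → hi.eval t = b)
    (hI : ∀ i t k v, I i t → I i ((t.charge k 0).setReg r v)) (h0 : I a s)
    (hbody : ∀ i t, a ≤ i → i < b → t.reg r = i → I i t →
      wp body t fun t' => t'.reg r = i ∧ I (i + 1) t' ∧ t'.time ≤ t.time + k)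
    (hQ : ∀ t, I b t → t.time ≤ s.time + (lo.cost + hi.cost + 4) + (k + hi.cost + 7) * (b - a) →
      Q t) :
    wp (.forUp r lo hi body) s Q := by
  have hI' : ∀ i t k, I i t → I i (t.charge k 0) := fun i t k ht => by
    have := hI i t k (t.reg r) ht
    rwa [← State.charge_reg t k 0, State.setReg_self] at this
  rw [Cmd.forUp, wp_seq, wp_assign]
  refine wp_while (fun t => a ≤ t.reg r ∧ t.reg r ≤ b ∧ I (t.reg r) t ∧
      t.time + (k + hi.cost + 7) * (b - t.reg r) ≤
        s.time + (lo.cost + 1) + (k + hi.cost + 7) * (b - a))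
    (s.time + (lo.cost + 1) + (k + hi.cost + 7) * (b - a)) ?_ ?_ ?_ ?_
  · rw [hlo, hlo0]
    refine ⟨by simp, by simpa using hab, ?_, by simp⟩
    have := hI a s (lo.cost + 1) a h0
    simpa using this
  · rintro t ⟨-, -, -, h⟩
    omega
  · rintro t ⟨h1, h2, ht, htime⟩ hx
    simp only [Test.eval_lt_true, Expr.eval_reg, hhi _ _ ht] at hx
    have htouch : (Test.lt (Expr.reg r) hi).touch t = 0 := by simp [hi0]
    rw [wp_seq, htouch]
    refine (hbody (t.reg r) (t.charge ((Test.lt (Expr.reg r) hi).cost t + 1) 0) h1 hx rfl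
      (hI' _ _ _ ht)).mono ?_
    rintro t' ⟨hr, ht', htime'⟩
    rw [wp_assign]
    have hsub : b - t.reg r = (b - (t.reg r + 1)) + 1 := by omega
    rw [hsub, Nat.mul_add] at htime
    refine ⟨by simp [hr]; omega, by simp [hr]; omega, ?_, ?_⟩
    · simp only [State.setReg_reg, Function.update_self, Expr.eval_add, Expr.eval_reg,
        Expr.eval_one, hr, Expr.touch_add, Expr.touch_reg, Expr.touch_one]
      have : (0 : Arr → ℕ) ⊔ 0 = 0 := sup_idem 0
      rw [this]
      exact hI _ _ _ _ ht'
    · simp [hr] at htime' ⊢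
      omega
  · rintro t ⟨h1, h2, ht, htime⟩ hx
    simp only [Test.eval_lt_false, Expr.eval_reg, hhi _ _ ht] at hx
    have hb : t.reg r = b := le_antisymm h2 hx
    have htouch : (Test.lt (Expr.reg r) hi).touch t = 0 := by simp [hi0]
    rw [htouch]
    rw [hb] at ht htime
    refine hQ _ (hI' _ _ _ ht) ?_
    simp at htime ⊢
    omega

/-- The contents of the arrays for `In_trs` after initialization, as far as they matter for the
running time. -/
structure InLists (nQ nT N : ℕ) (inF inL inE : ℕ → ℕ) : Prop where
  index_lt : ∀ q k, 1 ≤ q → q ≤ nQ → inF q ≤ k → k < inL q → k < N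
  one_le_inE : ∀ q k, 1 ≤ q → q ≤ nQ → inF q ≤ k → k < inL q → 1 ≤ inE k
  inE_le : ∀ q k, 1 ≤ q → q ≤ nQ → inF q ≤ k → k < inL q → inE k ≤ nT
  sum_le : ∑ q ∈ Finset.Icc 1 nQ, (inL q - inF q) ≤ nT

/-- The input sizes and the heads of the transitions are as they should be, and all cells used so
far have indices below `N`. -/
structure HeadOk (nQ nT N : ℕ) (s : State) : Prop where
  regQ : s.reg .nQ = nQ
  regT : s.reg .nT = nT
  one_le : ∀ t, 1 ≤ t → t ≤ nT → 1 ≤ s.arr .head t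
  le : ∀ t, 1 ≤ t → t ≤ nT → s.arr .head t ≤ nQ
  bound : 2 * nT + nQ + 3 ≤ N
  ext : Within N s.ext

theorem HeadOk.of_frame {nQ nT N : ℕ} {s t : State} {L : List Reg} {M : List Arr}
    (h : HeadOk nQ nT N s) (hf : Frame L M s t) (h1 : Reg.nQ ∉ L) (h2 : Reg.nT ∉ L)
    (h3 : Arr.head ∉ M) (hx : Within N t.ext) : HeadOk nQ nT N t := by
  refine ⟨(hf.reg _ h1).trans h.regQ, (hf.reg _ h2).trans h.regT, ?_, ?_, h.bound, hx⟩
  · rw [hf.arr _ h3]; exact h.one_le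
  · rw [hf.arr _ h3]; exact h.le

/-- The counters of the counting sort are set to `0`. -/
theorem wp_clearCounts {nQ nT N : ℕ} {s : State} (hs : HeadOk nQ nT N s) :
    wp (.forUp .q 1 (Reg.nQ + 1) (.store .inLim Reg.q 0)) s fun t =>
      Frame [.q] [.inLim] s t ∧ Within N t.ext ∧ (∀ q, 1 ≤ q → q ≤ nQ → t.arr .inLim q = 0) ∧
      t.time ≤ s.time + 10 + 20 * nQ := by
  have hN := hs.bound
  refine wp_forUp (a := 1) (b := nQ + 1) (k := 5) (fun i t => Frame [.q] [.inLim] s t ∧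
    Within N t.ext ∧ ∀ q, 1 ≤ q → q < i → t.arr .inLim q = 0) ?_ ?_ ?_ ?_ ?_ ?_ ?_ ?_ ?_
  · simp
  · simp
  · simp
  · simp
  · rintro i t ⟨hf, -⟩
    simp [hf.reg .nQ (by decide), hs.regQ]
  · rintro i t k v ⟨hf, hx, h⟩
    exact ⟨by rwa [Frame.setReg (by decide), Frame.charge], by simp [hx], h⟩
  · exact ⟨Frame.refl, hs.ext, fun q h1 h2 => by omega⟩
  · rintro i t h1 h2 hi ⟨hf, hx, h⟩
    rw [wp_store]
    refine ⟨hi, ⟨?_, ?_, ?_⟩, ?_⟩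
    · rwa [Frame.setArr (by decide), Frame.charge]
    · simp [hx, hi]
      omega
    · intro q hq1 hq2
      simp [hi, Function.update_apply]
      intro hqi
      exact h q hq1 (by omega)
    · simp
  · rintro t ⟨hf, hx, h⟩ ht
    refine ⟨hf, hx, fun q h1 h2 => h q h1 (by omega), ?_⟩
    simp at ht
    omega

theorem sum_update_succ {S : Finset ℕ} {f : ℕ → ℕ} {v : ℕ} (hv : v ∈ S) :
    ∑ q ∈ S, Function.update f v (f v + 1) q = ∑ q ∈ S, f q + 1 := by
  have := sum_add_eq_of_eq_off (f := f) (g := Function.update f v (f v + 1)) hv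
    (fun x _ hx => by simp [hx])
  simp only [Function.update_self] at this
  omega

/-- After counting, the counters add up to the number of transitions. -/
theorem wp_count {nQ nT N : ℕ} {s : State} (hs : HeadOk nQ nT N s)
    (h0 : ∀ q, 1 ≤ q → q ≤ nQ → s.arr .inLim q = 0) :
    wp (.forUp .t 1 (Reg.nT + 1) (
      .store .inLim (.get .head Reg.t) (.get .inLim (.get .head Reg.t) + 1))) s fun t =>
      Frame [.t] [.inLim] s t ∧ Within N t.ext ∧
      ∑ q ∈ Finset.Icc 1 nQ, t.arr .inLim q = nT ∧ t.time ≤ s.time + 10 + 30 * nT := by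
  have hN := hs.bound
  refine wp_forUp (a := 1) (b := nT + 1) (k := 15) (fun i t => Frame [.t] [.inLim] s t ∧
    Within N t.ext ∧ ∑ q ∈ Finset.Icc 1 nQ, t.arr .inLim q + 1 = i) ?_ ?_ ?_ ?_ ?_ ?_ ?_ ?_ ?_
  · simp
  · simp
  · simp
  · simp
  · rintro i t ⟨hf, -⟩
    simp [hf.reg .nT (by decide), hs.regT]
  · rintro i t k v ⟨hf, hx, h⟩
    exact ⟨by rwa [Frame.setReg (by decide), Frame.charge], by simp [hx], h⟩
  · refine ⟨Frame.refl, hs.ext, ?_⟩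
    rw [Finset.sum_eq_zero]
    intro q hq
    rw [Finset.mem_Icc] at hq
    exact h0 q hq.1 hq.2
  · rintro i t h1 h2 hi ⟨hf, hx, h⟩
    have hh := hf.arr .head (by decide)
    have g1 := hs.one_le i h1 (by omega)
    have g2 := hs.le i h1 (by omega)
    rw [wp_store]
    refine ⟨hi, ⟨?_, ?_, ?_⟩, ?_⟩
    · rwa [Frame.setArr (by decide), Frame.charge]
    · simp [hx, hi, hh]
      omega
    · simp only [State.setArr_arr, State.charge_arr, Function.update_self, Expr.eval_get,
        Expr.eval_reg, Expr.eval_add, Expr.eval_one, hi, hh]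
      rw [sum_update_succ (Finset.mem_Icc.2 ⟨g1, g2⟩), h]
    · simp
  · rintro t ⟨hf, hx, h⟩ ht
    refine ⟨hf, hx, by omega, ?_⟩
    simp at ht
    omega

/-- The lists become empty; they start at the partial sums of the counters, below `nT + 2`. -/
theorem wp_prefixSums {nQ nT N : ℕ} {s : State} (hs : HeadOk nQ nT N s)
    (h0 : ∑ q ∈ Finset.Icc 1 nQ, s.arr .inLim q = nT) (hk : s.reg .k = 1) :
    wp (.forUp .q 1 (Reg.nQ + 1) (
      .store .inFirst Reg.q Reg.k ;;
      .k ::= Reg.k + .get .inLim Reg.q ;;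
      .store .inLim Reg.q (.get .inFirst Reg.q))) s fun t =>
      Frame [.q, .k] [.inLim, .inFirst] s t ∧ Within N t.ext ∧
      (∀ q, 1 ≤ q → q ≤ nQ → t.arr .inLim q = t.arr .inFirst q ∧ t.arr .inFirst q ≤ nT + 1) ∧
      t.time ≤ s.time + 10 + 30 * nQ := by
  have hN := hs.bound
  refine wp_forUp (a := 1) (b := nQ + 1) (k := 20) (fun i t =>
    Frame [.q, .k] [.inLim, .inFirst] s t ∧ Within N t.ext ∧
    (∀ q, 1 ≤ q → q < i → t.arr .inLim q = t.arr .inFirst q ∧ t.arr .inFirst q ≤ nT + 1) ∧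
    t.reg .k + ∑ q ∈ Finset.Ico i (nQ + 1), t.arr .inLim q ≤ nT + 1) ?_ ?_ ?_ ?_ ?_ ?_ ?_ ?_ ?_
  · simp
  · simp
  · simp
  · simp
  · rintro i t ⟨hf, -⟩
    simp [hf.reg .nQ (by decide), hs.regQ]
  · rintro i t k v ⟨hf, hx, h, hk⟩
    exact ⟨by rwa [Frame.setReg (by decide), Frame.charge], by simp [hx], h, by simpa using hk⟩
  · refine ⟨Frame.refl, hs.ext, fun q h1 h2 => by omega, ?_⟩
    have : Finset.Ico 1 (nQ + 1) = Finset.Icc 1 nQ := rfl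
    rw [this, h0, hk]
    omega
  · rintro i t h1 h2 hi ⟨hf, hx, h, hk⟩
    rw [Finset.sum_eq_sum_Ico_succ_bot h2] at hk
    simp only [wp_seq, wp_store, wp_assign]
    refine ⟨by simp [hi], ⟨by simpa using hf, ?_, ?_, ?_⟩, by simp⟩
    · simp [hx, hi]
      omega
    · intro q hq1 hq2
      by_cases hqi : q = i
      · subst hqi
        simp [hi]
        omega
      · simpa [hi, hqi] using h q hq1 (by omega)
    · simp [hi]
      rw [Finset.sum_congr rfl (g := fun q => t.arr .inLim q)]
      · omega
      · intro q hq
        rw [Finset.mem_Ico] at hq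
        rw [Function.update_of_ne (by omega)]
  · rintro t ⟨hf, hx, h, hk⟩ ht
    refine ⟨hf, hx, fun q h1 h2 => h q h1 (by omega), ?_⟩
    simp at ht
    omega

/-- The transitions are appended to the lists. Each of them increases the total length of the lists
by exactly `1`, whatever positions the lists start at. -/
theorem wp_distribute {nQ nT N : ℕ} {s : State} (hs : HeadOk nQ nT N s)
    (h0 : ∀ q, 1 ≤ q → q ≤ nQ → s.arr .inLim q = s.arr .inFirst q ∧ s.arr .inFirst q ≤ nT + 1) :
    wp (.forUp .t 1 (Reg.nT + 1) (
      .store .inElems (.get .inLim (.get .head Reg.t)) Reg.t ;;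
      .store .inLim (.get .head Reg.t) (.get .inLim (.get .head Reg.t) + 1))) s fun t =>
      Frame [.t] [.inLim, .inElems] s t ∧ Within N t.ext ∧
      InLists nQ nT N (t.arr .inFirst) (t.arr .inLim) (t.arr .inElems) ∧
      t.time ≤ s.time + 10 + 40 * nT := by
  have hN := hs.bound
  refine wp_forUp (a := 1) (b := nT + 1) (k := 25) (fun i t =>
    Frame [.t] [.inLim, .inElems] s t ∧ Within N t.ext ∧
    (∀ q, 1 ≤ q → q ≤ nQ → s.arr .inFirst q ≤ t.arr .inLim q) ∧
    (∀ q k, 1 ≤ q → q ≤ nQ → s.arr .inFirst q ≤ k → k < t.arr .inLim q →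
      1 ≤ t.arr .inElems k ∧ t.arr .inElems k ≤ nT) ∧
    ∑ q ∈ Finset.Icc 1 nQ, (t.arr .inLim q - s.arr .inFirst q) + 1 = i)
    ?_ ?_ ?_ ?_ ?_ ?_ ?_ ?_ ?_
  · simp
  · simp
  · simp
  · simp
  · rintro i t ⟨hf, -⟩
    simp [hf.reg .nT (by decide), hs.regT]
  · rintro i t k v ⟨hf, hx, h⟩
    exact ⟨by rwa [Frame.setReg (by decide), Frame.charge], by simp [hx], h⟩
  · refine ⟨Frame.refl, hs.ext, fun q h1 h2 => (h0 q h1 h2).1.ge, fun q k h1 h2 h3 h4 => ?_, ?_⟩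
    · have := (h0 q h1 h2).1
      omega
    · rw [Finset.sum_eq_zero]
      intro q hq
      rw [Finset.mem_Icc] at hq
      have := (h0 q hq.1 hq.2).1
      omega
  · rintro i t h1 h2 hi ⟨hf, hx, hle, hmem, hsum⟩
    have hh := hf.arr .head (by decide)
    have g1 := hs.one_le i h1 (by omega)
    have g2 := hs.le i h1 (by omega)
    have hmemI : s.arr .head i ∈ Finset.Icc 1 nQ := Finset.mem_Icc.2 ⟨g1, g2⟩
    have g3 := Finset.single_le_sum (f := fun q => t.arr .inLim q - s.arr .inFirst q)
      (fun q _ => Nat.zero_le _) hmemI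
    have g4 := (h0 _ g1 g2).2
    have g5 := hle _ g1 g2
    simp only [wp_seq, wp_store]
    refine ⟨by simp [hi], ⟨by simpa using hf, ?_, ?_, ?_, ?_⟩, by simp⟩
    · simp [hx, hi, hh]
      omega
    · intro q hq1 hq2
      have := hle q hq1 hq2
      simp [hi, hh, Function.update_apply]
      split_ifs with hq
      · subst hq; omega
      · exact this
    · intro q k hq1 hq2 hk1 hk2
      simp [hi, hh] at hk2 ⊢
      by_cases hk : k = t.arr .inLim (s.arr .head i)
      · subst hk
        simp
        omega
      · rw [Function.update_of_ne hk]
        refine hmem q k hq1 hq2 hk1 ?_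
        by_cases hq : q = s.arr .head i
        · subst hq
          simp at hk2
          omega
        · rwa [Function.update_of_ne hq] at hk2
    · simp [hi, hh]
      have := sum_add_eq_of_eq_off (f := fun q => t.arr .inLim q - s.arr .inFirst q)
        (g := fun q => Function.update (t.arr .inLim) (s.arr .head i)
          (t.arr .inLim (s.arr .head i) + 1) q - s.arr .inFirst q) hmemI
        (fun x _ hx => by simp [hx])
      simp only [Function.update_self] at this
      omega
  · rintro t ⟨hf, hx, hle, hmem, hsum⟩ ht
    have hF := hf.arr .inFirst (by decide)
    refine ⟨hf, hx, ⟨?_, ?_, ?_, ?_⟩, ?_⟩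
    · intro q k h1 h2 h3 h4
      have g3 := Finset.single_le_sum (f := fun q => t.arr .inLim q - s.arr .inFirst q)
        (fun q _ => Nat.zero_le _) (Finset.mem_Icc.2 ⟨h1, h2⟩)
      have g4 := (h0 q h1 h2).2
      omega
    · rw [hF]
      exact fun q k h1 h2 h3 h4 => (hmem q k h1 h2 h3 h4).1
    · rw [hF]
      exact fun q k h1 h2 h3 h4 => (hmem q k h1 h2 h3 h4).2
    · rw [hF]
      omega
    · simp at ht
      omega

theorem wp_initInTrs {nQ nT N : ℕ} {s : State} (hs : HeadOk nQ nT N s) :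
    wp initInTrs s fun t => Frame [.q, .t, .k] [.inLim, .inFirst, .inElems] s t ∧
      HeadOk nQ nT N t ∧ InLists nQ nT N (t.arr .inFirst) (t.arr .inLim) (t.arr .inElems) ∧
      t.time ≤ s.time + 50 + 70 * (nQ + nT) := by
  rw [initInTrs, wp_seq]
  refine (wp_clearCounts hs).mono ?_
  rintro t₁ ⟨hf₁, hx₁, h₁, ht₁⟩
  have hs₁ := hs.of_frame hf₁ (by decide) (by decide) (by decide) hx₁
  rw [wp_seq]
  refine (wp_count hs₁ h₁).mono ?_
  rintro t₂ ⟨hf₂, hx₂, h₂, ht₂⟩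
  have hs₂ := hs₁.of_frame hf₂ (by decide) (by decide) (by decide) hx₂
  rw [wp_seq, wp_assign, wp_seq]
  refine (wp_prefixSums (nQ := nQ) (nT := nT) (N := N) ?_ ?_ ?_).mono ?_
  · exact hs₂.of_frame (L := [.k]) (M := []) (by simp) (by decide) (by decide) (by decide)
      (by simp [hx₂])
  · exact h₂
  · simp
  rintro t₃ ⟨hf₃, hx₃, h₃, ht₃⟩
  rw [Frame.setReg_left (by decide), Frame.charge_left] at hf₃
  have hs₃ := hs₂.of_frame hf₃ (by decide) (by decide) (by decide) hx₃
  refine (wp_distribute hs₃ h₃).mono ?_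
  rintro t₄ ⟨hf₄, hx₄, h₄, ht₄⟩
  refine ⟨?_, hs₃.of_frame hf₄ (by decide) (by decide) (by decide) hx₄, h₄, ?_⟩
  · exact (((hf₁.mono (by decide) (by decide)).trans (hf₂.mono (by decide) (by decide))).trans
      (hf₃.mono (by decide) (by decide))).trans (hf₄.mono (by decide) (by decide))
  · simp at ht₃
    omega

/-- The arrays of a refinable partition. -/
def partArrs (P : RPart) : List Arr :=
  [.part P .elems, .part P .loc, .part P .sidx, .part P .first, .part P .lim, .part P .mid]

@[simp] theorem mem_partArrs {P : RPart} {A : Arr} : A ∈ partArrs P ↔ ∃ f, A = .part P f := by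
  constructor
  · intro h
    simp only [partArrs, List.mem_cons, List.not_mem_nil, or_false] at h
    rcases h with h | h | h | h | h | h <;> exact ⟨_, h⟩
  · rintro ⟨f, rfl⟩
    cases f <;> simp [partArrs]

/-- The partition of `{1, …, n}` into one set, or into no set if `n = 0`. -/
theorem wp_setup {P : RPart} {m : Reg} {n N : ℕ} {s : State} (hm : s.reg m = n)
    (hmP : m ≠ .sets P) (hmi : m ≠ .i) (hN : n + 1 < N) (hx : Within N s.ext) :
    wp (P.setup m) s fun t => Frame [.sets P, .i] (partArrs P) s t ∧ (t.rp P).Valid n ∧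
      (t.rp P).marks = 0 ∧ Within N t.ext ∧ t.time ≤ s.time + 50 + 40 * n := by
  rw [RPart.setup]
  refine wp_cond (fun h => ?_) (fun h => ?_)
  · simp [hm] at h
    subst h
    rw [wp_assign]
    refine ⟨by simp, ?_, ?_, by simp [hx], by simp⟩
    · constructor <;> intros <;> simp [State.rp] at * <;> omega
    · simp [RP.marks, State.rp]
  · simp [hm] at h
    simp only [wp_seq, wp_assign, RPart.setFirst, RPart.setMid, RPart.setLim, wp_store]
    refine wp_weaken (fun t => Frame [.sets P, .i] (partArrs P) s t ∧ Within N t.ext ∧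
      t.reg m = n ∧ t.reg (.sets P) = 1 ∧ t.arr (.part P .first) 1 = 1 ∧
      t.arr (.part P .mid) 1 = 1 ∧ t.arr (.part P .lim) 1 = n + 1 ∧
      t.time ≤ s.time + 20) ?_ ?_
    · refine ⟨by simp, ?_, ?_, ?_, ?_, ?_, ?_, ?_⟩
      · simp [hx]; omega
      · simp [hmP, hm]
      · simp
      · simp
      · simp
      · simp [hmP, hm]
      · simp
    rintro t₀ ⟨hf₀, hx₀, hm₀, hsets, hfirst, hmid, hlim, ht₀⟩
    refine wp_forUp (a := 1) (b := n + 1) (k := 15) (fun i t =>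
      Frame [.i] [.part P .elems, .part P .loc, .part P .sidx] t₀ t ∧ Within N t.ext ∧
      ∀ j, 1 ≤ j → j < i → t.arr (.part P .elems) j = j ∧ t.arr (.part P .loc) j = j ∧
        t.arr (.part P .sidx) j = 1) ?_ ?_ ?_ ?_ ?_ ?_ ?_ ?_ ?_
    · simp
    · simp
    · simp
    · simp
    · rintro i t ⟨hf, -⟩
      simp [hf.reg m (by simp [hmi]), hm₀]
    · rintro i t k v ⟨hf, hx, h⟩
      exact ⟨by rwa [Frame.setReg (by decide), Frame.charge], by simp [hx], h⟩
    · exact ⟨Frame.refl, hx₀, fun j h1 h2 => by omega⟩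
    · rintro i t h1 h2 hi ⟨hf, hx, h⟩
      simp only [wp_seq, RPart.setElems, RPart.setLoc, RPart.setSidx, wp_store]
      refine ⟨by simp [hi], ⟨by simpa using hf, ?_, ?_⟩, by simp⟩
      · simp [hx, hi]
        omega
      · intro j hj1 hj2
        by_cases hji : j = i
        · subst hji
          simp [hi]
        · simpa [hi, hji] using h j hj1 (by omega)
    · rintro t ⟨hf, hx, h⟩ ht
      have e1 : (t.rp P).sets = 1 := (hf.reg _ (by simp)).trans hsets
      have e2 : (t.rp P).first 1 = 1 :=
        (congrFun (hf.arr (.part P .first) (by simp)) 1).trans hfirst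
      have e3 : (t.rp P).mid 1 = 1 := (congrFun (hf.arr (.part P .mid) (by simp)) 1).trans hmid
      have e4 : (t.rp P).lim 1 = n + 1 :=
        (congrFun (hf.arr (.part P .lim) (by simp)) 1).trans hlim
      have e5 : ∀ j, 1 ≤ j → j ≤ n → (t.rp P).elems j = j := fun j h1 h2 => (h j h1 (by omega)).1
      have e6 : ∀ j, 1 ≤ j → j ≤ n → (t.rp P).loc j = j := fun j h1 h2 => (h j h1 (by omega)).2.1
      have e7 : ∀ j, 1 ≤ j → j ≤ n → (t.rp P).sidx j = 1 :=
        fun j h1 h2 => (h j h1 (by omega)).2.2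
      refine ⟨?_, ?_, ?_, hx, ?_⟩
      · exact hf₀.trans (hf.mono (by simp) (by simp))
      · constructor
        case sum_size_le => simp [e1, e2, e4]
        all_goals
          intros
          first
          | grind
      · simp [RP.marks, e1, e2, e3]
      · simp at ht
        omega

/-- The registers that the initialization of the data structures may change. -/
def initRegs : List Reg :=
  [.size .unreadySpls, .size .touchedBlocks, .size .touchedSpls, .q, .t, .k, .i, .sets .brp,
    .sets .trp]

/-- The arrays that the initialization of the data structures may change. -/
def initArrs : List Arr :=
  [.inLim, .inFirst, .inElems] ++ partArrs .brp ++ partArrs .trp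

/-- The effect of the initialization of the data structures. -/
structure InitPost (nQ nT N : ℕ) (s t : State) : Prop where
  frame : Frame initRegs initArrs s t
  lists : InLists nQ nT N (t.arr .inFirst) (t.arr .inLim) (t.arr .inElems)
  brp : (t.rp .brp).Valid nQ
  brp_marks : (t.rp .brp).marks = 0
  trp : (t.rp .trp).Valid nT
  trp_marks : (t.rp .trp).marks = 0
  size : ∀ B, t.reg (.size B) = 0
  ext : Within N t.ext
  time : t.time ≤ s.time + 200 + 110 * (nQ + nT)

theorem wp_initData {nQ nT N : ℕ} {s : State} (hs : HeadOk nQ nT N s) :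
    wp initData s (InitPost nQ nT N s) := by
  have hN := hs.bound
  simp only [initData, Bag.clear, wp_seq, wp_assign]
  refine wp_weaken (fun t => Frame [.size .unreadySpls, .size .touchedBlocks, .size .touchedSpls]
    [] s t ∧ (∀ B, t.reg (.size B) = 0) ∧ Within N t.ext ∧ t.time ≤ s.time + 6) ?_ ?_
  · refine ⟨by simp, ?_, by simp [hs.ext], by simp⟩
    intro B
    cases B <;> simp
  rintro t₁ ⟨hf₁, hB, hx₁, ht₁⟩
  refine (wp_initInTrs (hs.of_frame hf₁ (by decide) (by decide) (by decide) hx₁)).mono ?_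
  rintro t₂ ⟨hf₂, hs₂, hl, ht₂⟩
  refine (wp_setup (N := N) hs₂.regQ (by decide) (by decide) (by omega) hs₂.ext).mono ?_
  rintro t₃ ⟨hf₃, hv₃, hm₃, hx₃, ht₃⟩
  have hT : t₃.reg .nT = nT := (hf₃.reg _ (by decide)).trans hs₂.regT
  refine (wp_setup (N := N) hT (by decide) (by decide) (by omega) hx₃).mono ?_
  rintro t₄ ⟨hf₄, hv₄, hm₄, hx₄, ht₄⟩
  have hrp : t₄.rp .brp = t₃.rp .brp := hf₄.rp (by decide) (by simp)
  refine ⟨?_, ?_, ?_, ?_, hv₄, hm₄, ?_, hx₄, ?_⟩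
  · exact (((hf₁.mono (by decide) (by decide)).trans (hf₂.mono (by decide) (by decide))).trans
      (hf₃.mono (by decide) (by decide))).trans (hf₄.mono (by decide) (by decide))
  · rw [hf₄.arr .inFirst (by decide), hf₄.arr .inLim (by decide), hf₄.arr .inElems (by decide),
      hf₃.arr .inFirst (by decide), hf₃.arr .inLim (by decide), hf₃.arr .inElems (by decide)]
    exact hl
  · rw [hrp]; exact hv₃
  · rw [hrp]; exact hm₃
  · intro B
    rw [hf₄.reg _ (by simp), hf₃.reg _ (by simp), hf₂.reg _ (by simp), hB]
  · omega

/-! ### The main part -/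

/-- The registers that the initial refinement of the splitters may change. -/
def initSplittersRegs : List Reg :=
  [.t, .a, .p2, .sets .trp, .splitL, .markS, .markL, .markM]

/-- The initial refinement of the splitters takes linear time, since each round of the outer loop
advances register `t` by the length of a maximal run of transitions with the same label. -/
theorem wp_initSplitters {nT N : ℕ} {s : State} (hT : s.reg .nT = nT)
    (hR : (s.rp .trp).Valid nT) (hN : nT + 1 < N) (hx : Within N s.ext) :
    wp initSplitters s fun t => Frame initSplittersRegs (partArrs .trp) s t ∧
      (t.rp .trp).Valid nT ∧ Within N t.ext ∧
      t.time + 720 * (t.rp .trp).marks ≤ s.time + 720 * (s.rp .trp).marks + 1100 * nT + 20 := by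
  rw [initSplitters, wp_seq, wp_assign]
  refine wp_while (fun t => Frame initSplittersRegs (partArrs .trp) s t ∧
      (t.rp .trp).Valid nT ∧ Within N t.ext ∧ 1 ≤ t.reg .t ∧ t.reg .t ≤ nT + 1 ∧
      t.time + 720 * (t.rp .trp).marks + 1100 * (nT + 1 - t.reg .t) ≤
        s.time + 720 * (s.rp .trp).marks + 1100 * nT + 10)
    (s.time + 720 * (s.rp .trp).marks + 1100 * nT + 10) ?_ ?_ ?_ ?_
  · refine ⟨by simp [initSplittersRegs], ?_, by simp [hx], by simp, by simp, ?_⟩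
    · rw [State.rp_setReg (by decide)]; exact hR
    · rw [State.rp_setReg (by decide), State.rp_charge]
      simp
      omega
  · rintro t ⟨-, -, -, -, -, h⟩
    omega
  · rintro t ⟨hf, hR, hx, h1, h2, hcost⟩ hc
    have hnT : t.reg .nT = nT := (hf.reg _ (by decide)).trans hT
    simp [hnT] at hc
    rw [wp_seq, wp_assign, wp_seq]
    -- a maximal run of transitions with the label of transition `t`
    refine wp_while (fun u => Frame [.t, .a, .markS, .markL, .markM] (markArrs .trp) t u ∧
        (u.rp .trp).Valid nT ∧ Within N u.ext ∧ u.reg .a = t.arr .label (t.reg .t) ∧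
        t.reg .t ≤ u.reg .t ∧ u.reg .t ≤ nT + 1 ∧
        u.time + 720 * (u.rp .trp).marks + 900 * (nT + 1 - u.reg .t) ≤
          t.time + 720 * (t.rp .trp).marks + 900 * (nT + 1 - t.reg .t) + 20)
      (t.time + 720 * (t.rp .trp).marks + 900 * (nT + 1 - t.reg .t) + 20) ?_ ?_ ?_ ?_
    · refine ⟨by simp, ?_, ?_, by simp, by simp, by simpa using h2, ?_⟩
      · rw [State.rp_setReg (by decide)]; exact hR
      · simp [hx]
        omega
      · rw [State.rp_setReg (by decide), State.rp_charge, State.rp_charge]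
        simp
        omega
    · rintro u ⟨-, -, -, -, -, -, h⟩
      omega
    · rintro u ⟨hfu, hRu, hxu, hau, h1u, h2u, hcostu⟩ hcu
      have hnTu : u.reg .nT = nT := (hfu.reg _ (by decide)).trans hnT
      simp [hnTu] at hcu
      have hlt : u.reg .t < nT + 1 := by omega
      rw [wp_seq]
      refine (wp_mark (n := nT) (N := N) (v := u.reg .t) ?_ (by omega) (by omega) hN ?_ ?_).mono ?_
      · exact hRu
      · simp [Test.touch, hxu, hnTu, hlt]
        omega
      · intro s' hs'
        simp [hs'.reg .t (by decide)]
      · rintro u' ⟨hfu', hRu', hm', hxu', htime'⟩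
        have e1 : u'.reg .t = u.reg .t := hfu'.reg _ (by decide)
        have e2 : u'.reg .a = u.reg .a := hfu'.reg _ (by decide)
        rw [Frame.charge_left] at hfu'
        rw [wp_assign]
        refine ⟨?_, ?_, by simp [hxu'], ?_, ?_, ?_, ?_⟩
        · rw [Frame.setReg (by decide), Frame.charge]
          exact hfu.trans (hfu'.mono (by decide) (by decide))
        · rw [State.rp_setReg (by decide)]; exact hRu'
        · simp [e2, hau]
        · simp [e1]
          omega
        · simp [e1]
          omega
        · rw [State.rp_setReg (by decide), State.rp_charge]
          rw [State.rp_charge] at hm'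
          have hct : (Test.and (.lt Reg.t (Reg.nT + 1))
              (.eq (.get .label Reg.t) Reg.a)).cost u = 10 := by
            simp [Test.cost, hnTu, hlt]
          rw [State.charge_time, hct] at htime'
          simp [e1] at htime' ⊢
          omega
    · rintro u ⟨hfu, hRu, hxu, hau, h1u, h2u, hcostu⟩ hcu
      have hnTu : u.reg .nT = nT := (hfu.reg _ (by decide)).trans hnT
      have hlab : u.arr .label = t.arr .label := hfu.arr _ (by decide)
      -- the run contains at least transition `t` itself
      have hprog : t.reg .t < u.reg .t := by
        refine lt_of_le_of_ne h1u fun heq => ?_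
        have hlt : u.reg .t < nT + 1 := by omega
        have hev : (Test.and (.lt Reg.t (Reg.nT + 1))
            (.eq (.get .label Reg.t) Reg.a)).eval u = true := by
          rw [Test.eval_and, Bool.and_eq_true, Test.eval_lt_true, Test.eval_eq_true]
          simp [hnTu, hlt, hau, hlab, heq]
        rw [hev] at hcu
        cases hcu
      have hx1 : Within N ((Test.and (.lt Reg.t (Reg.nT + 1))
          (.eq (.get .label Reg.t) Reg.a)).touch u) := by
        simp only [Test.touch, within_sup]
        refine ⟨by simp, ?_⟩
        split_ifs
        · simp
          omega
        · simp
      have hct : (Test.and (.lt Reg.t (Reg.nT + 1))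
          (.eq (.get .label Reg.t) Reg.a)).cost u ≤ 10 := by
        simp only [Test.cost]
        split_ifs <;> simp
      have hsets := hRu.one_le_sidx 1 le_rfl (by omega)
      have hsets' := hRu.sidx_le 1 le_rfl (by omega)
      refine (wp_split (n := nT) (N := N) (v := 1) ?_ le_rfl ?_ hN ?_ (by decide) ?_ (by simp)
        (by simp)).mono ?_
      · exact hRu
      · exact hsets.trans hsets'
      · simp [hxu, hx1]
      · simp
      · rintro v ⟨hfv, hRv, hxv, hcases⟩
        have e1 : v.reg .t = u.reg .t := hfv.reg _ (by decide)
        rw [Frame.charge_left] at hfv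
        have key : v.time + 720 * (v.rp .trp).marks ≤
            u.time + 11 + 100 + 720 * (u.rp .trp).marks := by
          rcases hcases with h | h
          · have h3 := h.time
            have h4 := h.marks
            simp only [State.rp_charge, State.charge_time] at h3 h4
            omega
          · have h3 := h.time
            have h4 := RP.marks_cut (R := u.rp .trp) le_rfl (hsets.trans hsets')
            have h5 := h.rp
            rw [State.rp_charge] at h5
            rw [← h5] at h4
            simp only [State.rp_charge, State.charge_time] at h3
            omega
        refine ⟨?_, hRv, hxv, by omega, by omega, by omega⟩
        exact (hf.trans (hfu.mono (by decide) (by decide))).trans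
          (hfv.mono (by decide) (by decide))
  · rintro t ⟨hf, hR, hx, h1, h2, hcost⟩ hc
    refine ⟨by rwa [Frame.charge], hR, by simp [hx], ?_⟩
    rw [State.rp_charge]
    simp
    omega

/-- All splitters become unready; their sizes add up to at most the number `n` of transitions. -/
theorem wp_addSplitters {N n : ℕ} {s : State} (hR : (s.rp .trp).Valid n) (hN : n + 1 < N)
    (h0 : s.reg (.size .unreadySpls) = 0) (hx : Within N s.ext) :
    wp (.forUp .p 1 (Reg.sets .trp + 1) (Bag.unreadySpls.add Reg.p)) s fun t =>
      Frame [.p, .size .unreadySpls] [.bag .unreadySpls] s t ∧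
      (t.BagAll .unreadySpls fun p => 1 ≤ p ∧ p ≤ s.reg (.sets .trp)) ∧
      t.reg (.size .unreadySpls) ≤ s.reg (.sets .trp) ∧
      t.bagSum .unreadySpls (s.rp .trp).size ≤ n ∧ Within N t.ext ∧
      t.time ≤ s.time + 10 + 30 * n := by
  have hle : s.reg (.sets .trp) ≤ n := hR.sets_le
  refine wp_forUp (a := 1) (b := s.reg (.sets .trp) + 1) (k := 15) (fun i t =>
    Frame [.p, .size .unreadySpls] [.bag .unreadySpls] s t ∧
    (t.BagAll .unreadySpls fun p => 1 ≤ p ∧ p < i) ∧ t.reg (.size .unreadySpls) + 1 = i ∧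
    (∀ f, t.bagSum .unreadySpls f = ∑ x ∈ Finset.Ico 1 i, f x) ∧ Within N t.ext)
    ?_ ?_ ?_ ?_ ?_ ?_ ?_ ?_ ?_
  · simp
  · simp
  · simp
  · simp
  · rintro i t ⟨hf, -⟩
    simp [hf.reg (.sets .trp) (by decide)]
  · rintro i t k v ⟨hf, hall, hsz, hsum, hx⟩
    refine ⟨by rwa [Frame.setReg (by decide), Frame.charge], ?_, by simpa using hsz, ?_,
      by simp [hx]⟩
    · intro j hj
      simp at hj
      exact hall j hj
    · intro f
      rw [← hsum f]
      simp [State.bagSum]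
  · refine ⟨Frame.refl, ?_, by omega, ?_, hx⟩
    · intro j hj
      omega
    · intro f
      simp [State.bagSum, h0]
  · rintro i t h1 h2 hi ⟨hf, hall, hsz, hsum, hx⟩
    refine (wp_add (N := N) (by omega) (by simp) hx).mono ?_
    rintro t' ⟨hf', hsz', hsum', hall', hx', htime'⟩
    refine ⟨(hf'.reg _ (by decide)).trans hi, ⟨hf.trans (hf'.mono (by decide) (by decide)), ?_,
      by omega, ?_, hx'⟩, ?_⟩
    · refine hall' _ ?_ (hall.imp fun x hx => ⟨hx.1, by omega⟩)
      simp [hi, h1]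
    · intro f
      rw [hsum', hsum, Finset.sum_Ico_succ_top h1, Expr.eval_reg, hi]
    · simp at htime'
      omega
  · rintro t ⟨hf, hall, hsz, hsum, hx⟩ ht
    refine ⟨hf, hall.imp fun x hx => ⟨hx.1, by omega⟩, by omega, ?_, hx, ?_⟩
    · rw [hsum]
      exact hR.sum_size_le
    · simp at ht
      omega

/-- Marking the final states, of which there are at most `n`. -/
theorem wp_markFinals {n nF N : ℕ} {s : State} (hR : (s.rp .brp).Valid n) (hN : n + 1 < N)
    (hF : s.reg .nF = nF) (hle : nF ≤ n) (h1 : ∀ i, 1 ≤ i → i ≤ nF → 1 ≤ s.arr .finals i)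
    (h2 : ∀ i, 1 ≤ i → i ≤ nF → s.arr .finals i ≤ n) (hx : Within N s.ext) :
    wp (.forUp .i 1 (Reg.nF + 1) (RPart.brp.mark (.get .finals Reg.i))) s fun t =>
      Frame (.i :: markRegs) (markArrs .brp) s t ∧ (t.rp .brp).Valid n ∧
      (t.rp .brp).marks ≤ (s.rp .brp).marks + n ∧ Within N t.ext ∧
      t.time ≤ s.time + 10 + 60 * n := by
  refine wp_forUp (a := 1) (b := nF + 1) (k := 48) (fun i t =>
    Frame (.i :: markRegs) (markArrs .brp) s t ∧ (t.rp .brp).Valid n ∧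
    (t.rp .brp).marks + 1 ≤ (s.rp .brp).marks + i ∧ Within N t.ext) ?_ ?_ ?_ ?_ ?_ ?_ ?_ ?_ ?_
  · simp
  · simp
  · simp
  · simp
  · rintro i t ⟨hf, -⟩
    simp [hf.reg .nF (by decide), hF]
  · rintro i t k v ⟨hf, hR, hm, hx⟩
    refine ⟨by rwa [Frame.setReg (by decide), Frame.charge], ?_, ?_, by simp [hx]⟩
    · rw [State.rp_setReg (by decide)]; exact hR
    · rw [State.rp_setReg (by decide)]; exact hm
  · exact ⟨Frame.refl, hR, le_rfl, hx⟩
  · rintro i t hi1 hi2 hi ⟨hf, hR, hm, hx⟩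
    have hfin := hf.arr .finals (by decide)
    refine (wp_mark (n := n) (N := N) (v := s.arr .finals i) hR (h1 i hi1 (by omega))
      (h2 i hi1 (by omega)) hN hx ?_).mono ?_
    · intro s' hs'
      simp [hs'.reg .i (by decide), hs'.arr .finals (by decide), hi, hfin]
      omega
    · rintro t' ⟨hf', hR', hm', hx', htime'⟩
      refine ⟨(hf'.reg _ (by decide)).trans hi, ⟨hf.trans (hf'.mono (by decide) (by decide)), hR',
        by omega, hx'⟩, ?_⟩
      simp at htime'
      omega
  · rintro t ⟨hf, hR, hm, hx⟩ ht
    refine ⟨hf, hR, by omega, hx, ?_⟩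
    simp at ht
    have := Nat.mul_le_mul_left 58 hle
    omega

/-- The scan of the part of `mainPart` that marks the tails of the transitions in a splitter. -/
def markTailsLoop : Cmd :=
  .while (.not (.eq Reg.t 0)) (
    .q ::= .get .tail Reg.t ;;
    .b2 ::= RPart.brp.sidx Reg.q ;;
    .cond (RPart.brp.noMarks Reg.b2) (Bag.touchedBlocks.add Reg.b2) .skip ;;
    RPart.brp.mark Reg.q ;;
    RPart.trp.next .t Reg.t)

/-- The part of `mainPart` that marks the tails of the transitions in splitter `p`. -/
def markTails : Cmd :=
  .t ::= RPart.trp.elems (RPart.trp.first Reg.p) ;; markTailsLoop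

/-- The registers that marking the tails of the transitions in a splitter may change. -/
def markTailsRegs : List Reg := [.q, .b2, .t, .size .touchedBlocks, .markS, .markL, .markM]

/-- The arrays that marking the tails of the transitions in a splitter may change. -/
def markTailsArrs : List Arr := .bag .touchedBlocks :: markArrs .brp

/-- The elapsed time and the potential of the main part: every element of `Touched_Blocks` keeps
`400` units ready for an execution of `splitBlock`. -/
def mainCost (c : Ctx) (s : State) : ℕ := blockCost c s + 400 * s.reg (.size .touchedBlocks)

/-- Marking the tails of the transitions in a splitter costs `640` units for each transition,
including `400` for an entry of `Touched_Blocks` and `100` for the mark of a state. -/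
theorem wp_markTails {c : Ctx} {s : State} {x : ℕ} (hs : Core c s) (hx : s.reg .p = x)
    (h1 : 1 ≤ x) (h2 : x ≤ (s.rp .trp).sets) (hB : s.reg (.size .touchedBlocks) = 0) :
    wp markTails s fun t => Core c t ∧ Frame markTailsRegs markTailsArrs s t ∧
      (t.BagAll .touchedBlocks fun b => 1 ≤ b ∧ b ≤ (s.rp .brp).sets) ∧
      t.reg (.size .touchedBlocks) ≤ c.nT ∧
      mainCost c t ≤ mainCost c s + 640 * (s.rp .trp).size x + 20 := by
  have hxT := hs.trp.sets_le
  have hNT := c.nT_lt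
  have hNQ := c.nQ_lt
  have hfl := hs.trp.first_lt x h1 h2
  have hln := hs.trp.lim_le x h1 h2
  have hf1 := hs.trp.one_le_first x h1 h2
  have hsize : (s.rp .trp).size x = (s.rp .trp).lim x - (s.rp .trp).first x := rfl
  have core : ∀ t, Frame markTailsRegs markTailsArrs s t → (t.rp .brp).Valid c.nQ →
      Within c.N t.ext → Core c t := fun t hf hv hx =>
    hs.of_frame hf hv hx (by decide) (by decide) (by decide) (by decide)
  rw [markTails, wp_seq, wp_assign]
  refine wp_while (fun t => Frame markTailsRegs markTailsArrs s t ∧ (t.rp .brp).Valid c.nQ ∧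
      Within c.N t.ext ∧ (t.BagAll .touchedBlocks fun b => 1 ≤ b ∧ b ≤ (s.rp .brp).sets) ∧
      ∃ i, (s.rp .trp).Cursor x i (t.reg .t) ∧
      t.reg (.size .touchedBlocks) + ((s.rp .trp).lim x - i) ≤ c.nT ∧
      t.time + 100 * (t.rp .brp).marks + 400 * t.reg (.size .touchedBlocks) +
          640 * ((s.rp .trp).lim x - i) ≤
        s.time + 100 * (s.rp .brp).marks + 640 * (s.rp .trp).size x + 10)
    (s.time + 100 * (s.rp .brp).marks + 640 * (s.rp .trp).size x + 10) ?_ ?_ ?_ ?_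
  · refine ⟨?_, ?_, ?_, ?_, (s.rp .trp).first x, ⟨le_rfl, hfl.le, ?_⟩, ?_, ?_⟩
    · rw [Frame.setReg (by decide), Frame.charge]
      exact Frame.refl
    · rw [State.rp_setReg (by decide)]; exact hs.brp
    · simp only [State.rp] at h2 hxT hfl hln
      simp [hs.ext, hx]
      omega
    · intro j hj
      simp [hB] at hj
    · rw [if_pos hfl]
      simp [hx, State.rp]
    · simp [hB]
      omega
    · simp [State.rp_setReg, State.rp_charge, hB]
      omega
  · rintro t ⟨-, -, -, -, i, -, -, h⟩
    omega
  · rintro t ⟨hf, hv, hext, hall, i, hc, hsz, hcost⟩ hq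
    obtain ⟨hi1, hi2, hti⟩ := id hc
    have ht0 : t.reg .t ≠ 0 := by simpa using hq
    have hi : i < (s.rp .trp).lim x := by
      by_contra h
      rw [if_neg h] at hti
      exact ht0 hti
    rw [if_pos hi] at hti
    have ht1 := hs.trp.one_le_elems x i h1 h2 hi1 hi
    have ht2 := hs.trp.elems_le x i h1 h2 hi1 hi
    rw [← hti] at ht1 ht2
    have hq1 := c.one_le_tl _ ht1 ht2
    have hq2 := c.tl_le _ ht1 ht2
    have htail := (core t hf hv hext).tail
    rw [wp_seq, wp_assign]
    refine wp_weaken (fun u => Frame [.q] [] t u ∧ u.reg .q = c.tl (t.reg .t) ∧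
      Within c.N u.ext ∧ u.time ≤ t.time + 10) ?_ ?_
    · refine ⟨by simp, by simp [htail], ?_, by simp⟩
      simp [hext]
      omega
    rintro u ⟨hfu, hqu, hxu, htu⟩
    have hrpu : u.rp .brp = t.rp .brp := hfu.rp (by decide) (by decide)
    have hBu : u.reg (.size .touchedBlocks) = t.reg (.size .touchedBlocks) :=
      hfu.reg _ (by decide)
    have hassoc : ∀ {a b d e : Cmd} {Q : State → Prop}, wp (a ;; b ;; d) u (fun v => wp e v Q) →
        wp (a ;; b ;; d ;; e) u Q := by
      intro a b d e Q h
      simpa only [wp_seq] using h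
    refine hassoc ((wp_touch (B := .touchedBlocks) (x := .q) (y := .b2) (n := c.nQ) (N := c.N)
      hqu (by decide) (by decide) (by decide) (by decide) (by decide) (by rwa [hrpu]) hq1 hq2
      c.nQ_lt (by omega) hxu).mono ?_)
    rintro v ⟨hfv, hvv, hmv, hszv, hallv, hxv, htv⟩
    have hfv' : Frame markTailsRegs markTailsArrs t v :=
      (hfu.mono (by decide) (by decide)).trans (hfv.mono (by decide) (by decide))
    have hrpt : v.rp .trp = s.rp .trp := (hf.trans hfv').rp (by decide) (by decide)
    have htv' : v.reg .t = t.reg .t := (hfv.reg _ (by decide)).trans (hfu.reg _ (by decide))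
    have hallv' : v.BagAll .touchedBlocks fun b => 1 ≤ b ∧ b ≤ (s.rp .brp).sets := by
      have hsets : (t.rp .brp).sets = (s.rp .brp).sets := hf.reg (.sets .brp) (by decide)
      refine hallv _ ?_ (hfu.bagAll (by decide) (by decide) hall)
      rw [hrpu, ← hsets]
      exact ⟨hv.one_le_sidx _ hq1 hq2, hv.sidx_le _ hq1 hq2⟩
    rw [hrpu] at hmv
    refine (wp_next (n := c.nT) (N := c.N) (x := x) (i := i) (by rw [hrpt]; exact hs.trp) h1
      (by rw [hrpt]; exact h2) (by rw [hrpt, htv']; exact hc) (by omega) c.nT_lt hxv).mono ?_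
    rintro w ⟨hfw, hcw, hxw, htw⟩
    rw [hrpt] at hcw
    have hrpw : w.rp .brp = v.rp .brp := hfw.rp (by decide) (by decide)
    have hBw : w.reg (.size .touchedBlocks) = v.reg (.size .touchedBlocks) :=
      hfw.reg _ (by decide)
    refine ⟨(hf.trans hfv').trans (hfw.mono (by decide) (by decide)), by rwa [hrpw], hxw,
      hfw.bagAll (by decide) (by decide) hallv', i + 1, hcw, by omega, ?_⟩
    rw [hrpw, hBw]
    omega
  · rintro t ⟨hf, hv, hext, hall, i, hc, hsz, hcost⟩ hq
    have hspl := hf.splCost (by decide) (by decide) (by decide) (by decide) (by decide)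
    have hlog : (t.rp .brp).logSum c.nQ c.deg = (s.rp .brp).logSum c.nQ c.deg := by
      have a1 : (t.rp .brp).sidx = (s.rp .brp).sidx := hf.arr (.part .brp .sidx) (by decide)
      have a2 : (t.rp .brp).first = (s.rp .brp).first := hf.arr (.part .brp .first) (by decide)
      have a3 : (t.rp .brp).lim = (s.rp .brp).lim := hf.arr (.part .brp .lim) (by decide)
      unfold RP.logSum RP.size
      rw [a1, a2, a3]
    refine ⟨(core t hf hv hext).charge (by simp), by rwa [Frame.charge], hall, ?_, ?_⟩
    · rw [State.charge_reg]
      omega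
    · simp only [mainCost, blockCost_charge]
      simp [blockCost, hlog, hB]
      omega

/-- The part of `mainPart` that splits the touched blocks. -/
def splitTouchedBlocks : Cmd :=
  .while (.not Bag.touchedBlocks.isEmpty) (
    Bag.touchedBlocks.remove .b ;;
    splitBlock)

/-- Splitting the touched blocks is paid for by the entries of `Touched_Blocks`. -/
theorem wp_splitTouchedBlocks {c : Ctx} {s : State} (hs : Core c s)
    (hB : s.BagAll .touchedBlocks fun b => 1 ≤ b ∧ b ≤ (s.rp .brp).sets)
    (hsz : s.reg (.size .touchedBlocks) ≤ c.nT) (hT : s.reg (.size .touchedSpls) = 0) :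
    wp splitTouchedBlocks s fun t => Core c t ∧ t.reg (.size .touchedBlocks) = 0 ∧
      t.reg (.size .touchedSpls) = 0 ∧ mainCost c t ≤ mainCost c s + 10 := by
  have hNT := c.nT_lt
  refine wp_while (fun t => Core c t ∧
      (t.BagAll .touchedBlocks fun b => 1 ≤ b ∧ b ≤ (t.rp .brp).sets) ∧
      t.reg (.size .touchedBlocks) ≤ c.nT ∧ t.reg (.size .touchedSpls) = 0 ∧
      mainCost c t ≤ mainCost c s) (mainCost c s) ⟨hs, hB, hsz, hT, le_rfl⟩ ?_ ?_ ?_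
  · rintro t ⟨-, -, -, -, h⟩
    simp only [mainCost, blockCost, splCost, scanCost] at h ⊢
    omega
  · rintro t ⟨ht, hB, hsz, hT, hcost⟩ hq
    have hpos : 0 < t.reg (.size .touchedBlocks) := by
      simp [Bag.isEmpty] at hq
      omega
    rw [wp_seq]
    refine (wp_remove (N := c.N) ?_ ?_ (by decide) (by decide) ?_).mono ?_
    · simpa using hpos
    · rw [State.charge_reg]
      omega
    · simp [Bag.isEmpty, ht.ext]
    rintro t₁ ⟨hf₁, hsz₁, -, hall₁, hext₁, htime₁⟩
    rw [Frame.charge_left] at hf₁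
    obtain ⟨⟨hp1, hp2⟩, hB₁⟩ := hall₁ _ (State.bagAll_charge.2 hB)
    have hrp₁ : t₁.rp .brp = t.rp .brp := hf₁.rp (by decide) (by decide)
    have ht₁ : Core c t₁ := ht.of_frame hf₁ (by rw [hrp₁]; exact ht.brp) hext₁ (by decide)
      (by decide) (by decide) (by decide)
    have hspl := hf₁.splCost (by decide) (by decide) (by decide) (by decide) (by decide)
    refine (wp_splitBlock ht₁ rfl hp1 (by rw [hrp₁]; exact hp2)
      ((hf₁.reg _ (by decide)).trans hT)).mono ?_
    rintro t₂ ⟨ht₂, hf₂, hT₂, hsets, hcost₂⟩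
    have hsz₂ : t₂.reg (.size .touchedBlocks) = t₁.reg (.size .touchedBlocks) :=
      hf₂.reg _ (by decide)
    rw [hrp₁] at hsets
    simp [Bag.isEmpty] at hsz₁ htime₁
    refine ⟨ht₂, ?_, by omega, hT₂, ?_⟩
    · exact hf₂.bagAll (by decide) (by decide) (hB₁.imp fun b hb => ⟨hb.1, hb.2.trans hsets⟩)
    · simp only [mainCost, blockCost, hrp₁] at hcost hcost₂ ⊢
      omega
  · rintro t ⟨ht, hB, hsz, hT, hcost⟩ hq
    refine ⟨ht.charge (by simp [Bag.isEmpty]), ?_, hT, ?_⟩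
    · simpa [Bag.isEmpty] using hq
    · simp only [mainCost, blockCost_charge] at hcost ⊢
      simp [Bag.isEmpty] at hcost ⊢
      omega

/-- The loop of `mainPart`. -/
def mainLoop : Cmd :=
  .while (.not Bag.unreadySpls.isEmpty) (
    Bag.unreadySpls.remove .p ;;
    .t ::= RPart.trp.elems (RPart.trp.first Reg.p) ;;
    markTailsLoop ;;
    splitTouchedBlocks)

/-- In each round of the loop the splitter leaves `Unready_Spls`; the `700` units that its
transitions kept ready pay for the round, so the cost does not increase at all. -/
theorem wp_mainLoop {c : Ctx} {s : State} (hs : Core c s)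
    (hB : s.reg (.size .touchedBlocks) = 0) (hT : s.reg (.size .touchedSpls) = 0) :
    wp mainLoop s fun t => Within c.N t.ext ∧ t.time ≤ blockCost c s + 10 := by
  have hNT := c.nT_lt
  refine wp_while (fun t => Core c t ∧ t.reg (.size .touchedBlocks) = 0 ∧
      t.reg (.size .touchedSpls) = 0 ∧ blockCost c t ≤ blockCost c s) (blockCost c s)
    ⟨hs, hB, hT, le_rfl⟩ ?_ ?_ ?_
  · rintro t ⟨-, -, -, h⟩
    simp only [blockCost, splCost, scanCost] at h ⊢
    omega
  · rintro t ⟨ht, hB, hT, hcost⟩ hq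
    have hpos : 0 < t.reg (.size .unreadySpls) := by
      simp [Bag.isEmpty] at hq
      omega
    have hunle := ht.unready_le
    have hsetsle : t.reg (.sets .trp) ≤ c.nT := ht.trp.sets_le
    rw [wp_seq]
    refine (wp_remove (N := c.N) ?_ ?_ (by decide) (by decide) ?_).mono ?_
    · simpa using hpos
    · rw [State.charge_reg]
      omega
    · simp [Bag.isEmpty, ht.ext]
    rintro t₁ ⟨hf₁, hsz₁, hsum₁, hall₁, hext₁, htime₁⟩
    rw [Frame.charge_left] at hf₁
    obtain ⟨⟨hp1, hp2⟩, hU₁⟩ := hall₁ _ (State.bagAll_charge.2 ht.unready)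
    have hrpb : t₁.rp .brp = t.rp .brp := hf₁.rp (by decide) (by decide)
    have hrpt : t₁.rp .trp = t.rp .trp := hf₁.rp (by decide) (by decide)
    have hsets₁ : t₁.reg (.sets .trp) = t.reg (.sets .trp) := hf₁.reg _ (by decide)
    have hT₁ : t₁.reg (.size .touchedSpls) = 0 := (hf₁.reg _ (by decide)).trans hT
    have hB₁ : t₁.reg (.size .touchedBlocks) = 0 := (hf₁.reg _ (by decide)).trans hB
    simp [Bag.isEmpty] at hsz₁ htime₁
    have ht₁ : Core c t₁ := by
      refine ⟨?_, ?_, ?_, ?_, ?_, ?_, ?_, by omega, hext₁⟩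
      · exact (hf₁.arr _ (by decide)).trans ht.tail
      · exact (hf₁.arr _ (by decide)).trans ht.inFirst
      · exact (hf₁.arr _ (by decide)).trans ht.inLim
      · exact (hf₁.arr _ (by decide)).trans ht.inElems
      · rw [hrpb]; exact ht.brp
      · rw [hrpt]; exact ht.trp
      · rw [hsets₁]; exact hU₁
    have hun : unreadySize t₁ + (t.rp .trp).size (t₁.reg .p) = unreadySize t := by
      have := hsum₁ (t.rp .trp).size
      rw [unreadySize, hrpt]
      exact this
    have hsizepos : 1 ≤ (t.rp .trp).size (t₁.reg .p) := by
      have := ht.trp.first_lt _ hp1 hp2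
      rw [RP.size]
      omega
    rw [← wp_seq_assoc, wp_seq]
    refine (wp_markTails ht₁ rfl hp1 (by rw [hrpt]; exact hp2) hB₁).mono ?_
    rintro t₂ ⟨ht₂, hf₂, hB₂, hsz₂, hcost₂⟩
    have hsets₂ : (t₂.rp .brp).sets = (t₁.rp .brp).sets := hf₂.reg (.sets .brp) (by decide)
    refine (wp_splitTouchedBlocks ht₂ (by rw [hsets₂]; exact hB₂) hsz₂
      ((hf₂.reg _ (by decide)).trans hT₁)).mono ?_
    rintro t₃ ⟨ht₃, hB₃, hT₃, hcost₃⟩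
    refine ⟨ht₃, hB₃, hT₃, ?_⟩
    have e1 : blockCost c t₁ + 700 * (t.rp .trp).size (t₁.reg .p) ≤ blockCost c t + 30 := by
      simp only [blockCost, splCost, scanCost, hrpb, hrpt, hT, hT₁]
      omega
    rw [hrpt] at hcost₂
    simp only [mainCost, hB₃, hB₁] at hcost₂ hcost₃
    omega
  · rintro t ⟨ht, hB, hT, hcost⟩ hq
    refine ⟨by simp [Bag.isEmpty, ht.ext], ?_⟩
    have htime : t.time ≤ blockCost c s := by
      simp only [blockCost, splCost, scanCost] at hcost ⊢
      omega
    simp [Bag.isEmpty]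
    omega

/-- The conditions on the input, as stored in the machine, under which the bounds hold. -/
structure InputOk (nQ nT nF N : ℕ) (s : State) : Prop extends HeadOk nQ nT N s where
  regF : s.reg .nF = nF
  nF_le : nF ≤ nQ
  one_le_tail : ∀ t, 1 ≤ t → t ≤ nT → 1 ≤ s.arr .tail t
  tail_le : ∀ t, 1 ≤ t → t ≤ nT → s.arr .tail t ≤ nQ
  one_le_finals : ∀ i, 1 ≤ i → i ≤ nF → 1 ≤ s.arr .finals i
  finals_le : ∀ i, 1 ≤ i → i ≤ nF → s.arr .finals i ≤ nQ

/-- The logarithmic sum is at most its value for the partition into a single set. -/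
theorem RP.Valid.logSum_le {n : ℕ} {R : RP} (h : R.Valid n) (w : ℕ → ℕ) :
    R.logSum n w ≤ (∑ q ∈ Finset.Icc 1 n, w q) * Nat.log 2 n := by
  rw [RP.logSum, Finset.sum_mul]
  refine Finset.sum_le_sum fun q hq => Nat.mul_le_mul_left _ (Nat.log_mono_right ?_)
  rw [Finset.mem_Icc] at hq
  have h1 := h.one_le_sidx q hq.1 hq.2
  have h2 := h.sidx_le q hq.1 hq.2
  have := h.lim_le _ h1 h2
  have := h.one_le_first _ h1 h2
  rw [RP.size]
  omega

/-- The block-splitting stage in terms of the numbers of states and transitions. The final time is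
at most the cost at the beginning of the main loop. -/
theorem wp_blockSplitting {nQ nT nF N : ℕ} {s : State} (hs : InputOk nQ nT nF N s)
    (hQ : 1 ≤ nQ) :
    wp blockSplitting s fun t => Within N t.ext ∧
      t.time ≤ s.time + 700 + 300 * nQ + 3000 * nT + 1100 * (nT * Nat.log 2 nQ) := by
  have hN := hs.bound
  have hNQ : nQ + 1 < N := by omega
  have hNT : nT + 1 < N := by omega
  rw [blockSplitting, wp_seq]
  refine (wp_initData hs.toHeadOk).mono ?_
  rintro t₁ ⟨hf₁, hl, hb₁, hbm₁, ht₁, htm₁, hsz₁, hx₁, htime₁⟩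
  let c : Ctx :=
    { nQ := nQ, nT := nT, N := N, tl := s.arr .tail, inF := t₁.arr .inFirst,
      inL := t₁.arr .inLim, inE := t₁.arr .inElems, nQ_lt := hNQ, nT_lt := hNT,
      one_le_tl := hs.one_le_tail, tl_le := hs.tail_le, index_lt := hl.index_lt,
      one_le_inE := hl.one_le_inE, inE_le := hl.inE_le, sum_le := hl.sum_le }
  rw [mainPart, wp_seq]
  refine (wp_initSplitters ((hf₁.reg _ (by decide)).trans hs.regT) ht₁ hNT hx₁).mono ?_
  rintro t₂ ⟨hf₂, hv₂, hx₂, hcost₂⟩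
  rw [wp_seq]
  refine (wp_addSplitters hv₂ hNT ((hf₂.reg _ (by decide)).trans (hsz₁ _)) hx₂).mono ?_
  rintro t₃ ⟨hf₃, hall₃, hle₃, hsum₃, hx₃, htime₃⟩
  have hrpb₃ : t₃.rp .brp = t₁.rp .brp :=
    (hf₃.rp (by decide) (by decide)).trans (hf₂.rp (by decide) (by decide))
  have hfin₃ : t₃.arr .finals = s.arr .finals :=
    (hf₃.arr _ (by decide)).trans ((hf₂.arr _ (by decide)).trans (hf₁.arr _ (by decide)))
  have hF₃ : t₃.reg .nF = nF :=
    (hf₃.reg _ (by decide)).trans ((hf₂.reg _ (by decide)).trans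
      ((hf₁.reg _ (by decide)).trans hs.regF))
  rw [wp_seq]
  refine (wp_markFinals (n := nQ) (by rw [hrpb₃]; exact hb₁) hNQ hF₃ hs.nF_le
    (by rw [hfin₃]; exact hs.one_le_finals) (by rw [hfin₃]; exact hs.finals_le) hx₃).mono ?_
  rintro t₄ ⟨hf₄, hv₄, hm₄, hx₄, htime₄⟩
  have hrpt₄ : t₄.rp .trp = t₂.rp .trp :=
    (hf₄.rp (by decide) (by decide)).trans (hf₃.rp (by decide) (by decide))
  have hsets₄ : t₄.reg (.sets .trp) = t₂.reg (.sets .trp) :=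
    (hf₄.reg _ (by decide)).trans (hf₃.reg _ (by decide))
  have hszU : t₄.reg (.size .unreadySpls) = t₃.reg (.size .unreadySpls) := hf₄.reg _ (by decide)
  have hszT : t₄.reg (.size .touchedSpls) = 0 :=
    (hf₄.reg _ (by decide)).trans ((hf₃.reg _ (by decide)).trans
      ((hf₂.reg _ (by decide)).trans (hsz₁ _)))
  have hszB : t₄.reg (.size .touchedBlocks) = 0 :=
    (hf₄.reg _ (by decide)).trans ((hf₃.reg _ (by decide)).trans
      ((hf₂.reg _ (by decide)).trans (hsz₁ _)))
  have harr : ∀ A ∈ [Arr.inFirst, .inLim, .inElems, .tail], t₄.arr A = t₁.arr A := by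
    intro A hA
    simp only [List.mem_cons, List.not_mem_nil, or_false] at hA
    rcases hA with rfl | rfl | rfl | rfl <;>
      rw [hf₄.arr _ (by decide), hf₃.arr _ (by decide), hf₂.arr _ (by decide)]
  have hcore₄ : Core c t₄ := by
    refine ⟨?_, ?_, ?_, ?_, hv₄, ?_, ?_, ?_, hx₄⟩
    · exact (harr _ (by decide)).trans (hf₁.arr _ (by decide))
    · exact harr _ (by decide)
    · exact harr _ (by decide)
    · exact harr _ (by decide)
    · rw [hrpt₄]; exact hv₂
    · rw [hsets₄]
      exact hf₄.bagAll (by decide) (by decide) hall₃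
    · rw [hsets₄, hszU]; exact hle₃
  have hun : unreadySize t₄ ≤ nT := by
    rw [unreadySize, hrpt₄, hf₄.bagSum (by decide) (by decide)]
    exact hsum₃
  have hlog : (t₄.rp .brp).logSum nQ c.deg ≤ nT * Nat.log 2 nQ :=
    (hv₄.logSum_le c.deg).trans (Nat.mul_le_mul_right _ hl.sum_le)
  have hcost₄ : blockCost c t₄ ≤
      s.time + 260 + 270 * nQ + 2000 * nT + 1100 * (nT * Nat.log 2 nQ) := by
    have e : blockCost c t₄ = t₄.time + 720 * (t₄.rp .trp).marks +
      200 * t₄.reg (.size .touchedSpls) + 700 * unreadySize t₄ + 100 * (t₄.rp .brp).marks +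
      1100 * (t₄.rp .brp).logSum nQ c.deg := rfl
    rw [e, hrpt₄, hszT]
    rw [hrpb₃, hbm₁] at hm₄
    rw [htm₁] at hcost₂
    omega
  have hsets1 : 1 ≤ (t₄.rp .brp).sets :=
    (hv₄.one_le_sidx 1 le_rfl hQ).trans (hv₄.sidx_le 1 le_rfl hQ)
  rw [wp_seq, wp_assign, wp_seq]
  refine wp_weaken (fun t => Core c t ∧ t.reg .b = 1 ∧ 1 ≤ (t.rp .brp).sets ∧
    t.reg (.size .touchedSpls) = 0 ∧ t.reg (.size .touchedBlocks) = 0 ∧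
    blockCost c t ≤ blockCost c t₄ + 2) ?_ ?_
  · have hrp : ((t₄.charge ((1 : Expr).cost + 1) ((1 : Expr).touch t₄)).setReg .b
        ((1 : Expr).eval t₄)).rp .brp = t₄.rp .brp := by
      rw [State.rp_setReg (by decide), State.rp_charge]
    have hfr : Frame [.b] [] t₄ ((t₄.charge ((1 : Expr).cost + 1) ((1 : Expr).touch t₄)).setReg
        .b ((1 : Expr).eval t₄)) := by simp
    refine ⟨?_, by simp, by rw [hrp]; exact hsets1, ?_, ?_, ?_⟩
    · exact hcore₄.of_frame hfr (by rw [hrp]; exact hv₄) (by simp; exact hx₄) (by decide)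
        (by decide) (by decide) (by decide)
    · exact (hfr.reg _ (by decide)).trans hszT
    · exact (hfr.reg _ (by decide)).trans hszB
    · have hspl := hfr.splCost (by decide) (by decide) (by decide) (by decide) (by decide)
      have htm : ((t₄.charge ((1 : Expr).cost + 1) ((1 : Expr).touch t₄)).setReg .b
        ((1 : Expr).eval t₄)).time = t₄.time + 2 := rfl
      simp only [blockCost, hrp]
      omega
  rintro t₅ ⟨hcore₅, hb₅, hsets₅, hT₅, hB₅, hcost₅⟩
  refine (wp_splitBlock hcore₅ hb₅ le_rfl hsets₅ hT₅).mono ?_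
  rintro t₆ ⟨hcore₆, hf₆, hT₆, -, hcost₆⟩
  refine (wp_mainLoop hcore₆ ((hf₆.reg _ (by decide)).trans hB₅) hT₆).mono ?_
  rintro t₇ ⟨hx₇, htime₇⟩
  refine ⟨hx₇, ?_⟩
  omega

end Ram

/-! ### From the input to the machine -/

namespace PTDFA

variable {Q S : Type*} {D : PTDFA Q S}

/-- A state that is reached by a nonempty path is the end state of a transition. -/
theorem Path.eq_or_exists_trans {q q' : Q} {w : List S} (h : D.Path q w q') :
    q' = q ∨ ∃ r a, (r, a, q') ∈ D.δ := by
  cases h with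
  | nil => exact .inl rfl
  | snoc _ hd => exact .inr ⟨_, _, hd⟩

/-- If all states are relevant, each state but the initial one is the end state of a transition. -/
theorem card_le_of_relevant [Finite Q] (h : ∀ q, D.Relevant q) : Nat.card Q ≤ D.δ.card + 1 := by
  classical
  have := Fintype.ofFinite Q
  rw [Nat.card_eq_fintype_card, ← Finset.card_univ]
  calc (Finset.univ : Finset Q).card
      ≤ (insert D.init (D.δ.image fun e => e.2.2)).card := by
        refine Finset.card_le_card fun q _ => ?_
        rw [Finset.mem_insert, Finset.mem_image]
        rcases h q with rfl | ⟨_, _, w, _, hw, _⟩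
        · exact .inl rfl
        · rcases hw.eq_or_exists_trans with rfl | ⟨r, a, hra⟩
          · exact .inl rfl
          · exact .inr ⟨_, hra, rfl⟩
    _ ≤ (D.δ.image fun e => e.2.2).card + 1 := Finset.card_insert_le _ _
    _ ≤ D.δ.card + 1 := Nat.add_le_add_right Finset.card_image_le 1

theorem Presentation.num_le (P : D.Presentation) (q : Q) : P.num q ≤ Nat.card Q :=
  (P.state q).isLt

end PTDFA

namespace Ram

theorem Start.inputOk {Q S : Type*} [Finite Q] {D : PTDFA Q S} {P : D.Presentation} {s : State}
    (h : Start P s) :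
    InputOk (Nat.card Q) D.δ.card D.F.card (2 * D.δ.card + Nat.card Q + 3) s := by
  have hfin : ∀ {n t : ℕ}, 1 ≤ t → t ≤ n → ∃ i : Fin n, t = (i : ℕ) + 1 := fun {n t} h1 h2 =>
    ⟨⟨t - 1, by omega⟩, by simp; omega⟩
  refine ⟨⟨h.nQ, h.nT, ?_, ?_, le_rfl, ?_⟩, h.nF, ?_, ?_, ?_, ?_, ?_⟩
  · intro t h1 h2
    obtain ⟨i, rfl⟩ := hfin h1 h2
    rw [h.head]
    exact Nat.succ_pos _
  · intro t h1 h2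
    obtain ⟨i, rfl⟩ := hfin h1 h2
    rw [h.head]
    exact P.num_le _
  · rw [h.ext]
    exact within_zero
  · have := Fintype.ofFinite Q
    rw [Nat.card_eq_fintype_card]
    exact Finset.card_le_univ _
  · intro t h1 h2
    obtain ⟨i, rfl⟩ := hfin h1 h2
    rw [h.tail]
    exact Nat.succ_pos _
  · intro t h1 h2
    obtain ⟨i, rfl⟩ := hfin h1 h2
    rw [h.tail]
    exact P.num_le _
  · intro t h1 h2
    obtain ⟨i, rfl⟩ := hfin h1 h2
    rw [h.finals]
    exact Nat.succ_pos _
  · intro t h1 h2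
    obtain ⟨i, rfl⟩ := hfin h1 h2
    rw [h.finals]
    exact P.num_le _

theorem State.space_le {s : State} {N : ℕ} (h : Within N s.ext) :
    s.space ≤ Fintype.card Reg + Fintype.card Arr * N := by
  refine Nat.add_le_add_left ?_ _
  calc ∑ A : Arr, s.ext A ≤ ∑ _A : Arr, N := Finset.sum_le_sum fun A _ => h A
    _ = Fintype.card Arr * N := by simp

end Ram

theorem mainTheorem3 :
    ∃ C : ℝ, ∀ (Q S : Type*) [Finite Q] [Finite S] (D : PTDFA Q S)
      (P : D.Presentation) (s : Ram.State),
      (∀ q, D.Relevant q) → D.F.Nonempty → P.LabelsConsecutive → Ram.Start P s →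
      ∃ s' : Ram.State, Ram.Exec Ram.blockSplitting s s' ∧
        (2 ≤ Nat.card Q →
          (s'.time : ℝ) ≤ C * (D.δ.card * Real.logb 2 (Nat.card Q)) ∧
          (s'.space : ℝ) ≤ C * D.δ.card) ∧
        (Nat.card Q = 1 →
          (s'.time : ℝ) ≤ C * (D.δ.card + 1) ∧
          (s'.space : ℝ) ≤ C * (D.δ.card + 1)) := by
  refine ⟨6000 + Fintype.card Ram.Reg + 7 * Fintype.card Ram.Arr, ?_⟩
  intro Q S _ _ D P s hrel hF _ hstart
  have hcard := D.card_le_of_relevant hrel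
  have hQ : 1 ≤ Nat.card Q := by
    have : Nonempty Q := ⟨D.init⟩
    exact Nat.card_pos
  obtain ⟨s', hexec, hext, htime⟩ := Ram.wp_blockSplitting hstart.inputOk hQ
  have hspace := Ram.State.space_le hext
  rw [hstart.time] at htime
  refine ⟨s', hexec, ?_, ?_⟩
  · intro h2
    have hT : 1 ≤ D.δ.card := by omega
    have hlog : (Nat.log 2 (Nat.card Q) : ℝ) ≤ Real.logb 2 (Nat.card Q) := by
      exact_mod_cast Real.natLog_le_logb (Nat.card Q) 2
    have hlog1 : (1 : ℝ) ≤ Real.logb 2 (Nat.card Q) := by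
      rw [Real.le_logb_iff_rpow_le (by norm_num) (by positivity)]
      simpa using (by exact_mod_cast h2 : (2 : ℝ) ≤ (Nat.card Q : ℝ))
    have h1 : s'.time ≤ 4300 * D.δ.card + 1100 * (D.δ.card * Nat.log 2 (Nat.card Q)) := by omega
    have h1' : (s'.time : ℝ) ≤
        4300 * D.δ.card + 1100 * (D.δ.card * Nat.log 2 (Nat.card Q)) := by
      exact_mod_cast h1
    generalize Real.logb 2 (Nat.card Q) = l at hlog hlog1
    constructor
    · have e1 : (D.δ.card : ℝ) * Nat.log 2 (Nat.card Q) ≤ D.δ.card * l := by gcongr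
      have e2 : (D.δ.card : ℝ) ≤ D.δ.card * l := le_mul_of_one_le_right (by positivity) hlog1
      have e3 : (0 : ℝ) ≤ (Fintype.card Ram.Reg + 7 * Fintype.card Ram.Arr) * (D.δ.card * l) := by
        positivity
      linarith
    · have h3 : s'.space ≤
          (6000 + Fintype.card Ram.Reg + 7 * Fintype.card Ram.Arr) * D.δ.card := by
        calc s'.space ≤ Fintype.card Ram.Reg * D.δ.card + Fintype.card Ram.Arr * (7 * D.δ.card) :=
              hspace.trans (Nat.add_le_add (Nat.le_mul_of_pos_right _ hT)
                (Nat.mul_le_mul_left _ (by omega)))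
          _ ≤ 6000 * D.δ.card + (Fintype.card Ram.Reg * D.δ.card +
                Fintype.card Ram.Arr * (7 * D.δ.card)) := Nat.le_add_left _ _
          _ = _ := by ring
      exact_mod_cast h3
  · intro h1
    rw [h1] at htime hspace
    rw [Nat.log_one_right] at htime
    constructor
    · have h3 : s'.time ≤
          (6000 + Fintype.card Ram.Reg + 7 * Fintype.card Ram.Arr) * (D.δ.card + 1) := by
        calc s'.time ≤ 6000 * (D.δ.card + 1) := by omega
          _ ≤ _ := Nat.mul_le_mul_right _ (by rw [Nat.add_assoc]; exact Nat.le_add_right _ _)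
      exact_mod_cast h3
    · have h3 : s'.space ≤
          (6000 + Fintype.card Ram.Reg + 7 * Fintype.card Ram.Arr) * (D.δ.card + 1) := by
        calc s'.space ≤ Fintype.card Ram.Reg * (D.δ.card + 1) +
              Fintype.card Ram.Arr * (7 * (D.δ.card + 1)) :=
              hspace.trans (Nat.add_le_add (Nat.le_mul_of_pos_right _ (Nat.succ_pos _))
                (Nat.mul_le_mul_left _ (by omega)))
          _ ≤ 6000 * (D.δ.card + 1) + (Fintype.card Ram.Reg * (D.δ.card + 1) +
                Fintype.card Ram.Arr * (7 * (D.δ.card + 1))) := Nat.le_add_left _ _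
          _ = _ := by ring
      exact_mod_cast h3
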